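/- **Setting.** Let $M=\mathbb R^4$ be Minkowski space with coordinates $x=(x^0,\mathbf x)$ and metric $\eta=\mathrm{diag}(1,-1,-1,-1)$, and let $\nabla_a=\partial/\partial x^a$. Let $\gamma^0,\dots,\gamma^3$ be Dirac matrices, i.e. complex $4\times4$ matrices with $\gamma^a\gamma^b+\gamma^b\gamma^a=2\eta^{ab}$, $(\gamma^0)^\dagger=\gamma^0$, $(\gamma^i)^\dagger=-\gamma^i$ ($i=1,2,3$); put $\beta=\gamma^0$ and $\bar\psi=\psi^\dagger\gamma^0$. The free Dirac equation is $(i\gamma^a\nabla_a-1)\psi=0$. Let $\tau:M\to\mathbb R$ be a smooth function depending only on $x^0$ and $|\mathbf x|$, with everywhere timelike future-pointing gradient, whose level sets $\Sigma_s=\{\tau=s\}$, $s\in\mathbb R$, are all Cauchy surfaces (every inextendible causal curve meets each $\Sigma_s$ exactly once). Let $C_0^\infty(\Sigma_s,\mathbb C^4)$ be the space of smooth compactly supported $\mathbb C^4$-valued functions on $\Sigma_s$, let $$(\psi_1,\psi_2)_s=\int_{\Sigma_s}\overline{\psi_1}\gamma^a\psi_2\,d\sigma_a ,$$ where $d\sigma_a$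 is the dual integration element (in the coordinates $\mathbf x$ on $\Sigma_s$, $d\sigma_a=(\nabla_a\tau/\nabla_0\tau)\,d^3x$), and let $\mathcal H(\Sigma_s)$ be the space of measurable spinor functions on $\Sigma_s$, modulo equality almost everywhere, with $(\psi,\psi)_s<\infty$. **(i)** For all $s\in\mathbb R$ and $f\in C_0^\infty(\Sigma_s,\mathbb C^4)$ there is a unique smooth solution $\psi$ of the free Dirac equation on $M$ with $\psi|_{\Sigma_s}=f$. The map $U_0^\Sigma(t,s):f\mapsto\psi|_{\Sigma_t}$ is a linear bijection $C_0^\infty(\Sigma_s,\mathbb C^4)\to C_0^\infty(\Sigma_t,\mathbb C^4)$ for all $s,t\in\mathbb R$, it is isometric with respect to the products $(\cdot,\cdot)_s$ and $(\cdot,\cdot)_t$, and it is causal: every point of $\operatorname{supp}U_0^\Sigma(t,s)f$ lies in the causal future or past of a point of $\operatorname{supp}f$. Each $\mathcal H(\Sigma_s)$ is a Hilbert space in which $C_0^\infty(\Sigma_s,\mathbb C^4)$ is dense, and $U_0^\Sigma(t,s)$ extends by continuity to a unitary operator $\mathcal H(\Sigma_s)\to\mathcal H(\Sigma_t)$. **(ii)**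 Let moreover $(\xi^\mu)=(\tau,z^1,z^2,z^3):M\to\mathbb R^4$ be a smooth diffeomorphism with $\tau$ as above. Put $g_{\mu\nu}=\frac{\partial x^a}{\partial\xi^\mu}\frac{\partial x^b}{\partial\xi^\nu}\eta_{ab}$, $g_z=\det(g_{ij})_{i,j=1,2,3}$, $g^{\tau\tau}=\eta^{ab}\nabla_a\tau\nabla_b\tau$, $\hat\gamma^i=(\nabla_az^i)\gamma^a$, $n_a=(g^{\tau\tau})^{-1/2}\nabla_a\tau$, and $$K=\frac{1+\gamma^an_a\gamma^0}{\sqrt{2(1+n_0)}},\qquad \mu=(g^{\tau\tau})^{-1/2}\beta,\qquad \lambda^i=\mu K^{-1}\hat\gamma^iK ,$$ and denote by $\mu(s)$, $\lambda^i(s)$ these matrix functions on $\Sigma_s$, as functions of $\mathbf z\in\mathbb R^3$. Let $\mathcal H=\mathbb C^4\otimes L^2(\mathbb R^3,d^3z)$, $\mathcal D=C_0^\infty(\mathbb R^3,\mathbb C^4)\subset\mathcal H$, $p_i=-i\partial/\partial z^i$, and, as operators $\mathcal D\to\mathcal D$ (with $[\cdot,\cdot]_+$ the anticommutator and summation over $i$),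 $$H_0(s)=\tfrac12[\lambda^i(s),p_i]_++\mu(s),\qquad h_0=\tfrac12(\mathbf p^2+\mathbf z^2).$$ Then multiplication by $|g_z|^{-1/4}K$ defines a unitary operator $T_s:\mathcal H\to\mathcal H(\Sigma_s)$, $(T_s\chi)(x)=|g_z|^{-1/4}K(x)\,\chi(\mathbf z(x))$, for every $s$, and the operators $U_0(t,s)=T_t^{-1}U_0^\Sigma(t,s)T_s$ on $\mathcal H$ form a strongly continuous unitary evolution system: $U_0(s,s)=1$, $U_0(t,r)U_0(r,s)=U_0(t,s)$, and $(t,s)\mapsto U_0(t,s)\chi$ is continuous on $\mathbb R^2$ for each $\chi\in\mathcal H$. Moreover: (A) $U_0(t,s)\mathcal D=\mathcal D$, and causality is respected. That is, writing $x(s,\mathbf z)$ for the point with coordinates $(s,\mathbf z)$: if $\varphi\in\mathcal D$ and $\mathbf z\in\operatorname{supp}U_0(t,s)\varphi$, then $x(t,\mathbf z)$ lies in the causal future or past of $x(s,\mathbf w)$ for some $\mathbf w\in\operatorname{supp}\varphi$; and if $\chi\in\mathcal H$ vanishes almost everywhere outside a closed set $A\subset\mathbb R^3$, then $U_0(t,s)\chi$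 vanishes almost everywhere on the set of those $\mathbf z$ for which $x(t,\mathbf z)$ is not causally related to $x(s,\mathbf w)$ for any $\mathbf w\in A$. (B) For each $\varphi\in\mathcal D$ the maps $(t,s)\mapsto H_0(t)U_0(t,s)\varphi$ and $(t,s)\mapsto h_0U_0(t,s)\varphi$ from $\mathbb R^2$ to $\mathcal H$ are continuous, the map $(t,s)\mapsto U_0(t,s)\varphi$ from $\mathbb R^2$ to $\mathcal H$ is of class $C^1$ in norm, and $$i\partial_tU_0(t,s)\varphi=H_0(t)U_0(t,s)\varphi,\qquad i\partial_sU_0(t,s)\varphi=-U_0(t,s)H_0(s)\varphi .$$ (C) The operators $H_0(s)$ are symmetric on $\mathcal D$. -/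

import Mathlib

open MeasureTheory
open scoped ContDiff

noncomputable section

namespace DiracFoliation

/-! ### Minkowski space, Dirac matrices, Dirac equation -/

/-- Four-component spinors, with the standard Hermitian product (conjugate-linear on the left). -/
abbrev Spinor := EuclideanSpace ℂ (Fin 4)

/-- Minkowski space in the chosen reference system `(e₀, …, e₃)`; `x 0` is the time coordinate
and `x 1, x 2, x 3` are the space coordinates (in units in which `c = ħ = m = 1`). -/
abbrev Minkowski := Fin 4 → ℝ

/-- The coordinate space `ℝ³`. Only its topology, smooth structure and Lebesgue measure are used. -/
abbrev Space := Fin 3 → ℝ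

/-- The diagonal entries of the Minkowski metric, of signature `(+,-,-,-)`. -/
def eta (a : Fin 4) : ℝ := if a = 0 then 1 else -1

/-- The partial derivative `∂f/∂xᵃ`. -/
def pd {n : ℕ} {E : Type*} [NormedAddCommGroup E] [NormedSpace ℝ E]
    (a : Fin n) (f : (Fin n → ℝ) → E) (x : Fin n → ℝ) : E :=
  fderiv ℝ f x (Pi.single a 1)

/-- A `4 × 4` matrix acting on a spinor. -/
abbrev act (A : Matrix (Fin 4) (Fin 4) ℂ) (v : Spinor) : Spinor := Matrix.toEuclideanLin A v

/-- A system of Dirac matrices: the Clifford relations for the Minkowski metric, with `γ⁰`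
Hermitian and `γⁱ` anti-Hermitian. -/
structure DiracMatrices where
  γ : Fin 4 → Matrix (Fin 4) (Fin 4) ℂ
  clifford : ∀ a b, γ a * γ b + γ b * γ a = if a = b then ((2 * eta a : ℝ) : ℂ) • 1 else 0
  conjTranspose_eq : ∀ a, (γ a).conjTranspose = ((eta a : ℝ) : ℂ) • γ a

set_option maxHeartbeats 2000000 in
/-- The Dirac representation. -/
def DiracMatrices.standard : DiracMatrices where
  γ := ![!![1, 0, 0, 0; 0, 1, 0, 0; 0, 0, -1, 0; 0, 0, 0, -1],
    !![0, 0, 0, 1; 0, 0, 1, 0; 0, -1, 0, 0; -1, 0, 0, 0],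
    !![0, 0, 0, -Complex.I; 0, 0, Complex.I, 0; 0, Complex.I, 0, 0; -Complex.I, 0, 0, 0],
    !![0, 0, 1, 0; 0, 0, 0, -1; -1, 0, 0, 0; 0, 1, 0, 0]]
  clifford := by
    intro a b
    fin_cases a <;> fin_cases b <;> ext i j <;> fin_cases i <;> fin_cases j <;>
      simp [eta] <;> norm_num
  conjTranspose_eq := by
    intro a
    fin_cases a <;> ext i j <;> fin_cases i <;> fin_cases j <;>
      simp [eta, Matrix.conjTranspose_apply]

/-- `ψ` is a smooth solution on the whole Minkowski space of the free Dirac equation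
`(i γᵃ ∂ₐ - 1) ψ = 0`. -/
def IsDiracSolution (D : DiracMatrices) (ψ : Minkowski → Spinor) : Prop :=
  ContDiff ℝ ∞ ψ ∧
    ∀ x, ∑ a, Complex.I • act (D.γ a) (pd a ψ x) - ψ x = 0

/-! ### Causality and Cauchy foliations -/

/-- `v` is causal (timelike or lightlike, nonzero) and future-directed. -/
def IsFutureCausal (v : Minkowski) : Prop :=
  0 < v 0 ∧ ∑ i : Fin 3, v i.succ ^ 2 ≤ v 0 ^ 2

/-- `x` lies in the causal future or in the causal past of `y`. -/
def CausallyRelated (x y : Minkowski) : Prop :=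
  ∑ i : Fin 3, (x i.succ - y i.succ) ^ 2 ≤ (x 0 - y 0) ^ 2

/-- A future-directed causal curve without future and past end points. (Every open
parameter interval may be replaced by `ℝ`.) -/
def IsInextendibleCausalCurve (c : ℝ → Minkowski) : Prop :=
  ContDiff ℝ 1 c ∧ (∀ r, IsFutureCausal (deriv c r)) ∧
    (¬ ∃ p, Filter.Tendsto c Filter.atTop (nhds p)) ∧
    (¬ ∃ p, Filter.Tendsto c Filter.atBot (nhds p))

/-- A smooth function `τ` whose level sets foliate Minkowski space by (smooth, spacelike) Cauchy
surfaces, with `τ` increasing into the future: the gradient of `τ` is timelike and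
future-pointing, and every inextendible causal curve meets each level set exactly once. In
particular `τ` is surjective. -/
structure CauchyFoliation where
  τ : Minkowski → ℝ
  smooth : ContDiff ℝ ∞ τ
  increasing : ∀ x, 0 < pd 0 τ x
  spacelike : ∀ x, ∑ i : Fin 3, pd i.succ τ x ^ 2 < pd 0 τ x ^ 2
  cauchy : ∀ s c, IsInextendibleCausalCurve c → ∃! r, τ (c r) = s

/-- `τ` is a function of `x⁰` and `|𝐱|` only. -/
def CauchyFoliation.RotationallySymmetric (F : CauchyFoliation) : Prop :=
  ∃ f : ℝ → ℝ → ℝ, ∀ x, F.τ x = f (x 0) (Real.sqrt (∑ i : Fin 3, x i.succ ^ 2))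

namespace CauchyFoliation

variable (D : DiracMatrices) (F : CauchyFoliation)

/-- The Cauchy surface `Σ_s`. -/
abbrev Slice (s : ℝ) : Type := {x : Minkowski // F.τ x = s}

/-- Smooth compactly supported spinor functions on `Σ_s`. As `Σ_s` is a closed embedded
submanifold, smooth functions on it are the restrictions of smooth functions on the whole space. -/
def TestSpinor (s : ℝ) : Submodule ℂ (F.Slice s → Spinor) where
  carrier := {f | (∃ G : Minkowski → Spinor, ContDiff ℝ ∞ G ∧ ∀ x : F.Slice s, f x = G x) ∧
    HasCompactSupport f}
  zero_mem' := ⟨⟨0, contDiff_const, fun _ => rfl⟩, HasCompactSupport.zero⟩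
  add_mem' := by
    rintro f g ⟨⟨G, hG, hf⟩, hfc⟩ ⟨⟨G', hG', hg⟩, hgc⟩
    exact ⟨⟨G + G', hG.add hG', fun x => by simp [hf, hg]⟩, hfc.add hgc⟩
  smul_mem' := by
    rintro c f ⟨⟨G, hG, hf⟩, hfc⟩
    exact ⟨⟨fun x => c • G x, hG.const_smul c, fun x => by simp [hf]⟩,
      hfc.mono fun x hx => by
        simp only [Function.mem_support, Pi.smul_apply] at hx ⊢
        exact fun h => hx (by simp [h])⟩

/-! ### The product on a Cauchy surface

`Σ_s` is a graph over the hyperplane `x⁰ = 0`, so `(x¹, x², x³)` are global coordinates on it. In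
these the dual integration element `dσₐ` is `(∂ₐτ / ∂₀τ) dx¹ dx² dx³`
(that is, `dσ₀ = dx¹ dx² dx³` and `dσᵢ = - (∂ᵢh) dx¹ dx² dx³` on the graph `x⁰ = h(𝐱)`). -/

/-- The measure `dx¹ dx² dx³` on `Σ_s`. -/
def surfMeasure (s : ℝ) : Measure (F.Slice s) :=
  Measure.comap (fun x (i : Fin 3) => x.1 i.succ) (volume : Measure Space)

/-- The components `∂ₐτ / ∂₀τ` of `dσₐ` with respect to `dx¹ dx² dx³`. -/
def conormal (a : Fin 4) (x : Minkowski) : ℝ := pd a F.τ x / pd 0 F.τ x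

/-- The matrix `γ⁰ γᵃ dσₐ` with respect to `dx¹ dx² dx³`. -/
def fluxMatrix (x : Minkowski) : Matrix (Fin 4) (Fin 4) ℂ :=
  ∑ a, ((F.conormal a x : ℝ) : ℂ) • (D.γ 0 * D.γ a)

/-- The density `v̄ γᵃ w dσₐ` with respect to `dx¹ dx² dx³`, where `v̄ = v† γ⁰`. -/
def flux (x : Minkowski) (v w : Spinor) : ℂ := inner ℂ v (act (F.fluxMatrix D x) w)

/-- The product `∫_{Σ_s} f̄ γᵃ g dσₐ`. -/
def prod (s : ℝ) (f g : F.Slice s → Spinor) : ℂ :=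
  ∫ x, F.flux D x (f x) (g x) ∂F.surfMeasure s

/-! ### The Hilbert space of spinor functions on a Cauchy surface -/

variable {D F}

lemma conormal_zero (x : Minkowski) : F.conormal 0 x = 1 := div_self (F.increasing x).ne'

lemma flux_add_left (x : Minkowski) (u v w : Spinor) :
    F.flux D x (u + v) w = F.flux D x u w + F.flux D x v w := inner_add_left _ _ _

lemma flux_add_right (x : Minkowski) (u v w : Spinor) :
    F.flux D x u (v + w) = F.flux D x u v + F.flux D x u w := by
  simp [flux, act]

lemma flux_smul_left (x : Minkowski) (c : ℂ) (v w : Spinor) :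
    F.flux D x (c • v) w = (starRingEnd ℂ) c * F.flux D x v w := inner_smul_left _ _ _

lemma flux_smul_right (x : Minkowski) (c : ℂ) (v w : Spinor) :
    F.flux D x v (c • w) = c * F.flux D x v w := by
  simp [flux, act]

lemma fluxMatrix_isHermitian (x : Minkowski) : (F.fluxMatrix D x).IsHermitian := by
  have h : ∀ a, (D.γ 0 * D.γ a).conjTranspose = D.γ 0 * D.γ a := by
    intro a
    rw [Matrix.conjTranspose_mul, D.conjTranspose_eq, D.conjTranspose_eq]
    have := D.clifford 0 a
    by_cases ha : a = 0
    · subst ha; simp [eta]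
    · rw [if_neg (Ne.symm ha)] at this
      simp only [eta, if_neg ha, if_true]
      push_cast
      simp only [one_smul, neg_smul, Matrix.neg_mul]
      rw [eq_comm, ← add_eq_zero_iff_eq_neg]; exact this
  unfold Matrix.IsHermitian fluxMatrix
  rw [Matrix.conjTranspose_sum]
  refine Finset.sum_congr rfl fun a _ => ?_
  rw [Matrix.conjTranspose_smul, h]
  simp

lemma inner_act_left {A : Matrix (Fin 4) (Fin 4) ℂ} (hA : A.IsHermitian) (v w : Spinor) :
    inner ℂ (act A v) w = inner ℂ v (act A w) :=
  (Matrix.isSymmetric_toEuclideanLin_iff.2 hA) v w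

lemma flux_conj (x : Minkowski) (v w : Spinor) :
    (starRingEnd ℂ) (F.flux D x v w) = F.flux D x w v := by
  rw [flux, inner_conj_symm, inner_act_left (fluxMatrix_isHermitian x), flux]


lemma flux_self_pos (x : Minkowski) {v : Spinor} (hv : v ≠ 0) :
    0 < (F.flux D x v v).re := by
  set k : Fin 3 → ℝ := fun i => F.conormal i.succ x with hk
  have hk1 : ∑ i, k i ^ 2 < 1 := by
    have h0 := F.increasing x
    have h1 := F.spacelike x
    simp only [hk, conormal, div_pow]
    rw [← Finset.sum_div, div_lt_one (by positivity)]
    exact h1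
  set A : Matrix (Fin 4) (Fin 4) ℂ :=
    ∑ i : Fin 3, ((k i : ℝ) : ℂ) • (D.γ 0 * D.γ i.succ) with hA
  have g00 : D.γ 0 * D.γ 0 = 1 := by
    have h := D.clifford 0 0
    rw [if_pos rfl, ← two_smul ℂ] at h
    have h2 := congrArg (fun X => (2 : ℂ)⁻¹ • X) h
    simpa [eta, smul_smul] using h2
  have g0i : ∀ i : Fin 3, D.γ i.succ * D.γ 0 = - (D.γ 0 * D.γ i.succ) := by
    intro i
    have h := D.clifford i.succ 0
    rw [if_neg (Fin.succ_ne_zero i)] at h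
    exact eq_neg_of_add_eq_zero_left h
  have hsplit : F.fluxMatrix D x = 1 + A := by
    rw [fluxMatrix, Fin.sum_univ_succ, conormal_zero, g00]
    simp [hA, hk]
  have hAh : A.IsHermitian := by
    have : A = F.fluxMatrix D x - 1 := by rw [hsplit]; simp
    rw [this]
    exact (fluxMatrix_isHermitian x).sub Matrix.isHermitian_one
  have hprod : ∀ i j : Fin 3, (D.γ 0 * D.γ i.succ) * (D.γ 0 * D.γ j.succ)
      = - (D.γ i.succ * D.γ j.succ) := by
    intro i j
    calc (D.γ 0 * D.γ i.succ) * (D.γ 0 * D.γ j.succ)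
        = D.γ 0 * (D.γ i.succ * D.γ 0) * D.γ j.succ := by simp only [Matrix.mul_assoc]
      _ = - ((D.γ 0 * D.γ 0) * (D.γ i.succ * D.γ j.succ)) := by
          rw [g0i]; simp only [Matrix.mul_assoc, Matrix.mul_neg, Matrix.neg_mul]
      _ = _ := by rw [g00, Matrix.one_mul]
  have hAA : A * A = ((∑ i, k i ^ 2 : ℝ) : ℂ) • (1 : Matrix (Fin 4) (Fin 4) ℂ) := by
    have e1 : A * A = ∑ i, ∑ j, ((k i * k j : ℝ) : ℂ) • - (D.γ i.succ * D.γ j.succ) := by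
      rw [hA, Finset.sum_mul_sum]
      refine Finset.sum_congr rfl fun i _ => Finset.sum_congr rfl fun j _ => ?_
      rw [Matrix.smul_mul, Matrix.mul_smul, smul_smul, hprod]
      push_cast; rfl
    have e2 : A * A = ∑ i, ∑ j, ((k i * k j : ℝ) : ℂ) • - (D.γ j.succ * D.γ i.succ) := by
      rw [e1, Finset.sum_comm]
      refine Finset.sum_congr rfl fun i _ => Finset.sum_congr rfl fun j _ => ?_
      rw [mul_comm]
    have e3 : A * A + A * A = ((2 * ∑ i, k i ^ 2 : ℝ) : ℂ) • (1 : Matrix (Fin 4) (Fin 4) ℂ) := by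
      nth_rewrite 1 [e1]
      rw [e2, ← Finset.sum_add_distrib]
      rw [Finset.mul_sum, Complex.ofReal_sum, Finset.sum_smul]
      refine Finset.sum_congr rfl fun i _ => ?_
      rw [← Finset.sum_add_distrib, Finset.sum_eq_single i]
      · rw [← smul_add, ← neg_add, D.clifford, if_pos rfl, ← neg_smul, smul_smul]
        congr 1
        simp [eta]; ring
      · intro j _ hj
        rw [← smul_add, ← neg_add, D.clifford, if_neg (fun h => hj (Fin.succ_injective _ h).symm)]
        simp
      · simp
    rw [← two_smul ℂ] at e3
    have h2 := congrArg (fun X => (2 : ℂ)⁻¹ • X) e3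
    simpa [smul_smul] using h2
  have hnorm : ‖act A v‖ ^ 2 = (∑ i, k i ^ 2) * ‖v‖ ^ 2 := by
    have h1 : inner ℂ (act A v) (act A v) = ((∑ i, k i ^ 2 : ℝ) : ℂ) * inner ℂ v v := by
      rw [inner_act_left hAh]
      have : act A (act A v) = act (A * A) v := by
        simp [act, Matrix.toLpLin_apply]
      rw [this, hAA]
      simp only [act, map_smul, LinearMap.smul_apply, inner_smul_right]
      simp
    rw [inner_self_eq_norm_sq_to_K, inner_self_eq_norm_sq_to_K] at h1
    have h3 : ((‖act A v‖ ^ 2 : ℝ) : ℂ) = (((∑ i, k i ^ 2) * ‖v‖ ^ 2 : ℝ) : ℂ) := by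
      push_cast at h1 ⊢; exact h1
    exact Complex.ofReal_injective h3
  have hvpos : 0 < ‖v‖ := norm_pos_iff.2 hv
  have hlt : ‖act A v‖ < ‖v‖ := by
    have : ‖act A v‖ ^ 2 < ‖v‖ ^ 2 := by
      rw [hnorm]; nlinarith [pow_pos hvpos 2]
    exact lt_of_pow_lt_pow_left₀ 2 hvpos.le this
  have hcs : -(‖v‖ * ‖act A v‖) ≤ (inner ℂ v (act A v)).re := by
    have h1 := norm_inner_le_norm (𝕜 := ℂ) v (act A v)
    have h2 := Complex.abs_re_le_norm (inner ℂ v (act A v))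
    have h3 := neg_abs_le (inner ℂ v (act A v)).re
    linarith
  have hfl : (F.flux D x v v).re = ‖v‖ ^ 2 + (inner ℂ v (act A v)).re := by
    have : F.flux D x v v = inner ℂ v v + inner ℂ v (act A v) := by
      rw [flux, hsplit, ← inner_add_right]
      congr 1
      simp [act, Matrix.toLpLin_apply]
    rw [this, Complex.add_re, inner_self_eq_norm_sq_to_K]
    congr 1
    norm_cast
  rw [hfl]
  nlinarith

lemma flux_self_nonneg (x : Minkowski) (v : Spinor) : 0 ≤ (F.flux D x v v).re := by
  by_cases hv : v = 0
  · simp [hv, flux]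
  · exact (flux_self_pos x hv).le

lemma norm_flux_self (x : Minkowski) (v : Spinor) :
    ‖F.flux D x v v‖ = (F.flux D x v v).re := by
  have h : ((F.flux D x v v).re : ℂ) = F.flux D x v v := Complex.conj_eq_iff_re.1 (flux_conj x v v)
  rw [← h, Complex.norm_real, Complex.ofReal_re, Real.norm_of_nonneg (flux_self_nonneg x v)]

lemma continuous_flux : Continuous fun p : Minkowski × Spinor × Spinor =>
    F.flux D p.1 p.2.1 p.2.2 := by
  have hc : ∀ a, Continuous (F.conormal a) := by
    intro a
    have h : ∀ b, Continuous (pd b F.τ) := fun b =>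
      (F.smooth.continuous_fderiv (by simp)).clm_apply continuous_const
    exact (h a).div (h 0) fun x => (F.increasing x).ne'
  have : (fun p : Minkowski × Spinor × Spinor => F.flux D p.1 p.2.1 p.2.2) = fun p =>
      ∑ a, ((F.conormal a p.1 : ℝ) : ℂ) * inner ℂ p.2.1 (act (D.γ 0 * D.γ a) p.2.2) := by
    funext p
    simp only [flux, fluxMatrix, act, map_sum, map_smul, LinearMap.sum_apply,
      LinearMap.smul_apply, inner_sum, inner_smul_right]
  rw [this]
  refine continuous_finsetSum _ fun a _ => ?_
  refine (Complex.continuous_ofReal.comp ((hc a).comp continuous_fst)).mul ?_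
  refine Continuous.inner (by fun_prop) ?_
  exact (LinearMap.continuous_of_finiteDimensional (Matrix.toEuclideanLin (D.γ 0 * D.γ a))).comp
    (by fun_prop)

lemma aestronglyMeasurable_flux {s : ℝ} {f g : F.Slice s → Spinor}
    (hf : AEStronglyMeasurable f (F.surfMeasure s))
    (hg : AEStronglyMeasurable g (F.surfMeasure s)) :
    AEStronglyMeasurable (fun x : F.Slice s => F.flux D x (f x) (g x)) (F.surfMeasure s) :=
  (continuous_flux (D := D) (F := F)).comp_aestronglyMeasurable
    (g := fun p : Minkowski × Spinor × Spinor => F.flux D p.1 p.2.1 p.2.2)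
    (f := fun x : F.Slice s => (x.1, f x, g x))
    (continuous_subtype_val.aestronglyMeasurable.prodMk (hf.prodMk hg))

lemma integrable_flux_add {s : ℝ} {f g : F.Slice s → Spinor}
    (hf : AEStronglyMeasurable f (F.surfMeasure s))
    (hg : AEStronglyMeasurable g (F.surfMeasure s))
    (hf' : Integrable (fun x : F.Slice s => F.flux D x (f x) (f x)) (F.surfMeasure s))
    (hg' : Integrable (fun x : F.Slice s => F.flux D x (g x) (g x)) (F.surfMeasure s)) :
    Integrable (fun x : F.Slice s => F.flux D x (f x + g x) (f x + g x)) (F.surfMeasure s) := by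
  refine ((hf'.norm.add hg'.norm).const_mul 2).mono'
    (aestronglyMeasurable_flux (hf.add hg) (hf.add hg)) (ae_of_all _ fun x => ?_)
  have h := flux_self_nonneg (D := D) (F := F) x (f x + (-1 : ℂ) • g x)
  simp only [norm_flux_self, Pi.add_apply]
  simp only [flux_add_left, flux_add_right, flux_smul_left, flux_smul_right, Complex.add_re,
    map_neg, map_one, neg_mul, one_mul, Complex.neg_re] at h ⊢
  linarith

lemma integrable_flux_smul {s : ℝ} (c : ℂ) {f : F.Slice s → Spinor}
    (hf' : Integrable (fun x : F.Slice s => F.flux D x (f x) (f x)) (F.surfMeasure s)) :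
    Integrable (fun x : F.Slice s => F.flux D x (c • f x) (c • f x)) (F.surfMeasure s) := by
  simp only [flux_smul_left, flux_smul_right]
  exact (hf'.const_mul _).const_mul _

lemma integrable_flux {s : ℝ} {f g : F.Slice s → Spinor}
    (hf : AEStronglyMeasurable f (F.surfMeasure s))
    (hg : AEStronglyMeasurable g (F.surfMeasure s))
    (hf' : Integrable (fun x : F.Slice s => F.flux D x (f x) (f x)) (F.surfMeasure s))
    (hg' : Integrable (fun x : F.Slice s => F.flux D x (g x) (g x)) (F.surfMeasure s)) :
    Integrable (fun x : F.Slice s => F.flux D x (f x) (g x)) (F.surfMeasure s) := by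
  have key : ∀ c : ℂ,
      Integrable (fun x : F.Slice s => F.flux D x (f x + c • g x) (f x + c • g x)) (F.surfMeasure s) :=
    fun c => integrable_flux_add hf (hg.const_smul c) hf' (integrable_flux_smul c hg')
  have h := ((((key 1).sub (key (-1))).sub ((key Complex.I).const_mul Complex.I)).add
    ((key (-Complex.I)).const_mul Complex.I)).const_mul (1 / 4)
  refine h.congr (ae_of_all _ fun x => ?_)
  simp only [Pi.add_apply, Pi.sub_apply, flux_add_left, flux_add_right, flux_smul_left,
    flux_smul_right, map_neg, map_one, Complex.conj_I]
  ring_nf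
  simp only [Complex.I_sq]
  ring

variable (D F)

/-- Measurable spinor functions on `Σ_s`, modulo equality almost everywhere, which are
square-integrable with respect to the product `prod`. -/
def hilbertSubmodule (s : ℝ) : Submodule ℂ (F.Slice s →ₘ[F.surfMeasure s] Spinor) where
  carrier := {f | Integrable (fun x : F.Slice s => F.flux D x (f x) (f x)) (F.surfMeasure s)}
  zero_mem' := by
    refine (integrable_zero _ _ _).congr ?_
    filter_upwards [AEEqFun.coeFn_zero (μ := F.surfMeasure s) (β := Spinor)] with x hx
    simp [hx, flux]
  add_mem' := by
    intro f g hf hg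
    refine (integrable_flux_add f.aestronglyMeasurable g.aestronglyMeasurable hf hg).congr ?_
    filter_upwards [AEEqFun.coeFn_add f g] with x hx
    rw [hx, Pi.add_apply]
  smul_mem' := by
    intro c f hf
    refine (integrable_flux_smul c hf).congr ?_
    filter_upwards [AEEqFun.coeFn_smul c f] with x hx
    rw [hx, Pi.smul_apply]

/-- The space `𝓗(Σ_s)` of spinor functions on `Σ_s`, with the product `prod`. -/
def Hilbert (s : ℝ) : Type := F.hilbertSubmodule D s

instance (s : ℝ) : AddCommGroup (F.Hilbert D s) :=
  inferInstanceAs (AddCommGroup (F.hilbertSubmodule D s))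

instance (s : ℝ) : Module ℂ (F.Hilbert D s) :=
  inferInstanceAs (Module ℂ (F.hilbertSubmodule D s))

/-- The (almost everywhere determined) function represented by an element of `𝓗(Σ_s)`. -/
def Hilbert.fn {D : DiracMatrices} {F : CauchyFoliation} {s : ℝ} (f : F.Hilbert D s) :
    F.Slice s → Spinor := (f.1 : F.Slice s →ₘ[F.surfMeasure s] Spinor)

/-- The inner product of `𝓗(Σ_s)` is the product `prod` of the representing functions. -/
abbrev hilbertCore (s : ℝ) : InnerProductSpace.Core ℂ (F.Hilbert D s) where
  inner f g := F.prod D s f.fn g.fn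
  conj_inner_symm f g := by
    simp only [prod]
    rw [← integral_conj]
    exact integral_congr_ae (ae_of_all _ fun x => flux_conj _ _ _)
  re_inner_nonneg f := by
    have h : (F.prod D s f.fn f.fn).re = ∫ x, (F.flux D x (f.fn x) (f.fn x)).re ∂F.surfMeasure s :=
      (integral_re (𝕜 := ℂ) f.2).symm
    change 0 ≤ (F.prod D s f.fn f.fn).re
    rw [h]
    exact integral_nonneg fun x => flux_self_nonneg _ _
  add_left f g h := by
    simp only [prod]
    have hfh : Integrable (fun x : F.Slice s => F.flux D x (f.fn x) (h.fn x)) (F.surfMeasure s) :=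
      integrable_flux f.1.aestronglyMeasurable h.1.aestronglyMeasurable f.2 h.2
    have hgh : Integrable (fun x : F.Slice s => F.flux D x (g.fn x) (h.fn x)) (F.surfMeasure s) :=
      integrable_flux g.1.aestronglyMeasurable h.1.aestronglyMeasurable g.2 h.2
    rw [← integral_add hfh hgh]
    refine integral_congr_ae ?_
    filter_upwards [AEEqFun.coeFn_add f.1 g.1] with x hx
    have : (f + g).fn x = f.fn x + g.fn x := hx
    rw [this, flux_add_left]
  smul_left f g c := by
    simp only [prod]
    rw [← integral_const_mul]
    refine integral_congr_ae ?_
    filter_upwards [AEEqFun.coeFn_smul c f.1] with x hx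
    have : (c • f).fn x = c • f.fn x := hx
    rw [this, flux_smul_left]
  definite f hf := by
    have h : (F.prod D s f.fn f.fn).re = ∫ x, (F.flux D x (f.fn x) (f.fn x)).re ∂F.surfMeasure s :=
      (integral_re (𝕜 := ℂ) f.2).symm
    have hf' : F.prod D s f.fn f.fn = 0 := hf
    have hff : Integrable (fun x : F.Slice s => (F.flux D x (f.fn x) (f.fn x)).re)
        (F.surfMeasure s) := Integrable.re (𝕜 := ℂ) f.2
    rw [hf', Complex.zero_re, eq_comm,
      integral_eq_zero_iff_of_nonneg (fun x => flux_self_nonneg _ _) hff] at h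
    apply Subtype.ext
    apply AEEqFun.ext
    filter_upwards [h, AEEqFun.coeFn_zero (μ := F.surfMeasure s) (β := Spinor)] with x hx h0
    change f.fn x = _
    by_contra hne
    have hne' : f.fn x ≠ 0 := fun h => hne (h.trans h0.symm)
    exact (flux_self_pos (D := D) (F := F) x hne').ne' hx

instance (s : ℝ) : NormedAddCommGroup (F.Hilbert D s) :=
  (F.hilbertCore D s).toNormedAddCommGroup

instance (s : ℝ) : InnerProductSpace ℂ (F.Hilbert D s) :=
  InnerProductSpace.ofCore (F.hilbertCore D s).toCore

variable {D F}

lemma surfMeasure_lt_top {s : ℝ} {A : Set (F.Slice s)} (hA : IsCompact A) :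
    F.surfMeasure s A < ⊤ := by
  set p : F.Slice s → Space := fun x i => x.1 i.succ with hp
  have hpc : Continuous p := 
    continuous_pi fun i => (continuous_apply i.succ).comp continuous_subtype_val
  by_cases h : Function.Injective p ∧ ∀ t, MeasurableSet t → NullMeasurableSet (p '' t) volume
  · rw [surfMeasure, Measure.comap_apply₀ p volume h.1 h.2 hA.measurableSet.nullMeasurableSet]
    exact (hA.image hpc).measure_lt_top
  · rw [surfMeasure, Measure.comap, dif_neg h]
    simp

instance (s : ℝ) : IsFiniteMeasureOnCompacts (F.surfMeasure s) :=
  ⟨fun _ hA => surfMeasure_lt_top hA⟩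

lemma testSpinor_continuous {s : ℝ} (f : F.TestSpinor s) : Continuous f.1 := by
  obtain ⟨⟨G, hG, hf⟩, -⟩ := f.2
  have : f.1 = fun x => G x.1 := funext hf
  rw [this]
  exact hG.continuous.comp continuous_subtype_val

lemma testSpinor_integrable {s : ℝ} (f : F.TestSpinor s) :
    Integrable (fun x : F.Slice s => F.flux D x (f.1 x) (f.1 x)) (F.surfMeasure s) := by
  refine Continuous.integrable_of_hasCompactSupport ?_ ?_
  · exact (continuous_flux (D := D) (F := F)).comp
      (g := fun p : Minkowski × Spinor × Spinor => F.flux D p.1 p.2.1 p.2.2)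
      (f := fun x : F.Slice s => (x.1, f.1 x, f.1 x))
      (continuous_subtype_val.prodMk ((testSpinor_continuous f).prodMk (testSpinor_continuous f)))
  · refine f.2.2.mono fun x hx => ?_
    simp only [Function.mem_support] at hx ⊢
    exact fun h => hx (by simp [h, flux])

variable (D F)

/-- The inclusion of the smooth compactly supported functions into `𝓗(Σ_s)`. -/
def toHilbert (s : ℝ) : F.TestSpinor s →ₗ[ℂ] F.Hilbert D s where
  toFun f := ⟨AEEqFun.mk f.1 (testSpinor_continuous f).aestronglyMeasurable,
    (testSpinor_integrable (D := D) f).congr (by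
      filter_upwards [AEEqFun.coeFn_mk f.1 ((testSpinor_continuous f).aestronglyMeasurable
        (μ := F.surfMeasure s))] with x hx
      rw [hx])⟩
  map_add' f g := rfl
  map_smul' c f := rfl

end CauchyFoliation

/-! ### Spinor functions on `ℝ³` -/

/-- The Hilbert space `ℂ⁴ ⊗ L²(ℝ³, d³z)`. -/
abbrev L2Spinor := Lp Spinor 2 (volume : Measure Space)

/-- The space `C₀^∞(ℝ³, ℂ⁴)`. -/
def TestSpinor : Submodule ℂ (Space → Spinor) where
  carrier := {f | ContDiff ℝ ∞ f ∧ HasCompactSupport f}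
  zero_mem' := ⟨contDiff_const, HasCompactSupport.zero⟩
  add_mem' := fun ⟨hf, hfc⟩ ⟨hg, hgc⟩ => ⟨hf.add hg, hfc.add hgc⟩
  smul_mem' := fun c f ⟨hf, hfc⟩ => ⟨hf.const_smul c, hfc.mono fun x hx => by
    simp only [Function.mem_support, Pi.smul_apply] at hx ⊢
    exact fun h => hx (by simp [h])⟩

/-- The inclusion of `C₀^∞(ℝ³, ℂ⁴)` into `ℂ⁴ ⊗ L²(ℝ³)`. -/
def toL2 : TestSpinor →ₗ[ℂ] L2Spinor where
  toFun f := (f.2.1.continuous.memLp_of_hasCompactSupport f.2.2 :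
    MemLp f.1 2 (volume : Measure Space)).toLp f.1
  map_add' _ _ := rfl
  map_smul' _ _ := rfl

/-- The momentum operator `pᵢ = -i ∂/∂zⁱ`. -/
def momentum (i : Fin 3) (f : Space → Spinor) (z : Space) : Spinor := -Complex.I • pd i f z

/-- The differential expression `h₀ = ½ (𝐩² + 𝐳²)`. -/
def oscillator (f : Space → Spinor) (z : Space) : Spinor :=
  (1 / 2 : ℂ) • (∑ i, momentum i (momentum i f) z + ((∑ i, z i ^ 2 : ℝ) : ℂ) • f z)

/-! ### Coordinates adapted to the foliation -/

/-- A smooth diffeomorphism `(τ, z¹, z², z³)` of Minkowski space onto `ℝ⁴` whose zeroth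
component is the function `τ` of the foliation. -/
structure AdaptedCoordinates (F : CauchyFoliation) where
  ξ : Minkowski ≃ (Fin 4 → ℝ)
  smooth : ContDiff ℝ ∞ ξ
  smooth_symm : ContDiff ℝ ∞ ξ.symm
  time_eq : ∀ x, ξ x 0 = F.τ x

namespace AdaptedCoordinates

variable (D : DiracMatrices) {F : CauchyFoliation} (C : AdaptedCoordinates F)

/-- The point of Minkowski space with coordinates `(s, z)`. -/
def point (s : ℝ) (z : Space) : Minkowski := C.ξ.symm (Fin.cons s z)

/-- The coordinates `(z¹, z², z³)` of a point. -/
def space (x : Minkowski) : Space := fun i => C.ξ x i.succ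

/-- The metric components `g_{μν} = (∂xᵃ/∂ξ^μ) (∂xᵇ/∂ξ^ν) η_{ab}` at the point `x`. -/
def metric (x : Minkowski) (μ ν : Fin 4) : ℝ :=
  ∑ a, eta a * (pd μ C.ξ.symm (C.ξ x) a * pd ν C.ξ.symm (C.ξ x) a)

/-- `g_z = det (g_{ij})`, with indices restricted to the values `1, 2, 3`. -/
def gz (x : Minkowski) : ℝ := Matrix.det (Matrix.of fun i j : Fin 3 => C.metric x i.succ j.succ)

/-- `γ̂ⁱ = (∂ₐ zⁱ) γᵃ`. -/
def gammaHat (i : Fin 3) (x : Minkowski) : Matrix (Fin 4) (Fin 4) ℂ :=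
  ∑ a, ((pd a C.ξ x i.succ : ℝ) : ℂ) • D.γ a

end AdaptedCoordinates

namespace CauchyFoliation

variable (D : DiracMatrices) (F : CauchyFoliation)

/-- `g^{ττ} = η^{ab} (∂ₐτ) (∂_bτ)`. -/
def gInvTau (x : Minkowski) : ℝ := ∑ a, eta a * pd a F.τ x ^ 2

/-- The (covariant) components of the unit normal `n = (g^{ττ})^{-1/2} ∇τ`. -/
def normal (a : Fin 4) (x : Minkowski) : ℝ := F.gInvTau x ^ (-(1 / 2) : ℝ) * pd a F.τ x

/-- The matrix `γ·n = γᵃ nₐ`. -/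
def gammaNormal (x : Minkowski) : Matrix (Fin 4) (Fin 4) ℂ :=
  ∑ a, ((F.normal a x : ℝ) : ℂ) • D.γ a

/-- The Lorentz rotation of Dirac spinors in the plane of `t = e₀` and `n`, which takes `γ·n` to
`γ⁰`: `K = (1 + (γ·n) (γ·t)) / (2 (1 + n·t))^{1/2}`. -/
def boost (x : Minkowski) : Matrix (Fin 4) (Fin 4) ℂ :=
  (((2 * (1 + F.normal 0 x)) ^ (-(1 / 2) : ℝ) : ℝ) : ℂ) • (1 + F.gammaNormal D x * D.γ 0)

/-- The matrix `μ = (g^{ττ})^{-1/2} β`, with `β = γ⁰`. -/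
def muMatrix (x : Minkowski) : Matrix (Fin 4) (Fin 4) ℂ :=
  ((F.gInvTau x ^ (-(1 / 2) : ℝ) : ℝ) : ℂ) • D.γ 0

end CauchyFoliation

namespace AdaptedCoordinates

variable (D : DiracMatrices) {F : CauchyFoliation} (C : AdaptedCoordinates F)

/-- The matrix `λⁱ = μ K⁻¹ γ̂ⁱ K`. -/
def lambdaMatrix (i : Fin 3) (x : Minkowski) : Matrix (Fin 4) (Fin 4) ℂ :=
  F.muMatrix D x * ((F.boost D x)⁻¹ * C.gammaHat D i x * F.boost D x)

/-- The matrix `|g_z|^{-1/4} K` at the point `x`. -/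
def transfer (x : Minkowski) : Matrix (Fin 4) (Fin 4) ℂ :=
  ((|C.gz x| ^ (-(1 / 4) : ℝ) : ℝ) : ℂ) • F.boost D x

/-- The differential expression `H₀(s) = ½ [λⁱ(s), pᵢ]₊ + μ(s)`. -/
def hamiltonian (s : ℝ) (f : Space → Spinor) (z : Space) : Spinor :=
  ∑ i, (1 / 2 : ℂ) • (act (C.lambdaMatrix D i (C.point s z)) (momentum i f z) +
      momentum i (fun z' => act (C.lambdaMatrix D i (C.point s z')) (f z')) z) +
    act (F.muMatrix D (C.point s z)) (f z)

end AdaptedCoordinates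

end DiracFoliation

end

open DiracFoliation

/-! The Cauchy problem is solved by explicit Green operators; the unitary theory then follows from
the Schrödinger form of the Dirac equation in adapted coordinates.

Green operators. The measure dy/|y| on the future light cone inverts the wave operator up to a
constant; this is Kirchhoff's formula `integral_inv_norm_smul_wave`, obtained by integrating by
parts on hyperboloids of mass ε and letting ε tend to 0. Damping by exp(-l x⁰) makes the total mass
less than 1, so a Neumann series of convolution powers yields a fundamental solution of □ + 1
supported in the future cone (`exists_retarded`), and reflection gives the advanced one
(`exists_advanced`). Since (iγ∂ - 1)(iγ∂ + 1) = -(□ + 1), the inhomogeneous Dirac equation is solved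
as well (`Propagator.slash_solve`).

Uniqueness and causality. A spacelike hypersurface is not characteristic, so a solution vanishing on
part of it vanishes there together with its first and second derivatives. Its extension by zero
across the hypersurface is C², and the fundamental identity, applied to a compactly supported
truncation, shows that it vanishes (`eq_zero_of_vanishing_data`). The required compactness of pasts
above and futures below a Cauchy surface follows from the Cauchy property for straight causal lines.

Existence. The data are extended to an approximate solution with error (τ - s)^k R. The future part
of the error is corrected by the retarded operator and the past part by the advanced one; neither
correction reaches Σ_s. By uniqueness the result does not depend on k, so it is smooth jointly in s
and x (`exists_smooth_solution`).

Transfer to ℝ³. The matrix K turns the flux form on Σ_s into a multiple of the standard product, and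
|g_z|^{-1/4} absorbs that multiple together with the Jacobian (`density_smul_flux`). Hence T_s is
unitary; completeness and density in 𝓗(Σ_s) are inherited from L² through the coordinates (τ, 𝐱),
which always exist.

The Hamiltonian. For χ = T⁻¹ψ the Dirac equation reads i λ^μ ∂_μ χ + i Γ χ = μ χ, with λ⁰ = 1 and
Hermitian λ^μ. It has the symmetric form i ∂_τ χ = H₀ χ because ∂_μ λ^μ = 2Γ (`sum_pd_lambda`). Here
rotational symmetry is decisive: the gradients of rotation-invariant functions are parallel, so the
spin connection term has no anti-Hermitian part (`boost_connection_isHermitian`). Symmetry of H₀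
gives conservation of the scalar product (`inner_toL2_evolutionTest`), whence isometry and the
unitary extension.

Regularity in (t, s) comes from joint smoothness together with locally uniform compact supports.
Strong continuity follows by density, the derivative in s from the evolution law, and causality for
general χ by duality with test functions. -/

noncomputable section

namespace DiracFoliation

section

/-! ### Partial derivatives -/

section PartialDerivatives

variable {n : ℕ} {E : Type*} [NormedAddCommGroup E] [NormedSpace ℝ E]

lemma contDiff_pd {f : (Fin n → ℝ) → E} {k m : WithTop ℕ∞} (hf : ContDiff ℝ k f)
    (hm : m + 1 ≤ k) (a : Fin n) : ContDiff ℝ m (pd a f) :=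
  (hf.fderiv_right hm).clm_apply contDiff_const

lemma continuous_pd {f : (Fin n → ℝ) → E} {k : WithTop ℕ∞} (hf : ContDiff ℝ k f)
    (hk : 1 ≤ k) (a : Fin n) : Continuous (pd a f) :=
  (contDiff_pd (m := 0) hf (by simpa using hk) a).continuous

lemma hasCompactSupport_pd {f : (Fin n → ℝ) → E} (hf : HasCompactSupport f) (a : Fin n) :
    HasCompactSupport (pd a f) :=
  hf.fderiv_apply ℝ _

lemma pd_comm {f : (Fin n → ℝ) → E} {k : WithTop ℕ∞} (hf : ContDiff ℝ k f) (hk : 2 ≤ k)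
    (a b : Fin n) (x : Fin n → ℝ) : pd a (pd b f) x = pd b (pd a f) x := by
  have hs : IsSymmSndFDerivAt ℝ f x :=
    hf.contDiffAt.isSymmSndFDerivAt (by simpa [minSmoothness] using hk)
  have hd : DifferentiableAt ℝ (fderiv ℝ f) x :=
    (hf.fderiv_right (m := 1) (by simpa [one_add_one_eq_two] using hk)).differentiable
      one_ne_zero x
  have h : ∀ a b, pd a (pd b f) x = fderiv ℝ (fderiv ℝ f) x (Pi.single a 1) (Pi.single b 1) := by
    intro a b
    have := hd.hasFDerivAt.clm_apply (hasFDerivAt_const (Pi.single b 1 : Fin n → ℝ) x)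
    change fderiv ℝ (fun x => fderiv ℝ f x (Pi.single b 1)) x _ = _
    rw [this.fderiv]
    simp
  rw [h, h]
  exact hs _ _

/-- The wave operator `∂₀² - ∂₁² - ∂₂² - ∂₃²`. -/
def wave (f : Minkowski → E) (x : Minkowski) : E :=
  pd 0 (pd 0 f) x - ∑ i : Fin 3, pd i.succ (pd i.succ f) x

lemma continuous_wave {f : Minkowski → E} (hf : ContDiff ℝ 2 f) : Continuous (wave f) := by
  have h : ∀ a b, Continuous (pd a (pd b f)) := fun a b =>
    continuous_pd (contDiff_pd (m := 1) hf (by norm_num [one_add_one_eq_two]) b) le_rfl a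
  exact (h 0 0).sub (continuous_finsetSum _ fun i _ => h _ _)

lemma hasCompactSupport_wave {f : Minkowski → E} (hf : HasCompactSupport f) :
    HasCompactSupport (wave f) := by
  refine HasCompactSupport.intro hf fun x hx => ?_
  have h : ∀ a b, pd a (pd b f) x = 0 := fun a b => by
    refine image_eq_zero_of_notMem_tsupport fun h => hx ?_
    exact tsupport_fderiv_apply_subset ℝ _ (tsupport_fderiv_apply_subset ℝ _ h)
  simp [wave, h]

end PartialDerivatives

/-! ### The Kirchhoff formula -/

/-- The Euclidean space `ℝ³`. -/
abbrev E3 := EuclideanSpace ℝ (Fin 3)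

/-- The function `(|y|² + ε²)^{1/2}`. -/
def radius (ε : ℝ) (y : E3) : ℝ := √(‖y‖ ^ 2 + ε ^ 2)

/-- The point `((|y|² + ε²)^{1/2}, y)` of the hyperboloid of mass `ε`, or of the future light cone
if `ε = 0`. -/
def hyper (ε : ℝ) (y : E3) : Minkowski := Fin.cons (radius ε y) (fun i => y i)

@[simp] lemma hyper_zero_apply (ε : ℝ) (y : E3) : hyper ε y 0 = radius ε y := rfl

@[simp] lemma hyper_succ_apply (ε : ℝ) (y : E3) (i : Fin 3) : hyper ε y i.succ = y i := rfl

lemma radius_pos {ε : ℝ} (hε : 0 < ε) (y : E3) : 0 < radius ε y :=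
  Real.sqrt_pos.2 (by positivity)

lemma radius_nonneg (ε : ℝ) (y : E3) : 0 ≤ radius ε y := Real.sqrt_nonneg _

lemma radius_sq (ε : ℝ) (y : E3) : radius ε y ^ 2 = ‖y‖ ^ 2 + ε ^ 2 :=
  Real.sq_sqrt (by positivity)

lemma norm_le_radius (ε : ℝ) (y : E3) : ‖y‖ ≤ radius ε y :=
  Real.le_sqrt_of_sq_le (by nlinarith [sq_nonneg ε])

lemma radius_zero (y : E3) : radius 0 y = ‖y‖ := by simp [radius]

/-- The hyperboloid of mass ε is the unit hyperboloid dilated by ε; this scaling isolates the finite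
part of the integrals below as ε tends to 0. -/
lemma radius_smul {ε : ℝ} (hε : 0 < ε) (z : E3) : radius ε (ε • z) = ε * radius 1 z := by
  rw [radius, radius, norm_smul, Real.norm_of_nonneg hε.le,
    show (ε * ‖z‖) ^ 2 + ε ^ 2 = ε ^ 2 * (‖z‖ ^ 2 + 1 ^ 2) by ring,
    Real.sqrt_mul (by positivity), Real.sqrt_sq hε.le]

lemma hyper_smul {ε : ℝ} (hε : 0 < ε) (z : E3) : hyper ε (ε • z) = ε • hyper 1 z := by
  ext a
  refine Fin.cases ?_ (fun i => ?_) a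
  · simp [radius_smul hε]
  · simp

lemma contDiff_radius {ε : ℝ} (hε : 0 < ε) : ContDiff ℝ ∞ (radius ε) := by
  refine ContDiff.sqrt ((contDiff_norm_sq ℝ).add contDiff_const) fun y => ?_
  positivity

lemma contDiff_hyper {ε : ℝ} (hε : 0 < ε) : ContDiff ℝ ∞ (hyper ε) := by
  rw [contDiff_pi]
  intro a
  refine Fin.cases ?_ (fun i => ?_) a
  · exact contDiff_radius hε
  · simp only [hyper_succ_apply]; fun_prop

lemma continuous_radius_uncurry : Continuous fun p : ℝ × E3 => radius p.1 p.2 := by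
  unfold radius; fun_prop

lemma continuous_hyper_uncurry : Continuous fun p : ℝ × E3 => hyper p.1 p.2 := by
  refine continuous_pi fun a => ?_
  refine Fin.cases ?_ (fun i => ?_) a
  · exact continuous_radius_uncurry
  · simp only [hyper_succ_apply]; fun_prop

lemma continuous_hyper (ε : ℝ) : Continuous (hyper ε) :=
  (continuous_hyper_uncurry.comp (Continuous.prodMk_right ε) :)

lemma norm_add_smul_single_sq (y : E3) (i : Fin 3) (s : ℝ) :
    ‖y + s • EuclideanSpace.single i (1 : ℝ)‖ ^ 2 = ‖y‖ ^ 2 + 2 * y i * s + s ^ 2 := by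
  rw [norm_add_sq_real, norm_smul, inner_smul_right, EuclideanSpace.inner_single_right,
    PiLp.norm_single]
  simp
  ring

lemma hasDerivAt_radius {ε : ℝ} (hε : 0 < ε) (y : E3) (i : Fin 3) :
    HasDerivAt (fun s : ℝ => radius ε (y + s • EuclideanSpace.single i 1))
      (y i / radius ε y) 0 := by
  have h1 : HasDerivAt (fun s : ℝ => ‖y‖ ^ 2 + 2 * y i * s + s ^ 2 + ε ^ 2) (2 * y i) 0 := by
    have := ((((hasDerivAt_id (0 : ℝ)).const_mul (2 * y i)).const_add (‖y‖ ^ 2)).add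
      ((hasDerivAt_id (0 : ℝ)).pow 2)).add_const (ε ^ 2)
    refine (this.congr_deriv ?_)
    simp
  have h3 := h1.sqrt (by simp; positivity)
  simp only [radius, norm_add_smul_single_sq]
  refine h3.congr_deriv ?_
  rw [mul_div_mul_left _ _ two_ne_zero]
  simp

section Kirchhoff

set_option linter.unusedSectionVars false

variable {E : Type*} [NormedAddCommGroup E] [NormedSpace ℝ E]

lemma hasDerivAt_comp_hyper {ε : ℝ} (hε : 0 < ε) {g : Minkowski → E}
    (hg : ContDiff ℝ 1 g) (y : E3) (i : Fin 3) :
    HasDerivAt (fun s : ℝ => g (hyper ε (y + s • EuclideanSpace.single i 1)))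
      ((y i / radius ε y) • pd 0 g (hyper ε y) + pd i.succ g (hyper ε y)) 0 := by
  have hc : HasDerivAt (fun s : ℝ => hyper ε (y + s • EuclideanSpace.single i 1))
      ((y i / radius ε y) • Pi.single 0 1 + Pi.single i.succ 1) 0 := by
    rw [hasDerivAt_pi]
    intro a
    refine Fin.cases ?_ (fun j => ?_) a
    · simpa using hasDerivAt_radius hε y i
    · simp only [hyper_succ_apply]
      have := (((hasDerivAt_id (0 : ℝ)).smul_const
        ((EuclideanSpace.single i (1 : ℝ) : E3) j)).const_add (y j))
      convert! this using 1
      by_cases h : j = i <;> simp [h]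
  have hgd := (hg.differentiable one_ne_zero (hyper ε y)).hasFDerivAt
  have := HasFDerivAt.comp_hasDerivAt (x := (0 : ℝ))
    (f := fun s : ℝ => hyper ε (y + s • EuclideanSpace.single i 1)) (l := g)
    (l' := fderiv ℝ g (hyper ε y)) (by simpa using hgd) hc
  convert! this using 1
  simp [pd]

lemma exists_time_bound {g : Minkowski → E} (hg : HasCompactSupport g) :
    ∃ R : ℝ, 0 < R ∧ ∀ x : Minkowski, R < x 0 → g x = 0 := by
  obtain ⟨R, hR⟩ := hg.isBounded.exists_norm_le
  refine ⟨max R 1, by positivity, fun x hx => ?_⟩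
  by_contra h
  have h1 := hR x (subset_tsupport _ h)
  have h2 := norm_le_pi_norm x 0
  have h3 := le_abs_self (x 0)
  rw [Real.norm_eq_abs] at h2
  have := le_max_left R 1
  linarith

lemma hasCompactSupport_comp_hyper (ε : ℝ) {g : Minkowski → E} (hg : HasCompactSupport g) :
    HasCompactSupport fun y => g (hyper ε y) := by
  obtain ⟨R, -, hR⟩ := exists_time_bound hg
  refine HasCompactSupport.intro (isCompact_closedBall (0 : E3) R) fun y hy => hR _ ?_
  simp only [Metric.mem_closedBall, dist_zero_right, not_le] at hy
  exact hy.trans_le (norm_le_radius ε y)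

lemma integral_fderiv_eq_zero {V : E3 → E} (hV : ContDiff ℝ 1 V) (hc : HasCompactSupport V)
    (v : E3) : ∫ y, fderiv ℝ V y v = 0 := by
  have hV' : Continuous fun y => fderiv ℝ V y v :=
    (hV.continuous_fderiv one_ne_zero).clm_apply continuous_const
  have hi := hV'.integrable_of_hasCompactSupport (μ := volume) (hc.fderiv_apply ℝ v)
  have := integral_smul_fderiv_eq_neg_fderiv_smul_of_integrable (μ := (volume : Measure E3))
    (f := fun _ : E3 => (1 : ℝ)) (g := V) (v := v) (by simp) (by simpa using hi)
    (by simpa using hV.continuous.integrable_of_hasCompactSupport hc)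
    (fun x _ => differentiableAt_const _) (fun x _ => hV.differentiable one_ne_zero x)
  simpa using this

/-- The integrand in the Kirchhoff formula is, for each coordinate direction, a derivative up to
the terms displayed here. -/
lemma integral_hyper_direction {ε : ℝ} (hε : 0 < ε) {g : Minkowski → E}
    (hg : ContDiff ℝ 2 g) (hc : HasCompactSupport g) (i : Fin 3) :
    ∫ y, (-((radius ε y)⁻¹ • pd i.succ (pd i.succ g) (hyper ε y))
      + (y i ^ 2 / radius ε y ^ 3) • pd 0 (pd 0 g) (hyper ε y)
      + (1 / radius ε y ^ 2 - 3 * y i ^ 2 / radius ε y ^ 4) • pd 0 g (hyper ε y)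
      - (1 / radius ε y ^ 3 - 3 * y i ^ 2 / radius ε y ^ 5) • g (hyper ε y)) = 0 := by
  have hp : ∀ a, ContDiff ℝ 1 (pd a g) := fun a =>
    contDiff_pd hg (by norm_num [one_add_one_eq_two]) a
  have hκ : ContDiff ℝ 1 (hyper ε) := (contDiff_hyper hε).of_le (by simp)
  have hr : ContDiff ℝ 1 (radius ε) := (contDiff_radius hε).of_le (by simp)
  have hne : ∀ y, radius ε y ≠ 0 := fun y => (radius_pos hε y).ne'
  have hy : ContDiff ℝ 1 fun y : E3 => y i := by fun_prop
  have hri := hr.inv hne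
  -- The leading term produces the second spatial derivative. The second term is chosen to cancel
  -- the mixed derivatives ∂₀∂ᵢg, the third to cancel the ∂ᵢg that arises from differentiating 1/r.
  set V : E3 → E := fun y => -((radius ε y)⁻¹ • pd i.succ g (hyper ε y))
      + (y i * ((radius ε y)⁻¹ ^ 2)) • pd 0 g (hyper ε y)
      - (y i * ((radius ε y)⁻¹ ^ 3)) • g (hyper ε y) with hVdef
  have hV : ContDiff ℝ 1 V :=
    ((hri.smul ((hp i.succ).comp hκ)).neg.add ((hy.mul (hri.pow 2)).smul ((hp 0).comp hκ))).sub
      ((hy.mul (hri.pow 3)).smul ((hg.of_le (by norm_num)).comp hκ))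
  have hVc : HasCompactSupport V := by
    have h1 := hasCompactSupport_comp_hyper ε (hasCompactSupport_pd hc i.succ)
    have h2 := hasCompactSupport_comp_hyper ε (hasCompactSupport_pd hc 0)
    have h3 := hasCompactSupport_comp_hyper ε hc
    exact (h1.smul_left.neg.add h2.smul_left).sub h3.smul_left
  rw [← integral_fderiv_eq_zero hV hVc (EuclideanSpace.single i 1)]
  refine integral_congr_ae (ae_of_all _ fun y => ?_)
  have hl := (hV.differentiable one_ne_zero y).hasFDerivAt.hasLineDerivAt
    (EuclideanSpace.single i 1)
  refine HasDerivAt.unique ?_ hl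
  have dr := hasDerivAt_radius hε y i
  have dri := dr.inv (by simpa using hne y)
  have dy : HasDerivAt (fun s : ℝ => (y + s • EuclideanSpace.single i (1 : ℝ) : E3) i) 1 0 := by
    have := (((hasDerivAt_id (0 : ℝ)).smul_const
        ((EuclideanSpace.single i (1 : ℝ) : E3) i)).const_add (y i))
    convert! this using 1
    simp
  have d := ((dri.smul (hasDerivAt_comp_hyper hε (hp i.succ) y i)).neg.add
    ((dy.mul (dri.pow 2)).smul (hasDerivAt_comp_hyper hε (hp 0) y i))).sub
    ((dy.mul (dri.pow 3)).smul (hasDerivAt_comp_hyper hε (hg.of_le (by norm_num)) y i))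
  convert! d using 1
  simp only [Pi.inv_apply, Pi.pow_apply, Pi.mul_apply, zero_smul, add_zero,
    pd_comm hg le_rfl 0 i.succ, Nat.reduceSub, pow_one]
  have := hne y
  match_scalars <;> field_simp <;> ring

/-- After summing the three directional identities, |y|² = r² - ε² completes the wave operator and
turns every remaining coefficient into a multiple of ε². -/
lemma integral_inv_radius_smul_wave {ε : ℝ} (hε : 0 < ε) {g : Minkowski → E}
    (hg : ContDiff ℝ 2 g) (hc : HasCompactSupport g) :
    ∫ y, (radius ε y)⁻¹ • wave g (hyper ε y) =
      ∫ y, ((3 * ε ^ 2 / radius ε y ^ 5) • g (hyper ε y)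
        - (3 * ε ^ 2 / radius ε y ^ 4) • pd 0 g (hyper ε y)
        + (ε ^ 2 / radius ε y ^ 3) • pd 0 (pd 0 g) (hyper ε y)) := by
  have hp : ∀ a, ContDiff ℝ 1 (pd a g) := fun a =>
    contDiff_pd hg (by norm_num [one_add_one_eq_two]) a
  have hr : Continuous (radius ε) := (contDiff_radius hε).continuous
  have hne : ∀ y, radius ε y ≠ 0 := fun y => (radius_pos hε y).ne'
  have hi : ∀ {c : E3 → ℝ} {f : Minkowski → E}, Continuous c → Continuous f →
      HasCompactSupport f → Integrable (fun y => c y • f (hyper ε y)) := by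
    intro c f h1 h2 h3
    exact (h1.smul (h2.comp (continuous_hyper ε))).integrable_of_hasCompactSupport
      (hasCompactSupport_comp_hyper ε h3).smul_left
  have hpp : ∀ a, Continuous (pd a (pd a g)) := fun a => continuous_pd (hp a) le_rfl a
  have hppc : ∀ a, HasCompactSupport (pd a (pd a g)) := fun a =>
    hasCompactSupport_pd (hasCompactSupport_pd hc a) a
  have hpow : ∀ (k : ℕ) (c : E3 → ℝ), Continuous c → Continuous fun y => c y / radius ε y ^ k :=
    fun k c h => h.div (hr.pow k) fun y => pow_ne_zero k (hne y)
  have hyi : ∀ i : Fin 3, Continuous fun y : E3 => y i := fun i => by fun_prop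
  rw [← sub_eq_zero, ← integral_sub]
  · have hsum := Finset.sum_congr (rfl : (Finset.univ : Finset (Fin 3)) = Finset.univ)
      fun i _ => integral_hyper_direction hε hg hc i
    rw [← integral_finsetSum] at hsum
    · rw [Finset.sum_const_zero] at hsum
      rw [← hsum]
      refine integral_congr_ae (ae_of_all _ fun y => ?_)
      have hsq : ∑ i, y i ^ 2 = radius ε y ^ 2 - ε ^ 2 := by
        rw [radius_sq, EuclideanSpace.norm_sq_eq]; simp
      have h0 := hne y
      rw [Fin.sum_univ_three] at hsq
      have h2 : y 2 ^ 2 = radius ε y ^ 2 - ε ^ 2 - y 0 ^ 2 - y 1 ^ 2 := by linarith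
      simp only [wave, Fin.sum_univ_three, h2]
      match_scalars <;> field_simp <;> ring
    · intro i _
      refine (((hi (hr.inv₀ hne) (hpp _) (hppc _)).neg.add
        (hi (hpow 3 _ ((hyi i).pow 2)) (hpp _) (hppc _))).add (hi ((hpow 2 _ continuous_const).sub
          (hpow 4 _ (continuous_const.mul ((hyi i).pow 2)))) (hp 0).continuous
          (hasCompactSupport_pd hc 0))).sub (hi ((hpow 3 _ continuous_const).sub
          (hpow 5 _ (continuous_const.mul ((hyi i).pow 2)))) hg.continuous hc)
  · exact hi (hr.inv₀ hne) (continuous_wave hg) (hasCompactSupport_wave hc)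
  · exact ((hi (hpow 5 _ continuous_const) hg.continuous hc).sub
      (hi (hpow 4 _ continuous_const) (hp 0).continuous (hasCompactSupport_pd hc 0))).add
      (hi (hpow 3 _ continuous_const) (hpp 0) (hppc 0))

/-- Substituting y = εz, the Jacobian ε³ makes the coefficient of g independent of ε, while the
derivative terms keep a factor ε or ε² and disappear in the limit. -/
lemma integral_inv_radius_smul_wave_rescaled {ε : ℝ} (hε : 0 < ε) {g : Minkowski → E}
    (hg : ContDiff ℝ 2 g) (hc : HasCompactSupport g) :
    ∫ y, (radius ε y)⁻¹ • wave g (hyper ε y) =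
      ∫ z, ((3 / radius 1 z ^ 5) • g (ε • hyper 1 z)
        - (3 * ε / radius 1 z ^ 4) • pd 0 g (ε • hyper 1 z)
        + (ε ^ 2 / radius 1 z ^ 3) • pd 0 (pd 0 g) (ε • hyper 1 z)) := by
  rw [integral_inv_radius_smul_wave hε hg hc]
  have h := Measure.integral_comp_smul_of_nonneg (volume : Measure E3)
    (fun y => ((3 * ε ^ 2 / radius ε y ^ 5) • g (hyper ε y)
        - (3 * ε ^ 2 / radius ε y ^ 4) • pd 0 g (hyper ε y)
        + (ε ^ 2 / radius ε y ^ 3) • pd 0 (pd 0 g) (hyper ε y))) ε (hR := hε.le)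
  rw [finrank_euclideanSpace_fin] at h
  rw [← inv_smul_eq_iff₀ (by positivity : (ε ^ 3)⁻¹ ≠ 0), inv_inv, ← integral_smul] at h
  rw [← h]
  refine integral_congr_ae (ae_of_all _ fun z => ?_)
  have h1 := (radius_pos one_pos z).ne'
  have h2 := hε.ne'
  simp only [radius_smul hε, hyper_smul hε]
  match_scalars <;> field_simp

/-- The constant in the Kirchhoff formula (its value is `4π`). -/
def kirchhoffConst : ℝ := ∫ z : E3, 3 / radius 1 z ^ 5

lemma one_le_radius_one (z : E3) : 1 ≤ radius 1 z :=
  Real.le_sqrt_of_sq_le (by nlinarith [sq_nonneg ‖z‖])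

/-- The decay exponent 4 exceeds the dimension 3. This function dominates all terms of the rescaled
integrand. -/
lemma integrable_inv_radius_pow_four : Integrable fun z : E3 => (radius 1 z ^ 4)⁻¹ := by
  have h := integrable_rpow_neg_one_add_norm_sq (E := E3) (μ := volume) (r := 4)
    (by rw [finrank_euclideanSpace_fin]; norm_num)
  refine h.congr (ae_of_all _ fun z => ?_)
  have h1 : radius 1 z ^ 4 = (1 + ‖z‖ ^ 2) ^ 2 := by
    rw [show radius 1 z ^ 4 = (radius 1 z ^ 2) ^ 2 by ring, radius_sq]; ring
  have h2 : (-4 / 2 : ℝ) = -((2 : ℕ) : ℝ) := by norm_num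
  simp only [h1, h2]
  rw [Real.rpow_neg (by positivity), Real.rpow_natCast]

lemma integrable_inv_radius_pow_five : Integrable fun z : E3 => 3 / radius 1 z ^ 5 := by
  refine (integrable_inv_radius_pow_four.const_mul 3).mono' ?_ (ae_of_all _ fun z => ?_)
  · exact (continuous_const.div ((contDiff_radius one_pos).continuous.pow 5)
      fun z => (pow_pos (radius_pos one_pos z) 5).ne').aestronglyMeasurable
  · have h1 := one_le_radius_one z
    rw [Real.norm_of_nonneg (by positivity), div_eq_mul_inv]
    gcongr
    norm_num

lemma kirchhoffConst_pos : 0 < kirchhoffConst := by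
  rw [kirchhoffConst, integral_pos_iff_support_of_nonneg]
  · have : Function.support (fun z : E3 => 3 / radius 1 z ^ 5) = Set.univ := by
      ext z
      have := radius_pos one_pos z
      simp [this.ne']
    rw [this]
    simp
  · intro z
    have := radius_nonneg 1 z
    simp only [Pi.zero_apply]
    positivity
  · exact integrable_inv_radius_pow_five

/-- In polar coordinates the factor r² removes the singularity at the origin. -/
lemma integrable_inv_norm_closedBall (R : ℝ) :
    Integrable ((Metric.ball (0 : E3) R).indicator fun y => ‖y‖⁻¹) := by
  rw [integrable_indicator_iff measurableSet_ball]
  have h := integrableOn_fun_norm_addHaar (E := E3) (volume : Measure E3) (f := fun r : ℝ => r⁻¹)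
    (r := R)
  refine h.2 ?_
  rw [finrank_euclideanSpace_fin]
  refine (continuous_id.integrableOn_Icc (a := 0) (b := R)).mono_set Set.Ioo_subset_Icc_self
    |>.congr_fun (fun r hr => ?_) measurableSet_Ioo
  have : r ≠ 0 := hr.1.ne'
  simp
  field_simp

/-- **Kirchhoff's formula**: the measure `dy / |y|` on the future light cone is, up to a factor, a
fundamental solution of the wave equation. -/
theorem integral_inv_norm_smul_wave [CompleteSpace E] {g : Minkowski → E}
    (hg : ContDiff ℝ 2 g) (hc : HasCompactSupport g) :
    ∫ y : E3, ‖y‖⁻¹ • wave g (hyper 0 y) = kirchhoffConst • g 0 := by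
  have hp : ContDiff ℝ 1 (pd 0 g) := contDiff_pd hg (by norm_num [one_add_one_eq_two]) 0
  have hpp : Continuous (pd 0 (pd 0 g)) := continuous_pd hp le_rfl 0
  obtain ⟨R, hR0, hR⟩ := exists_time_bound (hasCompactSupport_wave hc)
  obtain ⟨R', hR0', hR'⟩ := exists_time_bound
    (hasCompactSupport_pd (hasCompactSupport_pd hc 0) 0)
  obtain ⟨C, hC⟩ := (continuous_wave hg).bounded_above_of_compact_support
    (hasCompactSupport_wave hc)
  obtain ⟨C₀, hC₀⟩ := hg.continuous.bounded_above_of_compact_support hc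
  obtain ⟨C₁, hC₁⟩ := hp.continuous.bounded_above_of_compact_support (hasCompactSupport_pd hc 0)
  obtain ⟨C₂, hC₂⟩ := hpp.bounded_above_of_compact_support
    (hasCompactSupport_pd (hasCompactSupport_pd hc 0) 0)
  -- As r ≥ |y| and the wave expression vanishes at late times, the integrands are dominated by a
  -- constant times |y|⁻¹ on a fixed ball.
  have hl : Filter.Tendsto (fun ε : ℝ => ∫ y, (radius ε y)⁻¹ • wave g (hyper ε y))
      (nhdsWithin 0 (Set.Ioi 0)) (nhds (∫ y : E3, ‖y‖⁻¹ • wave g (hyper 0 y))) := by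
    refine tendsto_integral_filter_of_dominated_convergence
      (fun y => C * (Metric.ball (0 : E3) (R + 1)).indicator (fun y => ‖y‖⁻¹) y) ?_ ?_ ?_ ?_
    · filter_upwards [self_mem_nhdsWithin] with ε hε
      exact (((contDiff_radius hε).continuous.inv₀ fun y => (radius_pos hε y).ne').smul
        ((continuous_wave hg).comp (continuous_hyper ε))).aestronglyMeasurable
    · filter_upwards [self_mem_nhdsWithin] with ε hε
      have hne : ∀ᵐ y : E3, y ≠ 0 := by simp [ae_iff]
      filter_upwards [hne] with y hy
      by_cases hy' : ‖y‖ < R + 1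
      · rw [Set.indicator_of_mem (by simpa using hy'), norm_smul, mul_comm, norm_inv,
          Real.norm_of_nonneg (radius_nonneg _ _)]
        have h0 : 0 < ‖y‖ := norm_pos_iff.2 hy
        have h1 := norm_le_radius ε y
        have h2 : 0 ≤ C := (norm_nonneg _).trans (hC 0)
        have h3 := inv_nonneg.2 (radius_nonneg ε y)
        gcongr
        exact hC _
      · rw [hR _ (by
          have := norm_le_radius ε y
          rw [hyper_zero_apply]
          linarith), Set.indicator_of_notMem (by simpa using hy')]
        simp
    · exact (integrable_inv_norm_closedBall _).const_mul _
    · have hne : ∀ᵐ y : E3, y ≠ 0 := by simp [ae_iff]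
      filter_upwards [hne] with y hy
      have h1 : Filter.Tendsto (fun ε => radius ε y) (nhds 0) (nhds (radius 0 y)) :=
        (continuous_radius_uncurry.comp (Continuous.prodMk_left y)).tendsto 0
      have h2 : Filter.Tendsto (fun ε => hyper ε y) (nhds 0) (nhds (hyper 0 y)) :=
        (continuous_hyper_uncurry.comp (Continuous.prodMk_left y)).tendsto 0
      rw [radius_zero] at h1
      exact ((h1.inv₀ (norm_ne_zero_iff.2 hy)).smul
        (((continuous_wave hg).tendsto _).comp h2)).mono_left nhdsWithin_le_nhds
  have hr : Filter.Tendsto (fun ε : ℝ => ∫ y, (radius ε y)⁻¹ • wave g (hyper ε y))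
      (nhdsWithin 0 (Set.Ioi 0)) (nhds (∫ z : E3, (3 / radius 1 z ^ 5) • g 0)) := by
    have he : (fun ε : ℝ => ∫ z, ((3 / radius 1 z ^ 5) • g (ε • hyper 1 z)
        - (3 * ε / radius 1 z ^ 4) • pd 0 g (ε • hyper 1 z)
        + (ε ^ 2 / radius 1 z ^ 3) • pd 0 (pd 0 g) (ε • hyper 1 z)))
        =ᶠ[nhdsWithin 0 (Set.Ioi 0)] fun ε : ℝ => ∫ y, (radius ε y)⁻¹ • wave g (hyper ε y) := by
      filter_upwards [self_mem_nhdsWithin] with ε hε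
      exact (integral_inv_radius_smul_wave_rescaled hε hg hc).symm
    refine Filter.Tendsto.congr' he ?_
    have hrc : Continuous (radius 1) := (contDiff_radius one_pos).continuous
    have hdiv : ∀ (k : ℕ) (c : ℝ), Continuous fun z => c / radius 1 z ^ k := fun k c =>
      continuous_const.div (hrc.pow k) fun z => (pow_pos (radius_pos one_pos z) k).ne'
    have hs : ∀ ε : ℝ, Continuous fun z => ε • hyper 1 z := fun ε =>
      (continuous_hyper 1).const_smul ε
    refine tendsto_integral_filter_of_dominated_convergence
      (fun z => (3 * C₀ + 3 * C₁ + R' * C₂) * (radius 1 z ^ 4)⁻¹) ?_ ?_ ?_ ?_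
    · refine Filter.Eventually.of_forall fun ε => Continuous.aestronglyMeasurable ?_
      exact (((hdiv 5 _).smul (hg.continuous.comp (hs ε))).sub ((hdiv 4 _).smul
        (hp.continuous.comp (hs ε)))).add ((hdiv 3 _).smul (hpp.comp (hs ε)))
    · have h1 : ∀ᶠ ε : ℝ in nhdsWithin 0 (Set.Ioi 0), ε < 1 :=
        nhdsWithin_le_nhds (Iio_mem_nhds one_pos)
      filter_upwards [self_mem_nhdsWithin, h1] with ε hε h1
      refine ae_of_all _ fun z => ?_
      have hz := one_le_radius_one z
      have hε' : 0 < ε := hε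
      have hC₀' := (norm_nonneg _).trans (hC₀ 0)
      have hC₁' := (norm_nonneg _).trans (hC₁ 0)
      have hC₂' := (norm_nonneg _).trans (hC₂ 0)
      have t0 : ‖(3 / radius 1 z ^ 5) • g (ε • hyper 1 z)‖ ≤ 3 * C₀ * (radius 1 z ^ 4)⁻¹ := by
        rw [norm_smul, Real.norm_of_nonneg (by positivity), div_eq_mul_inv, mul_right_comm]
        gcongr
        · exact hC₀ _
        · norm_num
      have t1 : ‖(3 * ε / radius 1 z ^ 4) • pd 0 g (ε • hyper 1 z)‖
          ≤ 3 * C₁ * (radius 1 z ^ 4)⁻¹ := by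
        rw [norm_smul, Real.norm_of_nonneg (by positivity), div_eq_mul_inv, mul_right_comm]
        gcongr
        · nlinarith
        · exact hC₁ _
      -- The decay r⁻³ alone is not integrable. On the support of ∂₀²g, however, εr ≤ R', so ε²/r³ =
      -- ε(εr)/r⁴ is bounded by R'/r⁴.
      have t2 : ‖(ε ^ 2 / radius 1 z ^ 3) • pd 0 (pd 0 g) (ε • hyper 1 z)‖
          ≤ R' * C₂ * (radius 1 z ^ 4)⁻¹ := by
        by_cases h : R' < ε * radius 1 z
        · rw [hR' _ (by simpa using h)]
          simp only [smul_zero, norm_zero]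
          positivity
        · rw [norm_smul, Real.norm_of_nonneg (by positivity),
            show ε ^ 2 / radius 1 z ^ 3 = (ε * (ε * radius 1 z)) * (radius 1 z ^ 4)⁻¹ by
              field_simp, mul_right_comm]
          gcongr
          · nlinarith [not_lt.1 h]
          · exact hC₂ _
      calc _ ≤ _ := norm_add_le _ _
        _ ≤ _ := add_le_add_left (norm_sub_le _ _) _
        _ ≤ _ := add_le_add (add_le_add t0 t1) t2
        _ = _ := by ring
    · exact integrable_inv_radius_pow_four.const_mul _
    · refine ae_of_all _ fun z => ?_
      have hcont : Continuous fun ε : ℝ => (3 / radius 1 z ^ 5) • g (ε • hyper 1 z)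
          - (3 * ε / radius 1 z ^ 4) • pd 0 g (ε • hyper 1 z)
          + (ε ^ 2 / radius 1 z ^ 3) • pd 0 (pd 0 g) (ε • hyper 1 z) := by
        have hs : Continuous fun ε : ℝ => ε • hyper 1 z := by fun_prop
        exact ((continuous_const.smul (hg.continuous.comp hs)).sub
          (((continuous_const.mul continuous_id).div_const _).smul (hp.continuous.comp hs))).add
          (((continuous_id.pow 2).div_const _).smul (hpp.comp hs))
      have := (hcont.tendsto 0).mono_left (nhdsWithin_le_nhds (s := Set.Ioi 0))
      simpa using this
  rw [tendsto_nhds_unique hl hr, integral_smul_const, kirchhoffConst]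

end Kirchhoff

end

section

/-! ### Retarded and advanced fundamental solutions of the Klein-Gordon equation -/

/-- The future-directed causal vectors, and zero. -/
def futureCone : Set Minkowski := {w | 0 ≤ w 0 ∧ ∑ i : Fin 3, w i.succ ^ 2 ≤ w 0 ^ 2}

lemma isClosed_futureCone : IsClosed futureCone :=
  (isClosed_le (f := fun _ => (0 : ℝ)) (g := fun w : Minkowski => w 0) (by fun_prop)
    (by fun_prop)).inter (isClosed_le (f := fun w : Minkowski => ∑ i : Fin 3, w i.succ ^ 2)
      (g := fun w => w 0 ^ 2) (by fun_prop) (by fun_prop))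

/-- The triangle inequality for the spatial parts. It keeps the convolution powers of a measure on
the cone inside the cone. -/
lemma add_mem_futureCone {v w : Minkowski} (hv : v ∈ futureCone) (hw : w ∈ futureCone) :
    v + w ∈ futureCone := by
  refine ⟨add_nonneg hv.1 hw.1, ?_⟩
  have key : ∀ u : Minkowski, ∑ i : Fin 3, u i.succ ^ 2
      = ‖(WithLp.toLp 2 (fun i : Fin 3 => u i.succ) : E3)‖ ^ 2 := fun u => by
    simp [EuclideanSpace.norm_sq_eq]
  have hv2 := hv.2
  have hw2 := hw.2
  rw [key] at hv2 hw2 ⊢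
  have h1 := abs_le_of_sq_le_sq hv2 hv.1
  have h2 := abs_le_of_sq_le_sq hw2 hw.1
  have h3 : (WithLp.toLp 2 (fun i : Fin 3 => (v + w) i.succ) : E3)
      = WithLp.toLp 2 (fun i : Fin 3 => v i.succ) + WithLp.toLp 2 (fun i : Fin 3 => w i.succ) := rfl
  rw [h3]
  have h4 := norm_add_le (WithLp.toLp 2 (fun i : Fin 3 => v i.succ) : E3)
    (WithLp.toLp 2 (fun i : Fin 3 => w i.succ))
  rw [abs_norm] at h1 h2
  gcongr
  exact h4.trans (add_le_add h1 h2)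

lemma hyper_zero_mem_futureCone (y : E3) : hyper 0 y ∈ futureCone := by
  refine ⟨radius_nonneg _ _, ?_⟩
  simp [radius_sq, EuclideanSpace.norm_sq_eq]

/-- A fundamental solution of the Klein-Gordon equation `(□ + 1) u = j`, given by a difference of
two weighted measures supported in a cone. -/
structure Propagator where
  weight : Minkowski → ℝ
  continuous_weight : Continuous weight
  pos : Measure Minkowski
  neg : Measure Minkowski
  finite_pos : IsFiniteMeasure pos
  finite_neg : IsFiniteMeasure neg
  cone : Set Minkowski
  ae_pos : ∀ᵐ w ∂pos, w ∈ cone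
  ae_neg : ∀ᵐ w ∂neg, w ∈ cone
  fundamental : ∀ g : Minkowski → Spinor, ContDiff ℝ 2 g → HasCompactSupport g → ∀ x,
    ∫ w, weight w • (wave g (x - w) + g (x - w)) ∂pos
      - ∫ w, weight w • (wave g (x - w) + g (x - w)) ∂neg = g x

lemma integrable_weight_smul {μ : Measure Minkowski} [IsFiniteMeasure μ] {e : Minkowski → ℝ}
    (he : Continuous e) {j : Minkowski → Spinor} (hj : Continuous j) (hjc : HasCompactSupport j)
    (x : Minkowski) : Integrable (fun w => e w • j (x - w)) μ := by
  refine Continuous.integrable_of_hasCompactSupport (he.smul (by fun_prop)) ?_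
  have h : HasCompactSupport (j ∘ Homeomorph.subLeft x) :=
    hjc.comp_homeomorph (Homeomorph.subLeft x)
  exact h.smul_left (f := e)

/-! ### Convolution powers and the Neumann series for □ + 1. -/

section Neumann

set_option linter.unusedSectionVars false

variable (μ : Measure Minkowski)

/-- The convolution powers `μ^{*(n+1)}`. -/
def convPow : ℕ → Measure Minkowski
  | 0 => μ
  | n + 1 => Measure.conv (convPow n) μ

variable [IsFiniteMeasure μ]

instance isFiniteMeasure_convPow (n : ℕ) : IsFiniteMeasure (convPow μ n) := by
  induction n with
  | zero => assumption
  | succ n ih => exact Measure.finite_of_finite_conv (convPow μ n) μ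

lemma convPow_univ (n : ℕ) : convPow μ n Set.univ = μ Set.univ ^ (n + 1) := by
  induction n with
  | zero => simp [convPow]
  | succ n ih =>
    rw [convPow, Measure.conv, Measure.map_apply (by fun_prop) MeasurableSet.univ,
      Set.preimage_univ, Measure.prod_apply MeasurableSet.univ]
    simp [ih]
    ring

lemma tsum_convPow_lt_top (hμ : μ Set.univ < 1) : ∑' n, convPow μ n Set.univ < ⊤ := by
  simp only [convPow_univ, pow_succ]
  rw [ENNReal.tsum_mul_right, ENNReal.tsum_geometric]
  refine ENNReal.mul_lt_top ?_ (measure_lt_top _ _)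
  rw [ENNReal.inv_lt_top]
  exact tsub_pos_of_lt hμ

lemma isFiniteMeasure_sum_convPow (hμ : μ Set.univ < 1) {k : ℕ → ℕ} (hk : Function.Injective k) :
    IsFiniteMeasure (Measure.sum fun n => convPow μ (k n)) := by
  refine ⟨?_⟩
  rw [Measure.sum_apply _ MeasurableSet.univ]
  exact (ENNReal.tsum_comp_le_tsum_of_injective hk fun n => convPow μ n Set.univ).trans_lt
    (tsum_convPow_lt_top μ hμ)

lemma ae_convPow_mem_futureCone (hc : ∀ᵐ w ∂μ, w ∈ futureCone) (n : ℕ) :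
    ∀ᵐ w ∂convPow μ n, w ∈ futureCone := by
  induction n with
  | zero => exact hc
  | succ n ih =>
    rw [convPow, Measure.conv, ae_map_iff (p := (· ∈ futureCone)) (by fun_prop)
      isClosed_futureCone.measurableSet]
    filter_upwards [Measure.quasiMeasurePreserving_fst.ae ih,
      Measure.quasiMeasurePreserving_snd.ae hc] with p h1 h2
    exact add_mem_futureCone h1 h2

/-- The Neumann series turns a fundamental solution of the wave equation into one of the
Klein-Gordon equation. -/
theorem exists_propagator_of_wave (hμ : μ Set.univ < 1) (hc : ∀ᵐ w ∂μ, w ∈ futureCone)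
    {e : Minkowski → ℝ} (he : Continuous e) (hmul : ∀ v w, e (v + w) = e v * e w)
    (hw : ∀ g : Minkowski → Spinor, ContDiff ℝ 2 g → HasCompactSupport g → ∀ x,
      ∫ w, e w • wave g (x - w) ∂μ = g x) :
    ∃ Q : Propagator, Q.cone = futureCone := by
  -- The Neumann series has alternating signs: the odd-indexed members of `convPow` enter
  -- negatively, so even and odd members are collected in two positive measures.
  have hk0 : Function.Injective fun n : ℕ => 2 * n := fun a b h => by simpa using h
  have hk1 : Function.Injective fun n : ℕ => 2 * n + 1 := fun a b h => by simpa using h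
  have hf0 := isFiniteMeasure_sum_convPow μ hμ hk0
  have hf1 := isFiniteMeasure_sum_convPow μ hμ hk1
  refine ⟨{ weight := e
            continuous_weight := he
            pos := Measure.sum fun n => convPow μ (2 * n)
            neg := Measure.sum fun n => convPow μ (2 * n + 1)
            finite_pos := hf0
            finite_neg := hf1
            cone := futureCone
            ae_pos := Measure.ae_sum_iff.2 fun n => ae_convPow_mem_futureCone μ hc _
            ae_neg := Measure.ae_sum_iff.2 fun n => ae_convPow_mem_futureCone μ hc _
            fundamental := ?_ }, rfl⟩
  intro g hg hgc x
  have hgw := continuous_wave hg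
  have hgwc := hasCompactSupport_wave hgc
  -- Multiplicativity of e and the wave equation for μ give a (n + 1) = b n, so the alternating sum
  -- of a n + b n telescopes to a 0 = g x.
  set a : ℕ → Spinor := fun n => ∫ w, e w • wave g (x - w) ∂convPow μ n with ha
  set b : ℕ → Spinor := fun n => ∫ w, e w • g (x - w) ∂convPow μ n with hb
  have ha0 : a 0 = g x := hw g hg hgc x
  have hab : ∀ n, a (n + 1) = b n := by
    intro n
    simp only [ha, hb]
    rw [convPow, integral_conv (by
      have : IsFiniteMeasure (Measure.conv (convPow μ n) μ) :=
        Measure.finite_of_finite_conv (convPow μ n) μ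
      exact integrable_weight_smul he hgw hgwc x)]
    refine integral_congr_ae (ae_of_all _ fun v => ?_)
    simp only [hmul, ← sub_sub, mul_smul]
    rw [integral_smul, hw g hg hgc]
  simp only [smul_add]
  rw [integral_add (integrable_weight_smul he hgw hgwc x)
      (integrable_weight_smul he hg.continuous hgc x),
    integral_add (integrable_weight_smul he hgw hgwc x)
      (integrable_weight_smul he hg.continuous hgc x)]
  have A0 : HasSum (fun n => a (2 * n)) _ :=
    hasSum_integral_measure (integrable_weight_smul he hgw hgwc x
      (μ := Measure.sum fun n => convPow μ (2 * n)))
  have A1 : HasSum (fun n => a (2 * n + 1)) _ :=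
    hasSum_integral_measure (integrable_weight_smul he hgw hgwc x
      (μ := Measure.sum fun n => convPow μ (2 * n + 1)))
  have B0 : HasSum (fun n => b (2 * n)) _ :=
    hasSum_integral_measure (integrable_weight_smul he hg.continuous hgc x
      (μ := Measure.sum fun n => convPow μ (2 * n)))
  have B1 : HasSum (fun n => b (2 * n + 1)) _ :=
    hasSum_integral_measure (integrable_weight_smul he hg.continuous hgc x
      (μ := Measure.sum fun n => convPow μ (2 * n + 1)))
  simp only [hab] at A1
  rw [← hasSum_nat_add_iff' 1] at A0
  simp only [mul_add, mul_one, Finset.range_one, Finset.sum_singleton, mul_zero,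
    ha0] at A0
  have A0' : (fun n => a (2 * n + 2)) = fun n => b (2 * n + 1) := funext fun n => hab _
  rw [A0'] at A0
  have e1 := A1.unique B0
  have e2 := A0.unique B1
  rw [e1, ← e2]
  abel

end Neumann

/-! ### The damped measure on the light cone. -/

lemma integrable_exp_neg_norm_mul_inv_norm :
    Integrable fun y : E3 => Real.exp (-‖y‖) * ‖y‖⁻¹ := by
  refine (integrable_fun_norm_addHaar (E := E3) volume
    (f := fun r : ℝ => Real.exp (-r) * r⁻¹)).2 ?_
  rw [finrank_euclideanSpace_fin]
  refine (Real.GammaIntegral_convergent (s := 2) two_pos).congr_fun (fun r hr => ?_)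
    measurableSet_Ioi
  have : r ≠ 0 := (ne_of_gt hr)
  norm_num
  field_simp

/-- Scaling y by l shows that the total mass is c/l², with c = `kirchhoffConst`⁻¹ times the integral
of exp(-|y|)/|y|. The choice l = c + 1 makes it less than 1. -/
lemma exists_decay_rate : ∃ l : ℝ, 0 < l ∧
    Integrable (fun y : E3 => kirchhoffConst⁻¹ * (Real.exp (-(l * ‖y‖)) * ‖y‖⁻¹)) ∧
    ∫ y : E3, kirchhoffConst⁻¹ * (Real.exp (-(l * ‖y‖)) * ‖y‖⁻¹) < 1 := by
  set I := ∫ y : E3, Real.exp (-‖y‖) * ‖y‖⁻¹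
  have hI : 0 ≤ I := integral_nonneg fun y => by positivity
  have hC := kirchhoffConst_pos
  set l := kirchhoffConst⁻¹ * I + 1 with hl
  have hl0 : 1 ≤ l := by have : 0 ≤ kirchhoffConst⁻¹ * I := by positivity
                         linarith
  have hl1 : 0 < l := by linarith
  have he : (fun y : E3 => kirchhoffConst⁻¹ * (Real.exp (-(l * ‖y‖)) * ‖y‖⁻¹))
      = fun y => (kirchhoffConst⁻¹ * l) * (Real.exp (-‖l • y‖) * ‖l • y‖⁻¹) := by
    funext y
    rw [norm_smul, Real.norm_of_nonneg hl1.le, mul_inv]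
    field_simp
  refine ⟨l, hl1, ?_, ?_⟩
  · rw [he]
    exact (integrable_exp_neg_norm_mul_inv_norm.comp_smul hl1.ne').const_mul _
  · rw [he, integral_const_mul, Measure.integral_comp_smul_of_nonneg (volume : Measure E3)
      (fun y => Real.exp (-‖y‖) * ‖y‖⁻¹) l (hR := hl1.le), finrank_euclideanSpace_fin, smul_eq_mul]
    have : kirchhoffConst⁻¹ * l * ((l ^ 3)⁻¹ * I) = (kirchhoffConst⁻¹ * I) / l ^ 2 := by
      field_simp
    change kirchhoffConst⁻¹ * l * ((l ^ 3)⁻¹ * I) < 1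
    rw [this, div_lt_one (by positivity)]
    nlinarith

lemma pd_comp_sub_left {n : ℕ} {E : Type*} [NormedAddCommGroup E] [NormedSpace ℝ E]
    (g : (Fin n → ℝ) → E) (x : Fin n → ℝ) (a : Fin n) :
    pd a (fun w => g (x - w)) = fun w => -pd a g (x - w) := by
  funext w
  have h := (ContinuousLinearEquiv.neg ℝ (M := Fin n → ℝ)).comp_right_fderiv
    (f := fun u => g (x + u)) (x := w)
  have h2 : (fun u => g (x + u)) ∘ (ContinuousLinearEquiv.neg ℝ (M := Fin n → ℝ))
      = fun w => g (x - w) := by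
    funext w; simp [sub_eq_add_neg]
  rw [h2, fderiv_comp_add_left] at h
  rw [pd, h]
  simp [pd, sub_eq_add_neg]

lemma pd_neg {n : ℕ} {E : Type*} [NormedAddCommGroup E] [NormedSpace ℝ E]
    (g : (Fin n → ℝ) → E) (a : Fin n) :
    pd a (fun w => -g w) = fun w => -pd a g w := by
  funext w
  rw [pd, fderiv_fun_neg]
  simp [pd]

lemma wave_comp_sub_left {E : Type*} [NormedAddCommGroup E] [NormedSpace ℝ E]
    (g : Minkowski → E) (x : Minkowski) :
    wave (fun w => g (x - w)) = fun w => wave g (x - w) := by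
  funext w
  simp only [wave, pd_comp_sub_left, pd_neg, neg_neg]

/-- The density of Kirchhoff's measure is multiplied by exp(-l|y|) to make the Neumann series
converge. The weight exp(l w⁰) is multiplicative and undoes the damping exactly, because w⁰ = |y| on
the cone. -/
theorem exists_retarded : ∃ Q : Propagator, Q.cone = futureCone := by
  obtain ⟨l, hl, hinteg, hlt⟩ := exists_decay_rate
  have hC := kirchhoffConst_pos
  set d : E3 → ℝ := fun y => kirchhoffConst⁻¹ * (Real.exp (-(l * ‖y‖)) * ‖y‖⁻¹) with hd
  have hd0 : ∀ y, 0 ≤ d y := fun y => by positivity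
  have hdm : Measurable d := by fun_prop
  set ρ : Measure E3 := volume.withDensity fun y => ENNReal.ofReal (d y) with hρ
  have hmass : ρ Set.univ = ENNReal.ofReal (∫ y, d y) := by
    rw [hρ, withDensity_apply _ MeasurableSet.univ, Measure.restrict_univ,
      ofReal_integral_eq_lintegral_ofReal hinteg (ae_of_all _ hd0)]
  have hρf : IsFiniteMeasure ρ := ⟨by rw [hmass]; exact ENNReal.ofReal_lt_top⟩
  have hh : Measurable (hyper 0) := (continuous_hyper 0).measurable
  refine exists_propagator_of_wave (ρ.map (hyper 0)) ?_ ?_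
    (e := fun w => Real.exp (l * w 0)) (by fun_prop) (fun v w => ?_) fun g hg hgc x => ?_
  · rw [Measure.map_apply hh MeasurableSet.univ, Set.preimage_univ, hmass]
    exact ENNReal.ofReal_lt_one.2 hlt
  · rw [ae_map_iff (p := (· ∈ futureCone)) hh.aemeasurable isClosed_futureCone.measurableSet]
    exact ae_of_all _ hyper_zero_mem_futureCone
  · rw [← Real.exp_add, Pi.add_apply, mul_add]
  · have hgw := continuous_wave hg
    rw [integral_map hh.aemeasurable
      (Continuous.aestronglyMeasurable (by fun_prop)), hρ,
      integral_withDensity_eq_integral_toReal_smul (by fun_prop) (by simp)]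
    have hk := integral_inv_norm_smul_wave (g := fun w => g (x - w))
      (hg.comp (contDiff_const.sub contDiff_id)) (hgc.comp_homeomorph (Homeomorph.subLeft x))
    rw [wave_comp_sub_left, sub_zero] at hk
    rw [← inv_smul_eq_iff₀ hC.ne', ← integral_smul] at hk
    rw [← hk]
    refine integral_congr_ae (ae_of_all _ fun y => ?_)
    simp only [ENNReal.toReal_ofReal (hd0 _), hyper_zero_apply, radius_zero, smul_smul]
    congr 1
    simp only [hd]
    have : Real.exp (-(l * ‖y‖)) * Real.exp (l * ‖y‖) = 1 := by
      rw [← Real.exp_add]; simp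
    linear_combination kirchhoffConst⁻¹ * ‖y‖⁻¹ * this

/-- The reflection w ↦ -w leaves the wave operator invariant and exchanges the two cones. -/
theorem exists_advanced : ∃ Q : Propagator, Q.cone = -futureCone := by
  obtain ⟨Q, hQ⟩ := exists_retarded
  have h1 := Q.finite_pos
  have h2 := Q.finite_neg
  have hm : Measurable (fun w : Minkowski => -w) := measurable_neg
  have hS : MeasurableSet (-futureCone : Set Minkowski) := isClosed_futureCone.measurableSet.neg
  refine ⟨{ weight := fun w => Q.weight (-w)
            continuous_weight := Q.continuous_weight.comp continuous_neg
            pos := Q.pos.map fun w => -w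
            neg := Q.neg.map fun w => -w
            finite_pos := inferInstance
            finite_neg := inferInstance
            cone := -futureCone
            ae_pos := (ae_map_iff (p := (· ∈ -futureCone)) hm.aemeasurable hS).2 (by
              filter_upwards [Q.ae_pos] with w hw; rw [hQ] at hw; simpa using hw)
            ae_neg := (ae_map_iff (p := (· ∈ -futureCone)) hm.aemeasurable hS).2 (by
              filter_upwards [Q.ae_neg] with w hw; rw [hQ] at hw; simpa using hw)
            fundamental := ?_ }, rfl⟩
  intro g hg hgc x
  have hgw := continuous_wave hg
  have hgc' := hg.continuous
  have hwc := Q.continuous_weight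
  rw [integral_map hm.aemeasurable (Continuous.aestronglyMeasurable (by fun_prop)),
    integral_map hm.aemeasurable (Continuous.aestronglyMeasurable (by fun_prop))]
  have := Q.fundamental (fun w => g (0 - w)) (hg.comp (contDiff_const.sub contDiff_id))
    (hgc.comp_homeomorph (Homeomorph.subLeft 0)) (-x)
  rw [wave_comp_sub_left] at this
  simpa [add_comm] using this

end

section

/-! ### The operators defined by propagators -/

namespace Propagator

variable (Q : Propagator)

/-- Convolution with a propagator. -/
def apply (j : Minkowski → Spinor) (x : Minkowski) : Spinor :=
  ∫ w, Q.weight w • j (x - w) ∂Q.pos - ∫ w, Q.weight w • j (x - w) ∂Q.neg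

lemma apply_eq_convolution (j : Minkowski → Spinor) (x : Minkowski) :
    Q.apply j x = convolution Q.weight j (ContinuousLinearMap.lsmul ℝ ℝ) Q.pos x
      - convolution Q.weight j (ContinuousLinearMap.lsmul ℝ ℝ) Q.neg x := by
  simp [apply, convolution]

lemma locallyIntegrable_pos : LocallyIntegrable Q.weight Q.pos :=
  have := Q.finite_pos
  Q.continuous_weight.locallyIntegrable

lemma locallyIntegrable_neg : LocallyIntegrable Q.weight Q.neg :=
  have := Q.finite_neg
  Q.continuous_weight.locallyIntegrable

/-- A convolution inherits the regularity of its smooth factor, here jointly with a parameter,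
provided that all sources live in one compact set. -/
lemma contDiff_apply_param {P : Type*} [NormedAddCommGroup P] [NormedSpace ℝ P] {n : ℕ∞}
    {j : P → Minkowski → Spinor} {K : Set Minkowski} (hK : IsCompact K)
    (h0 : ∀ p, ∀ x ∉ K, j p x = 0) (hj : ContDiff ℝ n fun q : P × Minkowski => j q.1 q.2) :
    ContDiff ℝ n fun q : P × Minkowski => Q.apply (j q.1) q.2 := by
  simp only [apply_eq_convolution]
  have h : ∀ μ : Measure Minkowski, LocallyIntegrable Q.weight μ →
      ContDiff ℝ n fun q : P × Minkowski =>
        convolution Q.weight (j q.1) (ContinuousLinearMap.lsmul ℝ ℝ) μ q.2 := by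
    intro μ hμ
    have := contDiffOn_convolution_right_with_param (μ := μ) (ContinuousLinearMap.lsmul ℝ ℝ)
      (g := j) (s := Set.univ) isOpen_univ hK (fun p x _ hx => h0 p x hx) hμ (n := n)
      (by rw [Set.univ_prod_univ, contDiffOn_univ]; exact hj)
    rwa [Set.univ_prod_univ, contDiffOn_univ] at this
  exact (h _ Q.locallyIntegrable_pos).sub (h _ Q.locallyIntegrable_neg)

lemma pd_apply {j : Minkowski → Spinor} (hj : ContDiff ℝ 1 j) (hc : HasCompactSupport j)
    (a : Fin 4) (x : Minkowski) : pd a (Q.apply j) x = Q.apply (pd a j) x := by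
  have h : ∀ μ : Measure Minkowski, LocallyIntegrable Q.weight μ →
      ∃ A : Minkowski →L[ℝ] Spinor, HasFDerivAt (convolution Q.weight j (ContinuousLinearMap.lsmul ℝ ℝ) μ) A x ∧
        A (Pi.single a 1) = convolution Q.weight (pd a j) (ContinuousLinearMap.lsmul ℝ ℝ) μ x := by
    intro μ hμ
    -- The source is viewed as a family that is constant in a dummy real parameter; the derivative
    -- is then restricted to the second factor.
    have h1 := hasFDerivAt_convolution_right_with_param (μ := μ) (ContinuousLinearMap.lsmul ℝ ℝ)
      (g := fun (_ : ℝ) => j) (s := Set.univ) isOpen_univ hc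
      (fun p x _ hx => image_eq_zero_of_notMem_tsupport hx) hμ
      (by rw [Set.univ_prod_univ, contDiffOn_univ]; exact hj.comp contDiff_snd) (0, x)
      (Set.mem_univ _)
    have h2 : ∀ x' : Minkowski, fderiv ℝ (fun q : ℝ × Minkowski => j q.2) (0, x')
        = (fderiv ℝ j x').comp (ContinuousLinearMap.snd ℝ ℝ Minkowski) := fun x' =>
      ((hj.differentiable one_ne_zero x').hasFDerivAt.comp (f := fun q : ℝ × Minkowski => q.2)
        ((0 : ℝ), x') hasFDerivAt_snd).fderiv
    have h3 : HasFDerivAt (fun x : Minkowski => ((0 : ℝ), x))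
        (ContinuousLinearMap.inr ℝ ℝ Minkowski) x := hasFDerivAt_prodMk_right _ _
    refine ⟨_, h1.comp x h3, ?_⟩
    rw [ContinuousLinearMap.comp_apply, ContinuousLinearMap.inr_apply]
    change (convolution Q.weight (fun x' => fderiv ℝ (fun q : ℝ × Minkowski => j q.2) (0, x'))
      ((ContinuousLinearMap.lsmul ℝ ℝ).precompR (ℝ × Minkowski)) μ x) _ = _
    simp only [h2]
    rw [convolution_precompR_apply _ hμ]
    · rfl
    · exact (hc.fderiv ℝ).comp_left (g := fun A : Minkowski →L[ℝ] Spinor =>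
        A.comp (ContinuousLinearMap.snd ℝ ℝ Minkowski)) (by simp)
    · exact (hj.continuous_fderiv one_ne_zero).clm_comp continuous_const
  obtain ⟨A, hA, hA'⟩ := h _ Q.locallyIntegrable_pos
  obtain ⟨B, hB, hB'⟩ := h _ Q.locallyIntegrable_neg
  have hs : Q.apply j = convolution Q.weight j (ContinuousLinearMap.lsmul ℝ ℝ) Q.pos
      - convolution Q.weight j (ContinuousLinearMap.lsmul ℝ ℝ) Q.neg :=
    funext (Q.apply_eq_convolution j)
  rw [pd, hs, (hA.sub hB).fderiv, apply_eq_convolution, ← hA', ← hB']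
  rfl

lemma apply_add {j k : Minkowski → Spinor} (hj : Continuous j) (hjc : HasCompactSupport j)
    (hk : Continuous k) (hkc : HasCompactSupport k) (x : Minkowski) :
    Q.apply (fun y => j y + k y) x = Q.apply j x + Q.apply k x := by
  have := Q.finite_pos
  have := Q.finite_neg
  have hw := Q.continuous_weight
  simp only [apply, smul_add]
  rw [integral_add (integrable_weight_smul hw hj hjc x) (integrable_weight_smul hw hk hkc x),
    integral_add (integrable_weight_smul hw hj hjc x) (integrable_weight_smul hw hk hkc x)]
  abel

lemma apply_clm (L : Spinor →L[ℝ] Spinor) {j : Minkowski → Spinor} (hj : Continuous j)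
    (hjc : HasCompactSupport j) (x : Minkowski) :
    Q.apply (fun y => L (j y)) x = L (Q.apply j x) := by
  have := Q.finite_pos
  have := Q.finite_neg
  have hw := Q.continuous_weight
  simp only [apply, ← map_smul, map_sub]
  rw [L.integral_comp_comm (integrable_weight_smul hw hj hjc x),
    L.integral_comp_comm (integrable_weight_smul hw hj hjc x)]

lemma apply_sum {ι : Type*} (s : Finset ι) {j : ι → Minkowski → Spinor}
    (hj : ∀ i, Continuous (j i)) (hjc : ∀ i, HasCompactSupport (j i)) (x : Minkowski) :
    Q.apply (fun y => ∑ i ∈ s, j i y) x = ∑ i ∈ s, Q.apply (j i) x := by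
  have := Q.finite_pos
  have := Q.finite_neg
  have hw := Q.continuous_weight
  simp only [apply, Finset.smul_sum]
  rw [integral_finsetSum _ fun i _ => integrable_weight_smul hw (hj i) (hjc i) x,
    integral_finsetSum _ fun i _ => integrable_weight_smul hw (hj i) (hjc i) x,
    Finset.sum_sub_distrib]

lemma apply_eq_zero {j : Minkowski → Spinor} {x : Minkowski}
    (h : ∀ y, x - y ∈ Q.cone → j y = 0) : Q.apply j x = 0 := by
  have h1 : ∫ w, Q.weight w • j (x - w) ∂Q.pos = 0 := integral_eq_zero_of_ae (by
    filter_upwards [Q.ae_pos] with w hw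
    simp [h (x - w) (by simpa using hw)])
  have h2 : ∫ w, Q.weight w • j (x - w) ∂Q.neg = 0 := integral_eq_zero_of_ae (by
    filter_upwards [Q.ae_neg] with w hw
    simp [h (x - w) (by simpa using hw)])
  rw [apply, h1, h2, sub_zero]

end Propagator

/-! ### The Dirac operator -/

/-- The action of a matrix on spinors, as a real continuous linear map. -/
def actL (A : Matrix (Fin 4) (Fin 4) ℂ) : Spinor →L[ℝ] Spinor :=
  (LinearMap.toContinuousLinearMap (Matrix.toEuclideanLin A)).restrictScalars ℝ

lemma actL_apply (A : Matrix (Fin 4) (Fin 4) ℂ) (v : Spinor) : actL A v = act A v := rfl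

lemma act_act (A B : Matrix (Fin 4) (Fin 4) ℂ) (v : Spinor) : act A (act B v) = act (A * B) v := by
  simp [act, Matrix.toLpLin_apply]

lemma act_one (v : Spinor) : act 1 v = v := by simp [act]

lemma smul_act (c : ℂ) (A : Matrix (Fin 4) (Fin 4) ℂ) (v : Spinor) :
    c • act A v = act (c • A) v := by
  simp only [act, map_smul, LinearMap.smul_apply]

lemma act_add_matrix (A B : Matrix (Fin 4) (Fin 4) ℂ) (v : Spinor) :
    act (A + B) v = act A v + act B v := by
  simp only [act, map_add, LinearMap.add_apply]

lemma act_sum_matrix {ι : Type*} (s : Finset ι) (A : ι → Matrix (Fin 4) (Fin 4) ℂ) (v : Spinor) :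
    act (∑ i ∈ s, A i) v = ∑ i ∈ s, act (A i) v := by
  simp only [act, map_sum, LinearMap.sum_apply]

lemma act_zero_matrix (v : Spinor) : act 0 v = 0 := by simp [act]

lemma pd_clm {n : ℕ} {E F : Type*} [NormedAddCommGroup E] [NormedSpace ℝ E]
    [NormedAddCommGroup F] [NormedSpace ℝ F] (L : E →L[ℝ] F) {f : (Fin n → ℝ) → E}
    {x : Fin n → ℝ} (hf : DifferentiableAt ℝ f x) (a : Fin n) :
    pd a (fun y => L (f y)) x = L (pd a f x) := by
  have := (L.hasFDerivAt.comp x hf.hasFDerivAt).fderiv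
  change fderiv ℝ (L ∘ f) x _ = _
  rw [this]
  rfl

lemma pd_add {n : ℕ} {E : Type*} [NormedAddCommGroup E] [NormedSpace ℝ E]
    {f g : (Fin n → ℝ) → E} {x : Fin n → ℝ} (hf : DifferentiableAt ℝ f x)
    (hg : DifferentiableAt ℝ g x) (a : Fin n) :
    pd a (fun y => f y + g y) x = pd a f x + pd a g x := by
  rw [pd, fderiv_fun_add hf hg]; rfl

lemma pd_sub {n : ℕ} {E : Type*} [NormedAddCommGroup E] [NormedSpace ℝ E]
    {f g : (Fin n → ℝ) → E} {x : Fin n → ℝ} (hf : DifferentiableAt ℝ f x)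
    (hg : DifferentiableAt ℝ g x) (a : Fin n) :
    pd a (fun y => f y - g y) x = pd a f x - pd a g x := by
  rw [pd, fderiv_fun_sub hf hg]; rfl

lemma pd_sum {n : ℕ} {E ι : Type*} [NormedAddCommGroup E] [NormedSpace ℝ E] (s : Finset ι)
    {f : ι → (Fin n → ℝ) → E} {x : Fin n → ℝ} (hf : ∀ i, DifferentiableAt ℝ (f i) x)
    (a : Fin n) : pd a (fun y => ∑ i ∈ s, f i y) x = ∑ i ∈ s, pd a (f i) x := by
  rw [pd, fderiv_fun_sum fun i _ => hf i]; simp [pd]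

lemma pd_smul {n : ℕ} {E : Type*} [NormedAddCommGroup E] [NormedSpace ℝ E]
    {c : (Fin n → ℝ) → ℝ} {f : (Fin n → ℝ) → E} {x : Fin n → ℝ} (hc : DifferentiableAt ℝ c x)
    (hf : DifferentiableAt ℝ f x) (a : Fin n) :
    pd a (fun y => c y • f y) x = c x • pd a f x + pd a c x • f x := by
  rw [pd, fderiv_fun_smul hc hf]; simp [pd]

/-- The operator `i γᵃ ∂ₐ`. -/
def slash (D : DiracMatrices) (ψ : Minkowski → Spinor) (x : Minkowski) : Spinor :=
  ∑ a, Complex.I • act (D.γ a) (pd a ψ x)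

/-- The matrix `γᵃ ∂ₐT`. -/
def gradSlash (D : DiracMatrices) (T : Minkowski → ℝ) (x : Minkowski) :
    Matrix (Fin 4) (Fin 4) ℂ := ∑ a, ((pd a T x : ℝ) : ℂ) • D.γ a

/-! ### Calculus of the Dirac operator and the inhomogeneous equation. -/

section Slash

variable {D : DiracMatrices}

lemma slash_eq (ψ : Minkowski → Spinor) (x : Minkowski) :
    slash D ψ x = ∑ a, actL (Complex.I • D.γ a) (pd a ψ x) := by
  simp only [slash, smul_act, actL_apply]

lemma contDiff_slash {k m : WithTop ℕ∞} {ψ : Minkowski → Spinor} (h : ContDiff ℝ k ψ)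
    (hm : m + 1 ≤ k) : ContDiff ℝ m (slash D ψ) := by
  have : slash D ψ = fun x => ∑ a, actL (Complex.I • D.γ a) (pd a ψ x) := funext (slash_eq ψ)
  rw [this]
  exact ContDiff.sum fun a _ => (actL _).contDiff.comp (contDiff_pd h hm a)

lemma hasCompactSupport_slash {ψ : Minkowski → Spinor} (h : HasCompactSupport ψ) :
    HasCompactSupport (slash D ψ) := by
  refine HasCompactSupport.intro h fun x hx => ?_
  have h : ∀ a, pd a ψ x = 0 := fun a =>
    image_eq_zero_of_notMem_tsupport fun h => hx (tsupport_fderiv_apply_subset ℝ _ h)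
  simp [slash, h]

lemma slash_add {f g : Minkowski → Spinor} {x : Minkowski} (hf : DifferentiableAt ℝ f x)
    (hg : DifferentiableAt ℝ g x) :
    slash D (fun y => f y + g y) x = slash D f x + slash D g x := by
  simp only [slash_eq, pd_add hf hg, map_add, Finset.sum_add_distrib]

lemma slash_sub {f g : Minkowski → Spinor} {x : Minkowski} (hf : DifferentiableAt ℝ f x)
    (hg : DifferentiableAt ℝ g x) :
    slash D (fun y => f y - g y) x = slash D f x - slash D g x := by
  simp only [slash_eq, pd_sub hf hg, map_sub, Finset.sum_sub_distrib]

lemma slash_neg (f : Minkowski → Spinor) (x : Minkowski) :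
    slash D (fun y => -f y) x = -slash D f x := by
  simp only [slash_eq, pd_neg, map_neg, Finset.sum_neg_distrib]

lemma slash_smul {c : Minkowski → ℝ} {f : Minkowski → Spinor} {x : Minkowski}
    (hc : DifferentiableAt ℝ c x) (hf : DifferentiableAt ℝ f x) :
    slash D (fun y => c y • f y) x
      = c x • slash D f x + Complex.I • act (gradSlash D c x) (f x) := by
  simp only [slash_eq, pd_smul hc hf, map_add, Finset.sum_add_distrib, map_smul, Finset.smul_sum,
    gradSlash, act_sum_matrix]
  congr 1
  refine Finset.sum_congr rfl fun a _ => ?_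
  rw [actL_apply, ← smul_act, ← smul_act, smul_comm, Complex.coe_smul]

/-- The coefficients ∂ₐT ∂_bT are symmetric, so only the anticommutators of the Dirac matrices
contribute. Hence γ(dT) is invertible wherever the gradient is not null. -/
lemma gradSlash_mul_self (T : Minkowski → ℝ) (x : Minkowski) :
    gradSlash D T x * gradSlash D T x = ((∑ a, eta a * pd a T x ^ 2 : ℝ) : ℂ) • 1 := by
  have e1 : gradSlash D T x * gradSlash D T x
      = ∑ a, ∑ b, ((pd a T x * pd b T x : ℝ) : ℂ) • (D.γ a * D.γ b) := by
    rw [gradSlash, Finset.sum_mul_sum]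
    refine Finset.sum_congr rfl fun i _ => Finset.sum_congr rfl fun j _ => ?_
    rw [Matrix.smul_mul, Matrix.mul_smul, smul_smul, Complex.ofReal_mul]
  have e2 : gradSlash D T x * gradSlash D T x
      = ∑ a, ∑ b, ((pd a T x * pd b T x : ℝ) : ℂ) • (D.γ b * D.γ a) := by
    rw [e1, Finset.sum_comm]
    refine Finset.sum_congr rfl fun i _ => Finset.sum_congr rfl fun j _ => ?_
    rw [mul_comm (pd j T x)]
  have e3 : gradSlash D T x * gradSlash D T x + gradSlash D T x * gradSlash D T x
      = (2 : ℂ) • ((∑ a, eta a * pd a T x ^ 2 : ℝ) : ℂ) • 1 := by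
    nth_rewrite 1 [e1]
    rw [e2, ← Finset.sum_add_distrib, smul_smul, Complex.ofReal_sum, Finset.mul_sum,
      Finset.sum_smul]
    refine Finset.sum_congr rfl fun i _ => ?_
    rw [← Finset.sum_add_distrib, Finset.sum_eq_single i]
    · rw [← smul_add, D.clifford, if_pos rfl, smul_smul]
      congr 1
      push_cast; ring
    · intro j _ hj
      rw [← smul_add, D.clifford, if_neg (Ne.symm hj), smul_zero]
    · simp
  rw [← two_smul ℂ] at e3
  exact smul_right_injective _ two_ne_zero e3

lemma pd_slash {ψ : Minkowski → Spinor} (h : ContDiff ℝ 2 ψ) (b : Fin 4) (x : Minkowski) :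
    pd b (slash D ψ) x = slash D (pd b ψ) x := by
  have hp : ∀ a, Differentiable ℝ (pd a ψ) := fun a =>
    (contDiff_pd (m := 1) h (by norm_num [one_add_one_eq_two]) a).differentiable one_ne_zero
  have : slash D ψ = fun x => ∑ a, actL (Complex.I • D.γ a) (pd a ψ x) := funext (slash_eq ψ)
  rw [this, pd_sum (f := fun a y => actL (Complex.I • D.γ a) (pd a ψ y)) _
    (fun a => (actL _).differentiableAt.comp x (hp a x)), slash_eq]
  refine Finset.sum_congr rfl fun a _ => ?_
  rw [pd_clm _ (hp a x), pd_comm h le_rfl]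

/-- Second derivatives commute, so the double sum again sees only anticommutators: iγ∂ is a square
root of -□. -/
lemma slash_slash {ψ : Minkowski → Spinor} (h : ContDiff ℝ 2 ψ) (x : Minkowski) :
    slash D (slash D ψ) x = -wave ψ x := by
  have e1 : slash D (slash D ψ) x
      = -∑ a, ∑ b, act (D.γ a * D.γ b) (pd a (pd b ψ) x) := by
    rw [slash_eq, ← Finset.sum_neg_distrib]
    refine Finset.sum_congr rfl fun a _ => ?_
    rw [pd_slash h, slash_eq, map_sum, ← Finset.sum_neg_distrib]
    refine Finset.sum_congr rfl fun b _ => ?_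
    rw [actL_apply, actL_apply, act_act, Matrix.smul_mul, Matrix.mul_smul, smul_smul,
      Complex.I_mul_I, ← smul_act, pd_comm h le_rfl]
    simp
  have e2 : slash D (slash D ψ) x
      = -∑ a, ∑ b, act (D.γ b * D.γ a) (pd a (pd b ψ) x) := by
    rw [e1, Finset.sum_comm]
    congr 1
    refine Finset.sum_congr rfl fun a _ => Finset.sum_congr rfl fun b _ => ?_
    rw [pd_comm h le_rfl]
  have e3 : slash D (slash D ψ) x + slash D (slash D ψ) x = -((2 : ℝ) • wave ψ x) := by
    nth_rewrite 1 [e1]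
    rw [e2, ← neg_add, ← Finset.sum_add_distrib]
    congr 1
    have : ∀ a, (∑ b, act (D.γ a * D.γ b) (pd a (pd b ψ) x)
        + ∑ b, act (D.γ b * D.γ a) (pd a (pd b ψ) x)) = (2 * eta a) • pd a (pd a ψ) x := by
      intro a
      rw [← Finset.sum_add_distrib, Finset.sum_eq_single a]
      · rw [← act_add_matrix, D.clifford, if_pos rfl, ← smul_act, act_one, Complex.coe_smul]
      · intro b _ hb
        rw [← act_add_matrix, D.clifford, if_neg (Ne.symm hb), act_zero_matrix]
      · simp
    rw [Finset.sum_congr rfl fun a _ => this a, Fin.sum_univ_succ, wave]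
    simp [eta, Fin.succ_ne_zero, Finset.smul_sum, sub_eq_add_neg]
  rw [← two_smul ℝ, ← smul_neg] at e3
  exact smul_right_injective _ two_ne_zero e3

/-- The solution operator `-(i γᵃ ∂ₐ + 1) Q` of the inhomogeneous Dirac equation. -/
def Propagator.solve (D : DiracMatrices) (Q : Propagator) (j : Minkowski → Spinor)
    (x : Minkowski) : Spinor := -Q.apply (fun y => slash D j y + j y) x

/-- From (iγ∂ - 1)(iγ∂ + 1) = -(□ + 1), with derivatives moved from the convolution to the source,
the claim reduces to the fundamental identity for □ + 1. -/
lemma Propagator.slash_solve (Q : Propagator) {j : Minkowski → Spinor} (hj : ContDiff ℝ 2 j)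
    (hc : HasCompactSupport j) (x : Minkowski) :
    slash D (Q.solve D j) x - Q.solve D j x = j x := by
  have h1 : ContDiff ℝ 1 (slash D j) := contDiff_slash hj (by norm_num [one_add_one_eq_two])
  have h1c := hasCompactSupport_slash (D := D) hc
  set k : Minkowski → Spinor := fun y => slash D j y + j y with hk
  have hk1 : ContDiff ℝ 1 k := h1.add (hj.of_le (by norm_num))
  have hkc : HasCompactSupport k := h1c.add hc
  have hpc : ∀ a, Continuous (pd a k) := fun a => continuous_pd hk1 le_rfl a
  have e1 : slash D (Q.solve D j) x = -Q.apply (slash D k) x := by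
    change slash D (fun y => -Q.apply k y) x = _
    rw [slash_neg, slash_eq]
    congr 1
    have : slash D k = fun y => ∑ a, actL (Complex.I • D.γ a) (pd a k y) := funext (slash_eq k)
    rw [this, Q.apply_sum (j := fun a y => actL (Complex.I • D.γ a) (pd a k y)) _
      (fun a => (actL _).continuous.comp (hpc a))
      (fun a => (hasCompactSupport_pd hkc a).comp_left (map_zero (actL _)))]
    refine Finset.sum_congr rfl fun a _ => ?_
    rw [Q.pd_apply hk1 hkc, Q.apply_clm _ (hpc a) (hasCompactSupport_pd hkc a)]
  have e2 : slash D k = fun y => -wave j y + slash D j y := by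
    funext y
    rw [hk, slash_add (h1.differentiable one_ne_zero y) (hj.differentiable two_ne_zero y),
      slash_slash hj]
  have e3 : ∀ y, k y = (wave j y + j y) + slash D k y := by
    intro y
    rw [e2]
    simp only [hk]
    abel
  have hw : Continuous fun y => wave j y + j y := (continuous_wave hj).add hj.continuous
  have hwc : HasCompactSupport fun y => wave j y + j y := (hasCompactSupport_wave hc).add hc
  have e4 : Q.apply k x = Q.apply (fun y => wave j y + j y) x + Q.apply (slash D k) x := by
    rw [← Q.apply_add hw hwc (contDiff_slash (m := 0) hk1 (by norm_num)).continuous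
      (hasCompactSupport_slash hkc)]
    congr 1
    exact funext e3
  rw [e1, Propagator.solve, e4]
  have := Q.fundamental j hj hc x
  change Q.apply (fun y => wave j y + j y) x = j x at this
  rw [this]
  abel

end Slash

end

section

/-! ### Domain of dependence -/

lemma natCast_le_infty (n : ℕ) : (n : WithTop ℕ∞) ≤ ∞ := WithTop.coe_le_coe.2 le_top

lemma exists_cutoff {n : ℕ} {K O : Set (Fin n → ℝ)} (hK : IsCompact K) (hO : IsOpen O)
    (hKO : K ⊆ O) : ∃ χ : (Fin n → ℝ) → ℝ, ContDiff ℝ ∞ χ ∧ HasCompactSupport χ ∧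
      tsupport χ ⊆ O ∧ ∀ x ∈ K, ∀ᶠ y in nhds x, χ y = 1 := by
  obtain ⟨L, hL, hKL, hLO⟩ := exists_compact_between hK hO hKO
  obtain ⟨N, hN, hKN, hNL⟩ := exists_compact_between hK isOpen_interior hKL
  obtain ⟨χ, h1, -, h3, h4⟩ := exists_contMDiff_support_eq_eq_one_iff
    (modelWithCornersSelf ℝ (Fin n → ℝ)) (n := ⊤) isOpen_interior hN.isClosed hNL
  have hts : tsupport χ ⊆ L := by
    rw [tsupport, h3]
    exact closure_minimal interior_subset hL.isClosed
  refine ⟨χ, h1.contDiff, hL.of_isClosed_subset (isClosed_tsupport χ) hts, hts.trans hLO,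
    fun x hx => ?_⟩
  filter_upwards [isOpen_interior.mem_nhds (hKN hx)] with y hy
  exact (h4 y).1 (interior_subset hy)

/-! ### Extension by zero across a hypersurface. -/

section Gluing

set_option linter.unusedSectionVars false

variable {E : Type*} [NormedAddCommGroup E] [NormedSpace ℝ E]

open Classical in
/-- The function which is `ψ` where `T > 0` and zero elsewhere. -/
def cut (T : Minkowski → ℝ) (ψ : Minkowski → E) (x : Minkowski) : E :=
  if 0 < T x then ψ x else 0

lemma norm_cut_le (T : Minkowski → ℝ) (ψ : Minkowski → E) (x : Minkowski) :
    ‖cut T ψ x‖ ≤ ‖ψ x‖ := by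
  unfold cut; split_ifs <;> simp

lemma continuousAt_cut {T : Minkowski → ℝ} (hT : Continuous T) {ψ : Minkowski → E}
    (hψ : Continuous ψ) {x : Minkowski} (h0 : T x = 0 → ψ x = 0) : ContinuousAt (cut T ψ) x := by
  rcases lt_trichotomy (T x) 0 with h | h | h
  · have : cut T ψ =ᶠ[nhds x] fun _ => 0 := by
      filter_upwards [hT.continuousAt.eventually_lt continuousAt_const h] with y hy
      rw [cut, if_neg hy.not_gt]
    exact continuousAt_const.congr this.symm
  · have hx : cut T ψ x = 0 := by rw [cut, if_neg h.not_gt]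
    rw [ContinuousAt, hx]
    refine squeeze_zero_norm (norm_cut_le T ψ) ?_
    have := hψ.norm.tendsto x
    rwa [h0 h, norm_zero] at this
  · have : cut T ψ =ᶠ[nhds x] ψ := by
      filter_upwards [continuousAt_const.eventually_lt hT.continuousAt h] with y hy
      rw [cut, if_pos hy]
    exact hψ.continuousAt.congr this.symm

/-- On the hypersurface ψ vanishes to first order, and the truncated function is bounded by ψ in
norm, so it is differentiable there with zero derivative. -/
lemma hasFDerivAt_cut {T : Minkowski → ℝ} (hT : Continuous T) {ψ : Minkowski → E}
    (hψ : Differentiable ℝ ψ) {x : Minkowski} (h0 : T x = 0 → ψ x = 0)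
    (h1 : T x = 0 → fderiv ℝ ψ x = 0) : HasFDerivAt (cut T ψ) (cut T (fderiv ℝ ψ) x) x := by
  rcases lt_trichotomy (T x) 0 with h | h | h
  · have : cut T ψ =ᶠ[nhds x] fun _ => 0 := by
      filter_upwards [hT.continuousAt.eventually_lt continuousAt_const h] with y hy
      rw [cut, if_neg hy.not_gt]
    rw [cut, if_neg h.not_gt]
    exact (hasFDerivAt_const 0 x).congr_of_eventuallyEq this
  · have hx : cut T ψ x = 0 := by rw [cut, if_neg h.not_gt]
    have h2 := (hψ x).hasFDerivAt
    rw [h1 h, hasFDerivAt_iff_isLittleO] at h2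
    rw [cut, if_neg h.not_gt, hasFDerivAt_iff_isLittleO]
    refine Asymptotics.IsBigO.trans_isLittleO (Asymptotics.isBigO_of_le _ fun y => ?_) h2
    simpa [hx, h0 h] using norm_cut_le T ψ y
  · have : cut T ψ =ᶠ[nhds x] ψ := by
      filter_upwards [continuousAt_const.eventually_lt hT.continuousAt h] with y hy
      rw [cut, if_pos hy]
    rw [cut, if_pos h]
    exact (hψ x).hasFDerivAt.congr_of_eventuallyEq this

/-- Truncation commutes with differentiation as long as the derivatives vanish on the hypersurface;
this is applied twice, and the truncated second derivative is continuous. -/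
lemma contDiffOn_cut {T : Minkowski → ℝ} (hT : Continuous T) {ψ : Minkowski → E}
    (hψ : ContDiff ℝ 2 ψ) {O : Set Minkowski} (hO : IsOpen O)
    (h0 : ∀ x ∈ O, T x = 0 → ψ x = 0) (h1 : ∀ x ∈ O, T x = 0 → fderiv ℝ ψ x = 0)
    (h2 : ∀ x ∈ O, T x = 0 → fderiv ℝ (fderiv ℝ ψ) x = 0) : ContDiffOn ℝ 2 (cut T ψ) O := by
  have hψ1 : ContDiff ℝ 1 (fderiv ℝ ψ) := hψ.fderiv_right (by norm_num [one_add_one_eq_two])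
  have key : ∀ {F : Type _} [NormedAddCommGroup F] [NormedSpace ℝ F] {f : Minkowski → F}
      {f' : Minkowski → Minkowski →L[ℝ] F} {k : ℕ}, (∀ x ∈ O, HasFDerivAt f (f' x) x) →
      ContDiffOn ℝ k f' O → ContDiffOn ℝ (k + 1) f O := by
    intro F _ _ f f' k hf hf'
    rw [contDiffOn_succ_iff_fderiv_of_isOpen hO]
    refine ⟨fun x hx => (hf x hx).differentiableAt.differentiableWithinAt, by simp, ?_⟩
    exact hf'.congr fun x hx => (hf x hx).fderiv
  have k0 : ContDiffOn ℝ 0 (cut T (fderiv ℝ (fderiv ℝ ψ))) O := by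
    rw [contDiffOn_zero]
    exact fun x hx => (continuousAt_cut hT (hψ1.continuous_fderiv one_ne_zero)
      (h2 x hx)).continuousWithinAt
  have k1 := key (k := 0) (fun x hx => hasFDerivAt_cut hT (hψ1.differentiable one_ne_zero)
    (h1 x hx) (h2 x hx)) k0
  have k2 := key (k := 1) (fun x hx => hasFDerivAt_cut hT (hψ.differentiable two_ne_zero)
    (h0 x hx) (h1 x hx)) (by simpa using k1)
  simpa [one_add_one_eq_two] using k2

end Gluing

lemma pd_congr {n : ℕ} {E : Type*} [NormedAddCommGroup E] [NormedSpace ℝ E]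
    {f g : (Fin n → ℝ) → E} {x : Fin n → ℝ} (h : f =ᶠ[nhds x] g) (a : Fin n) :
    pd a f =ᶠ[nhds x] pd a g := by
  filter_upwards [h.fderiv (𝕜 := ℝ)] with y hy
  rw [pd, hy, pd]

lemma wave_congr {E : Type*} [NormedAddCommGroup E] [NormedSpace ℝ E]
    {f g : Minkowski → E} {x : Minkowski} (h : f =ᶠ[nhds x] g) : wave f x = wave g x := by
  have key : ∀ a, pd a (pd a f) x = pd a (pd a g) x := fun a =>
    (pd_congr (pd_congr h a) a).self_of_nhds
  simp only [wave, key]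

/-! ### Vanishing of solutions with vanishing data. -/

section Dependence

variable {D : DiracMatrices}

/-- If a function vanishes on a hypersurface, then its differential is a multiple of the conormal
there. -/
lemma fderiv_apply_eq_of_eqOn_level {T : Minkowski → ℝ} (hT : ContDiff ℝ 1 T)
    {ψ : Minkowski → Spinor} (hψ : ContDiff ℝ 1 ψ) {x : Minkowski} (hTx : T x = 0)
    (h0 : ∀ᶠ y in nhds x, T y = 0 → ψ y = 0) {u : Minkowski} (hu : fderiv ℝ T x u = 1)
    (v : Minkowski) : fderiv ℝ ψ x v = fderiv ℝ T x v • fderiv ℝ ψ x u := by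
  refine (SeparatingDual.eq_iff_forall_dual_eq (R := ℝ)).2 fun ℓ => ?_
  -- The function ℓ ∘ ψ is constant on the level set near x, so x is trivially a constrained
  -- extremum and Lagrange multipliers make the two differentials dependent.
  have hex : IsLocalExtrOn (fun y => ℓ (ψ y)) {y | T y = T x} x := by
    left
    rw [IsMinFilter]
    filter_upwards [nhdsWithin_le_nhds h0, self_mem_nhdsWithin] with y hy hy'
    rw [h0.self_of_nhds hTx, hy (hy'.trans hTx)]
  have hs1 : HasStrictFDerivAt T (fderiv ℝ T x) x :=
    hT.contDiffAt.hasStrictFDerivAt one_ne_zero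
  have hs2 : HasStrictFDerivAt (fun y => ℓ (ψ y)) (ℓ.comp (fderiv ℝ ψ x)) x :=
    ℓ.hasStrictFDerivAt.comp x (hψ.contDiffAt.hasStrictFDerivAt one_ne_zero)
  obtain ⟨a, b, hab, h⟩ := hex.exists_multipliers_of_hasStrictFDerivAt_1d hs1 hs2
  have hv : ∀ v, a * fderiv ℝ T x v + b * ℓ (fderiv ℝ ψ x v) = 0 := fun v => by
    simpa using congrArg (fun A : StrongDual ℝ Minkowski => A v) h
  have hb : b ≠ 0 := by
    rintro rfl
    have := hv u
    rw [hu] at this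
    exact hab (by simp_all)
  have h1 := hv u
  rw [hu] at h1
  have h2 := hv v
  rw [map_smul, smul_eq_mul]
  refine mul_left_cancel₀ hb ?_
  linear_combination h2 - fderiv ℝ T x v * h1

/-- The differential of ψ has the form dT ⊗ w, and the equation reduces to γ(dT)w = 0 at x. The
gradient is not null, so γ(dT) is invertible and w = 0. -/
lemma fderiv_eq_zero_of_slash {T : Minkowski → ℝ} (hT : ContDiff ℝ 1 T)
    (hT' : ∀ x, ∑ a, eta a * pd a T x ^ 2 ≠ 0) {ψ : Minkowski → Spinor} (hψ : ContDiff ℝ 1 ψ)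
    {x : Minkowski} (hTx : T x = 0) (h0 : ∀ᶠ y in nhds x, T y = 0 → ψ y = 0)
    (hD : slash D ψ x - ψ x = 0) : fderiv ℝ ψ x = 0 := by
  have hne : fderiv ℝ T x ≠ 0 := by
    intro h
    exact hT' x (by simp [pd, h])
  obtain ⟨u, hu⟩ : ∃ u, fderiv ℝ T x u = 1 := by
    obtain ⟨w, hw⟩ := DFunLike.ne_iff.1 hne
    exact ⟨(fderiv ℝ T x w)⁻¹ • w, by simpa using inv_mul_cancel₀ hw⟩
  have key := fderiv_apply_eq_of_eqOn_level hT hψ hTx h0 hu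
  set w := fderiv ℝ ψ x u
  have hw : w = 0 := by
    rw [h0.self_of_nhds hTx, sub_zero] at hD
    have h1 : slash D ψ x = Complex.I • act (gradSlash D T x) w := by
      rw [slash, gradSlash, act_sum_matrix, Finset.smul_sum]
      refine Finset.sum_congr rfl fun a _ => ?_
      rw [pd, key, ← smul_act, ← actL_apply, map_smul, pd, Complex.coe_smul, actL_apply]
    rw [h1, smul_eq_zero_iff_right Complex.I_ne_zero] at hD
    have h2 := congrArg (act (gradSlash D T x)) hD
    rw [act_act, gradSlash_mul_self, ← smul_act, act_one, ← actL_apply, map_zero] at h2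
    exact (smul_eq_zero_iff_right (by exact_mod_cast hT' x)).1 h2
  ext1 v
  rw [key, hw]
  simp

/-- A solution of the Dirac equation vanishes at `x` if its restriction to the hypersurface `T = 0`
vanishes on the part of it seen from `x`. -/
theorem eq_zero_of_vanishing_data (Q : Propagator) {T : Minkowski → ℝ} (hT : ContDiff ℝ ∞ T)
    (hT' : ∀ x, ∑ a, eta a * pd a T x ^ 2 ≠ 0) {ψ : Minkowski → Spinor} (hψ : ContDiff ℝ 2 ψ)
    (hD : ∀ x, slash D ψ x - ψ x = 0) {B : Set Minkowski} (hB : IsClosed B)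
    (h0 : ∀ y ∉ B, T y = 0 → ψ y = 0) {x : Minkowski} (hTx : 0 < T x)
    (hx0 : (0 : Minkowski) ∈ Q.cone)
    (hK : IsCompact {y | x - y ∈ Q.cone ∧ 0 ≤ T y})
    (hKB : ∀ y, x - y ∈ Q.cone → 0 ≤ T y → y ∉ B) : ψ x = 0 := by
  set K := {y | x - y ∈ Q.cone ∧ 0 ≤ T y} with hKdef
  have hKO : K ⊆ Bᶜ := fun y hy => hKB y hy.1 hy.2
  have hO : IsOpen Bᶜ := hB.isOpen_compl
  have hT1 : ContDiff ℝ 1 T := hT.of_le (by simp)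
  have ev : ∀ y ∉ B, ∀ᶠ z in nhds y, z ∉ B := fun y hy => hO.mem_nhds hy
  have f1 : ∀ y ∈ Bᶜ, T y = 0 → fderiv ℝ ψ y = 0 := fun y hy hTy =>
    fderiv_eq_zero_of_slash hT1 hT' (hψ.of_le (by norm_num)) hTy
      ((ev y hy).mono fun z hz => h0 z hz) (hD y)
  -- The partial derivatives of ψ solve the same equation and, by the previous step, vanish on the
  -- hypersurface, so the first-order argument applies to them.
  have f2 : ∀ y ∈ Bᶜ, T y = 0 → fderiv ℝ (fderiv ℝ ψ) y = 0 := by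
    intro y hy hTy
    have hψ1 : ContDiff ℝ 1 (fderiv ℝ ψ) := hψ.fderiv_right (by norm_num [one_add_one_eq_two])
    have h : ∀ a, fderiv ℝ (pd a ψ) y = 0 := by
      intro a
      refine fderiv_eq_zero_of_slash (D := D) hT1 hT'
        (contDiff_pd hψ (by norm_num [one_add_one_eq_two]) a) hTy
        ((ev y hy).mono fun z hz hTz => by simp [pd, f1 z hz hTz]) ?_
      rw [← pd_slash hψ]
      have : slash D ψ = ψ := funext fun z => sub_eq_zero.1 (hD z)
      rw [this, sub_self]
    have hap : ∀ a, fderiv ℝ (pd a ψ) y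
        = (fderiv ℝ (fderiv ℝ ψ) y).flip (Pi.single a 1) := by
      intro a
      have h1 := ((hψ1.differentiable one_ne_zero y).hasFDerivAt.clm_apply
        (hasFDerivAt_const (Pi.single a 1 : Minkowski) y)).fderiv
      change fderiv ℝ (fun z => fderiv ℝ ψ z (Pi.single a 1)) y = _
      rw [h1]
      ext1 v
      simp
    ext1 v
    refine ContinuousLinearMap.coe_injective (LinearMap.pi_ext' fun a => LinearMap.ext_ring ?_)
    have := congrArg (fun A : Minkowski →L[ℝ] Spinor => A v) ((hap a).symm.trans (h a))
    simpa using this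
  have hcut : ContDiffOn ℝ 2 (cut T ψ) Bᶜ := contDiffOn_cut hT.continuous hψ hO h0 f1 f2
  obtain ⟨χ, hχ, hχc, hχO, hχ1⟩ := exists_cutoff hK hO hKO
  -- The cutoff is 1 near K, so g agrees with ψ at x and satisfies the homogeneous Klein-Gordon
  -- equation on all of x - cone; the fundamental identity then yields g x = 0.
  set g : Minkowski → Spinor := fun y => χ y • cut T ψ y with hg
  have hgs : ContDiff ℝ 2 g := by
    rw [contDiff_iff_contDiffAt]
    intro y
    by_cases hy : y ∈ tsupport χ
    · exact (hχ.of_le (natCast_le_infty 2)).contDiffAt.smul (hcut.contDiffAt (hO.mem_nhds (hχO hy)))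
    · have : g =ᶠ[nhds y] fun _ => 0 := by
        filter_upwards [(isClosed_tsupport χ).isOpen_compl.mem_nhds hy] with z hz
        simp [hg, image_eq_zero_of_notMem_tsupport hz]
      exact contDiffAt_const.congr_of_eventuallyEq this
  have hgc : HasCompactSupport g := hχc.smul_right
  have hwave : ∀ y, wave ψ y + ψ y = 0 := by
    intro y
    have h1 : slash D ψ = ψ := funext fun z => sub_eq_zero.1 (hD z)
    have h2 := slash_slash (D := D) hψ y
    rw [h1, h1] at h2
    rw [add_comm]
    exact eq_neg_iff_add_eq_zero.1 h2
  have hz : ∀ y, x - y ∈ Q.cone → wave g y + g y = 0 := by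
    intro y hy
    by_cases hTy : 0 ≤ T y
    · have hyK : y ∈ K := ⟨hy, hTy⟩
      have e1 : g =ᶠ[nhds y] cut T ψ := by
        filter_upwards [hχ1 y hyK] with z hz
        simp [hg, hz]
      have hyO : ∀ᶠ z in nhds y, z ∈ Bᶜ := hO.mem_nhds (hKO hyK)
      have e2 : ∀ a b, pd a (pd b (cut T ψ)) y = cut T (pd a (pd b ψ)) y := by
        intro a b
        have h1 : pd b (cut T ψ) =ᶠ[nhds y] cut T (pd b ψ) := by
          filter_upwards [hyO] with z hz
          rw [pd, (hasFDerivAt_cut hT.continuous (hψ.differentiable two_ne_zero) (h0 z hz)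
            (f1 z hz)).fderiv]
          unfold cut
          split_ifs <;> simp [pd]
        have hb : ContDiff ℝ 1 (pd b ψ) := contDiff_pd hψ (by norm_num [one_add_one_eq_two]) b
        have hb1 : T y = 0 → fderiv ℝ (pd b ψ) y = 0 := by
          intro hTy
          refine fderiv_eq_zero_of_slash (D := D) hT1 hT' hb hTy
            (hyO.mono fun z hz hTz => by simp [pd, f1 z hz hTz]) ?_
          rw [← pd_slash hψ]
          have : slash D ψ = ψ := funext fun z => sub_eq_zero.1 (hD z)
          rw [this, sub_self]
        rw [pd, h1.fderiv_eq, (hasFDerivAt_cut hT.continuous (hb.differentiable one_ne_zero)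
          (fun hTy => by simp [pd, f1 y (hKO hyK) hTy]) hb1).fderiv]
        unfold cut
        split_ifs <;> simp [pd]
      have e3 : wave g y = wave (cut T ψ) y := wave_congr e1
      rw [e3, e1.self_of_nhds]
      have e4 : wave (cut T ψ) y = cut T (wave ψ) y := by
        simp only [wave, e2]
        unfold cut
        split_ifs <;> simp [wave]
      rw [e4]
      unfold cut
      split_ifs
      · exact hwave y
      · simp
    · have e1 : g =ᶠ[nhds y] fun _ => 0 := by
        filter_upwards [hT.continuous.continuousAt.eventually_lt continuousAt_const
          (not_le.1 hTy)] with z hz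
        simp [hg, cut, hz.not_gt]
      have h0 : ∀ a, pd a (fun _ : Minkowski => (0 : Spinor)) = fun _ => 0 := fun a =>
        funext fun z => by simp [pd]
      rw [wave_congr e1, e1.self_of_nhds]
      simp [wave, h0]
  have hfin := Q.fundamental g hgs hgc x
  change Q.apply (fun y => wave g y + g y) x = g x at hfin
  rw [Q.apply_eq_zero hz] at hfin
  have hxK : x ∈ K := ⟨by simpa using hx0, hTx.le⟩
  have hgx : g x = ψ x := by
    simp [hg, cut, hTx, (hχ1 x hxK).self_of_nhds]
  rw [← hgx, ← hfin]

end Dependence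

end

section

/-! ### Geometry of Cauchy foliations -/

namespace CauchyFoliation

variable (F : CauchyFoliation)

lemma gInvTau_pos (x : Minkowski) : 0 < F.gInvTau x := by
  have h := F.spacelike x
  rw [gInvTau, Fin.sum_univ_succ]
  simp only [eta, if_true, Fin.succ_ne_zero, if_false, one_mul, neg_one_mul,
    Finset.sum_neg_distrib]
  linarith

lemma fderiv_apply_eq_sum {n : ℕ} {E : Type*} [NormedAddCommGroup E] [NormedSpace ℝ E]
    (f : (Fin n → ℝ) → E) (x v : Fin n → ℝ) : fderiv ℝ f x v = ∑ a, v a • pd a f x := by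
  conv_lhs => rw [← Finset.univ_sum_single v]
  rw [map_sum]
  refine Finset.sum_congr rfl fun a _ => ?_
  rw [pd, ← map_smul, ← Pi.single_smul, smul_eq_mul, mul_one]

/-- By Cauchy-Schwarz the spatial contribution v^i ∂_i τ is strictly smaller in absolute value than
v⁰ ∂₀τ. -/
lemma fderiv_tau_pos {x v : Minkowski} (hv : v ∈ futureCone) (hv0 : v ≠ 0) :
    0 < fderiv ℝ F.τ x v := by
  have h0 := F.increasing x
  have h1 := F.spacelike x
  have hv00 : 0 < v 0 := by
    refine lt_of_le_of_ne hv.1 fun h => hv0 ?_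
    have h2 := hv.2
    rw [← h] at h2
    ext a
    refine Fin.cases h.symm (fun i => ?_) a
    have h3 := Finset.single_le_sum (f := fun i : Fin 3 => v i.succ ^ 2)
      (fun i _ => sq_nonneg _) (Finset.mem_univ i)
    simp only [Pi.zero_apply]
    nlinarith
  rw [fderiv_apply_eq_sum, Fin.sum_univ_succ]
  simp only [smul_eq_mul]
  have hcs := Finset.sum_mul_sq_le_sq_mul_sq Finset.univ (fun i : Fin 3 => v i.succ)
    fun i => pd i.succ F.τ x
  have h5 : (∑ i : Fin 3, v i.succ * pd i.succ F.τ x) ^ 2 < (v 0 * pd 0 F.τ x) ^ 2 := by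
    refine hcs.trans_lt ?_
    rw [mul_pow]
    calc _ ≤ v 0 ^ 2 * ∑ i : Fin 3, pd i.succ F.τ x ^ 2 :=
          mul_le_mul_of_nonneg_right hv.2 (Finset.sum_nonneg fun i _ => sq_nonneg _)
      _ < _ := mul_lt_mul_of_pos_left h1 (by positivity)
  have h6 := abs_lt_of_sq_lt_sq h5 (by positivity)
  have h7 := (abs_lt.1 h6).1
  linarith

/-- The segment from x to y is causal, so the derivative of τ along it is positive. -/
lemma tau_lt {x y : Minkowski} (h : y - x ∈ futureCone) (hne : x ≠ y) : F.τ x < F.τ y := by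
  have hd : ∀ r : ℝ, HasDerivAt (fun r : ℝ => F.τ (x + r • (y - x)))
      (fderiv ℝ F.τ (x + r • (y - x)) (y - x)) r := by
    intro r
    have h1 : HasDerivAt (fun r : ℝ => x + r • (y - x)) (y - x) r := by
      simpa using ((hasDerivAt_id r).smul_const (y - x)).const_add x
    exact ((F.smooth.differentiable (by simp)) _).hasFDerivAt.comp_hasDerivAt r h1
  have hm := strictMono_of_hasDerivAt_pos hd fun r =>
    F.fderiv_tau_pos h (sub_ne_zero.2 hne.symm)
  simpa using hm zero_lt_one

lemma tau_le {x y : Minkowski} (h : y - x ∈ futureCone) : F.τ x ≤ F.τ y := by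
  by_cases hne : x = y
  · rw [hne]
  · exact (F.tau_lt h hne).le

/-- The vectors `(1, v)`. -/
def ray (v : Fin 3 → ℝ) : Minkowski := Fin.cons 1 v

/-- The velocities not exceeding the velocity of light. -/
def velocities : Set (Fin 3 → ℝ) := {v | ∑ i, v i ^ 2 ≤ 1}

lemma isCompact_velocities : IsCompact velocities := by
  refine Metric.isCompact_of_isClosed_isBounded ?_ ?_
  · exact isClosed_le (f := fun v : Fin 3 → ℝ => ∑ i, v i ^ 2) (by fun_prop) continuous_const
  · refine (Metric.isBounded_closedBall (x := (0 : Fin 3 → ℝ)) (r := 1)).subset fun v hv => ?_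
    rw [mem_closedBall_zero_iff, pi_norm_le_iff_of_nonneg zero_le_one]
    intro i
    have h3 := Finset.single_le_sum (f := fun i : Fin 3 => v i ^ 2)
      (fun i _ => sq_nonneg _) (Finset.mem_univ i)
    rw [Real.norm_eq_abs]
    exact abs_le_of_sq_le_sq (by simpa using h3.trans hv) zero_le_one

lemma continuous_ray : Continuous ray := by
  refine continuous_pi fun a => ?_
  refine Fin.cases ?_ (fun i => ?_) a
  · exact continuous_const
  · exact continuous_apply i

lemma smul_ray_mem {v : Fin 3 → ℝ} (hv : v ∈ velocities) {r : ℝ} (hr : 0 ≤ r) :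
    r • ray v ∈ futureCone := by
  refine ⟨by simpa [ray] using hr, ?_⟩
  simp only [ray, Pi.smul_apply, Fin.cons_succ, Fin.cons_zero, smul_eq_mul, mul_pow, mul_one]
  rw [← Finset.mul_sum]
  have : ∑ i, v i ^ 2 ≤ 1 := hv
  nlinarith [sq_nonneg r]

lemma exists_ray {w : Minkowski} (hw : w ∈ futureCone) :
    ∃ v ∈ velocities, w = w 0 • ray v := by
  by_cases h0 : w 0 = 0
  · have hz : ∀ i : Fin 3, w i.succ = 0 := by
      intro i
      have h2 := hw.2
      have h3 := Finset.single_le_sum (f := fun i : Fin 3 => w i.succ ^ 2)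
        (fun i _ => sq_nonneg _) (Finset.mem_univ i)
      simp only [h0] at h2
      nlinarith
    refine ⟨0, by simp [velocities], ?_⟩
    ext a
    refine Fin.cases ?_ (fun i => ?_) a
    · simp [h0]
    · simp [hz, h0]
  · refine ⟨fun i => w i.succ / w 0, ?_, ?_⟩
    · simp only [velocities, Set.mem_ofPred_eq, div_pow]
      rw [← Finset.sum_div, div_le_one (by positivity)]
      exact hw.2
    · ext a
      refine Fin.cases ?_ (fun i => ?_) a
      · simp [ray]
      · simp [ray]; field_simp

/-- A straight line of velocity at most 1 is an inextendible causal curve. This is where the Cauchy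
property enters; straight lines suffice for all the compactness statements below. -/
lemma exists_tau_eq_on_ray (x : Minkowski) {v : Fin 3 → ℝ} (hv : v ∈ velocities) (s : ℝ) :
    ∃ r : ℝ, F.τ (x + r • ray v) = s := by
  have hd : ∀ r, HasDerivAt (fun r : ℝ => x + r • ray v) (ray v) r := fun r => by
    simpa using ((hasDerivAt_id r).smul_const (ray v)).const_add x
  have hc : IsInextendibleCausalCurve fun r : ℝ => x + r • ray v := by
    have h0 : ∀ r : ℝ, (x + r • ray v) 0 = x 0 + r := fun r => by simp [ray]
    refine ⟨by fun_prop, fun r => ?_, ?_, ?_⟩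
    · rw [(hd r).deriv]
      exact ⟨by simp [ray], by simpa [ray, velocities] using hv⟩
    · rintro ⟨p, hp⟩
      have h1 := ((continuous_apply (0 : Fin 4)).tendsto p).comp hp
      refine not_tendsto_atTop_of_tendsto_nhds h1 ?_
      simp only [Function.comp_def, h0]
      exact Filter.tendsto_atTop_add_const_left _ _ Filter.tendsto_id
    · rintro ⟨p, hp⟩
      have h1 := ((continuous_apply (0 : Fin 4)).tendsto p).comp hp
      refine not_tendsto_atBot_of_tendsto_nhds h1 ?_
      simp only [Function.comp_def, h0]
      exact Filter.tendsto_atBot_add_const_left _ _ Filter.tendsto_id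
  obtain ⟨r, hr, -⟩ := F.cauchy s _ hc
  exact ⟨r, hr⟩

lemma tau_ray_mono (x : Minkowski) {v : Fin 3 → ℝ} (hv : v ∈ velocities) :
    Monotone fun r : ℝ => F.τ (x + r • ray v) := by
  intro r r' h
  refine F.tau_le ?_
  have : x + r' • ray v - (x + r • ray v) = (r' - r) • ray v := by module
  rw [this]
  exact smul_ray_mem hv (sub_nonneg.2 h)

/-- Every backward ray eventually drops below Σ_s and stays below by monotonicity. Compactness of
the set of starting points and velocities makes the required parameter uniform. -/
lemma exists_past_bound {K : Set Minkowski} (hK : IsCompact K) (s : ℝ) :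
    ∃ ρ : ℝ, ∀ x ∈ K, ∀ v ∈ velocities, ∀ r, ρ ≤ r → F.τ (x - r • ray v) < s := by
  have hτ := F.smooth.continuous
  have hr := continuous_ray
  have hcov := (hK.prod isCompact_velocities).elim_directed_cover
    -- Monotonicity along rays holds only for admissible velocities; adding the open set of
    -- inadmissible ones makes the cover increasing in n.
    (fun n : ℕ => {p : Minkowski × (Fin 3 → ℝ) | F.τ (p.1 + min (-(n : ℝ)) 0 • ray p.2) < s
      ∨ p.2 ∉ velocities}) ?_ ?_ ?_
  · obtain ⟨n, hn⟩ := hcov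
    refine ⟨n, fun x hx v hv r hrn => ?_⟩
    have h1 : F.τ (x + min (-(n : ℝ)) 0 • ray v) < s :=
      (hn (Set.mk_mem_prod hx hv)).resolve_right (not_not.2 hv)
    refine lt_of_le_of_lt ?_ h1
    rw [sub_eq_add_neg, ← neg_smul]
    refine F.tau_ray_mono x hv ?_
    rw [min_eq_left (by simp)]
    linarith
  · intro n
    refine IsOpen.union (isOpen_lt (f := fun p : Minkowski × (Fin 3 → ℝ) =>
      F.τ (p.1 + min (-(n : ℝ)) 0 • ray p.2)) (by fun_prop) continuous_const) ?_
    exact isCompact_velocities.isClosed.isOpen_compl.preimage continuous_snd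
  · rintro ⟨x, v⟩ ⟨-, hv⟩
    obtain ⟨r, hr⟩ := F.exists_tau_eq_on_ray x hv (s - 1)
    obtain ⟨n, hn⟩ := exists_nat_ge (-r)
    refine Set.mem_iUnion.2 ⟨n, Or.inl ?_⟩
    have h1 : F.τ (x + min (-(n : ℝ)) 0 • ray v) ≤ F.τ (x + r • ray v) := by
      refine F.tau_ray_mono x hv ?_
      rw [min_eq_left (by simp)]
      linarith
    change F.τ (x + min (-(n : ℝ)) 0 • ray v) < s
    linarith
  · refine directed_of_isDirected_le fun m n hmn => ?_
    rintro ⟨x, v⟩ (h | h)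
    · by_cases hv : v ∈ velocities
      · left
        refine lt_of_le_of_lt (F.tau_ray_mono x hv ?_) h
        have : (m : ℝ) ≤ n := by exact_mod_cast hmn
        exact min_le_min (by linarith) le_rfl
      · exact Or.inr hv
    · exact Or.inr h

lemma exists_future_bound {K : Set Minkowski} (hK : IsCompact K) (s : ℝ) :
    ∃ ρ : ℝ, ∀ x ∈ K, ∀ v ∈ velocities, ∀ r, ρ ≤ r → s < F.τ (x + r • ray v) := by
  have hτ := F.smooth.continuous
  have hr := continuous_ray
  have hcov := (hK.prod isCompact_velocities).elim_directed_cover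
    (fun n : ℕ => {p : Minkowski × (Fin 3 → ℝ) | s < F.τ (p.1 + (n : ℝ) • ray p.2)
      ∨ p.2 ∉ velocities}) ?_ ?_ ?_
  · obtain ⟨n, hn⟩ := hcov
    refine ⟨n, fun x hx v hv r hrn => ?_⟩
    have h1 : s < F.τ (x + (n : ℝ) • ray v) :=
      (hn (Set.mk_mem_prod hx hv)).resolve_right (not_not.2 hv)
    exact lt_of_lt_of_le h1 (F.tau_ray_mono x hv hrn)
  · intro n
    refine IsOpen.union (isOpen_lt (g := fun p : Minkowski × (Fin 3 → ℝ) =>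
      F.τ (p.1 + (n : ℝ) • ray p.2)) continuous_const (by fun_prop)) ?_
    exact isCompact_velocities.isClosed.isOpen_compl.preimage continuous_snd
  · rintro ⟨x, v⟩ ⟨-, hv⟩
    obtain ⟨r, hr⟩ := F.exists_tau_eq_on_ray x hv (s + 1)
    obtain ⟨n, hn⟩ := exists_nat_ge r
    refine Set.mem_iUnion.2 ⟨n, Or.inl ?_⟩
    have h1 : F.τ (x + r • ray v) ≤ F.τ (x + (n : ℝ) • ray v) := F.tau_ray_mono x hv hn
    change s < F.τ (x + (n : ℝ) • ray v)
    linarith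
  · refine directed_of_isDirected_le fun m n hmn => ?_
    rintro ⟨x, v⟩ (h | h)
    · by_cases hv : v ∈ velocities
      · left
        refine lt_of_lt_of_le h (F.tau_ray_mono x hv ?_)
        exact_mod_cast hmn
      · exact Or.inr hv
    · exact Or.inr h

/-- The part of the past of a compact set which lies above a Cauchy surface is relatively
compact. -/
lemma exists_isCompact_past {K : Set Minkowski} (hK : IsCompact K) (s : ℝ) :
    ∃ L : Set Minkowski, IsCompact L ∧
      ∀ x ∈ K, ∀ y, x - y ∈ futureCone → s ≤ F.τ y → y ∈ L := by
  obtain ⟨ρ, hρ⟩ := F.exists_past_bound hK s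
  have hr := continuous_ray
  refine ⟨(fun p : (Minkowski × (Fin 3 → ℝ)) × ℝ => p.1.1 - p.2 • ray p.1.2) ''
    ((K ×ˢ velocities) ×ˢ Set.Icc 0 ρ), ((hK.prod isCompact_velocities).prod
      isCompact_Icc).image (by fun_prop), fun x hx y hy hs => ?_⟩
  obtain ⟨v, hv, hw⟩ := exists_ray hy
  have hy' : y = x - (x - y) 0 • ray v := by rw [← hw]; abel
  refine ⟨((x, v), (x - y) 0), ⟨⟨hx, hv⟩, hy.1, ?_⟩, hy'.symm⟩
  by_contra h
  have := hρ x hx v hv _ (not_le.1 h).le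
  rw [← hy'] at this
  linarith

lemma exists_isCompact_future {K : Set Minkowski} (hK : IsCompact K) (s : ℝ) :
    ∃ L : Set Minkowski, IsCompact L ∧
      ∀ x ∈ K, ∀ y, y - x ∈ futureCone → F.τ y ≤ s → y ∈ L := by
  obtain ⟨ρ, hρ⟩ := F.exists_future_bound hK s
  have hr := continuous_ray
  refine ⟨(fun p : (Minkowski × (Fin 3 → ℝ)) × ℝ => p.1.1 + p.2 • ray p.1.2) ''
    ((K ×ˢ velocities) ×ˢ Set.Icc 0 ρ), ((hK.prod isCompact_velocities).prod
      isCompact_Icc).image (by fun_prop), fun x hx y hy hs => ?_⟩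
  obtain ⟨v, hv, hw⟩ := exists_ray hy
  have hy' : y = x + (y - x) 0 • ray v := by rw [← hw]; abel
  refine ⟨((x, v), (y - x) 0), ⟨⟨hx, hv⟩, hy.1, ?_⟩, hy'.symm⟩
  by_contra h
  have := hρ x hx v hv _ (not_le.1 h).le
  rw [← hy'] at this
  linarith

lemma causallyRelated_iff {x y : Minkowski} :
    CausallyRelated x y ↔ x - y ∈ futureCone ∨ y - x ∈ futureCone := by
  simp only [CausallyRelated, futureCone, Set.mem_ofPred_eq, Pi.sub_apply]
  constructor
  · intro h
    rcases le_total 0 (x 0 - y 0) with h0 | h0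
    · exact Or.inl ⟨h0, h⟩
    · refine Or.inr ⟨by linarith, ?_⟩
      convert! h using 1
      · exact Finset.sum_congr rfl fun i _ => by ring
      · ring
  · rintro (h | h)
    · exact h.2
    · convert! h.2 using 1
      · exact Finset.sum_congr rfl fun i _ => by ring
      · ring

/-- The points of `Σ_t`, with `t` in a compact interval, which are causally related to points of a
compact set form a relatively compact set. -/
lemma exists_isCompact_related {K : Set Minkowski} (hK : IsCompact K) (a b : ℝ) :
    ∃ L : Set Minkowski, IsCompact L ∧
      ∀ x ∈ K, ∀ y, CausallyRelated y x → a ≤ F.τ y → F.τ y ≤ b → y ∈ L := by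
  obtain ⟨L, hL, h1⟩ := F.exists_isCompact_past hK a
  obtain ⟨L', hL', h2⟩ := F.exists_isCompact_future hK b
  refine ⟨L ∪ L', hL.union hL', fun x hx y hy ha hb => ?_⟩
  rcases causallyRelated_iff.1 hy with h | h
  · exact Or.inr (h2 x hx y h hb)
  · exact Or.inl (h1 x hx y h ha)

lemma isClosed_causallyRelated :
    IsClosed {p : Minkowski × Minkowski | CausallyRelated p.1 p.2} :=
  isClosed_le (f := fun p : Minkowski × Minkowski => ∑ i : Fin 3, (p.1 i.succ - p.2 i.succ) ^ 2)
    (g := fun p => (p.1 0 - p.2 0) ^ 2) (by fun_prop) (by fun_prop)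

/-! ### Uniqueness for the Cauchy problem -/

variable {F} {D : DiracMatrices}

/-- A solution of the Dirac equation vanishes at the points which are not causally related to the
support of its restriction to a Cauchy surface. -/
theorem eq_zero_of_not_causallyRelated {ψ : Minkowski → Spinor} (hψ : ContDiff ℝ 2 ψ)
    (hD : ∀ x, slash D ψ x - ψ x = 0) {s : ℝ} {B : Set Minkowski} (hB : IsClosed B)
    (h0 : ∀ y ∉ B, F.τ y = s → ψ y = 0) {x : Minkowski}
    (hx : ∀ y ∈ B, F.τ y = s → ¬ CausallyRelated x y) : ψ x = 0 := by
  have hτ := F.smooth.continuous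
  set B' := B ∩ {y | F.τ y = s} with hB'
  have hB'c : IsClosed B' := hB.inter (isClosed_eq hτ continuous_const)
  have h0' : ∀ y ∉ B', F.τ y = s → ψ y = 0 := fun y hy hys => h0 y (fun h => hy ⟨h, hys⟩) hys
  have zero_mem : (0 : Minkowski) ∈ futureCone := by simp [futureCone]
  rcases lt_trichotomy (F.τ x) s with h | h | h
  -- Below Σ_s time is reversed: the advanced propagator is used with the defining function s - τ.
  · obtain ⟨Q, hQ⟩ := exists_advanced
    obtain ⟨L, hL, hLx⟩ := F.exists_isCompact_future (isCompact_singleton (x := x)) s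
    have hpd : ∀ a y, pd a (fun y => s - F.τ y) y = -pd a F.τ y := by
      intro a y
      rw [pd_sub (differentiableAt_const _) (F.smooth.differentiable (by simp) y)]
      simp [pd]
    have hmem : ∀ y, x - y ∈ Q.cone ↔ y - x ∈ futureCone := fun y => by
      rw [hQ, Set.mem_neg, neg_sub]
    refine eq_zero_of_vanishing_data (D := D) Q (T := fun y => s - F.τ y)
      (contDiff_const.sub F.smooth) (fun y => ?_) hψ hD hB'c
      (fun y hy hys => h0' y hy (sub_eq_zero.1 hys).symm) (sub_pos.2 h) (by simp [hQ, zero_mem])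
      ?_ ?_
    · simp only [hpd, neg_sq]
      exact (F.gInvTau_pos y).ne'
    · refine hL.of_isClosed_subset ?_ fun y hy => hLx x rfl y ((hmem y).1 hy.1) (sub_nonneg.1 hy.2)
      simp only [hmem, sub_nonneg]
      exact (isClosed_futureCone.preimage (by fun_prop : Continuous fun y => y - x)).inter
        (isClosed_le hτ continuous_const)
    · rintro y hy - ⟨hyB, hys⟩
      exact hx y hyB hys (causallyRelated_iff.2 (Or.inr ((hmem y).1 hy)))
  · exact h0 x (fun hxB => hx x hxB h (by simp [CausallyRelated])) h
  · obtain ⟨Q, hQ⟩ := exists_retarded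
    obtain ⟨L, hL, hLx⟩ := F.exists_isCompact_past (isCompact_singleton (x := x)) s
    have hpd : ∀ a y, pd a (fun y => F.τ y - s) y = pd a F.τ y := by
      intro a y
      rw [pd_sub (F.smooth.differentiable (by simp) y) (differentiableAt_const _)]
      simp [pd]
    refine eq_zero_of_vanishing_data (D := D) Q (T := fun y => F.τ y - s)
      (F.smooth.sub contDiff_const) (fun y => ?_) hψ hD hB'c
      (fun y hy hys => h0' y hy (sub_eq_zero.1 hys)) (sub_pos.2 h) (by simp [hQ, zero_mem]) ?_ ?_
    · simp only [hpd]
      exact (F.gInvTau_pos y).ne'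
    · refine hL.of_isClosed_subset ?_ fun y hy => hLx x rfl y (hQ ▸ hy.1) (sub_nonneg.1 hy.2)
      simp only [hQ, sub_nonneg]
      exact (isClosed_futureCone.preimage (by fun_prop : Continuous fun y => x - y)).inter
        (isClosed_le continuous_const hτ)
    · rintro y hy - ⟨hyB, hys⟩
      exact hx y hyB hys (causallyRelated_iff.2 (Or.inl (hQ ▸ hy)))

theorem eq_of_eqOn_slice {ψ φ : Minkowski → Spinor} (hψ : ContDiff ℝ 2 ψ)
    (hψD : ∀ x, slash D ψ x - ψ x = 0) (hφ : ContDiff ℝ 2 φ)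
    (hφD : ∀ x, slash D φ x - φ x = 0) {s : ℝ} (h : ∀ y, F.τ y = s → ψ y = φ y) : ψ = φ := by
  funext x
  rw [← sub_eq_zero]
  refine eq_zero_of_not_causallyRelated (F := F) (D := D) (ψ := fun y => ψ y - φ y) (s := s)
    (hψ.sub hφ) (fun y => ?_) isClosed_empty (fun y _ hy => sub_eq_zero.2 (h y hy)) (by simp)
  rw [slash_sub (hψ.differentiable two_ne_zero y) (hφ.differentiable two_ne_zero y)]
  have h1 := hψD y
  have h2 := hφD y
  rw [sub_eq_zero] at h1 h2
  rw [h1, h2, sub_self]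

end CauchyFoliation

end

section

/-! ### Existence for the Cauchy problem -/

lemma hasDerivAt_max_pow (n : ℕ) (u : ℝ) :
    HasDerivAt (fun u : ℝ => max u 0 ^ (n + 2)) ((n + 2) * max u 0 ^ (n + 1)) u := by
  rcases lt_trichotomy u 0 with h | h | h
  · have : (fun u : ℝ => max u 0 ^ (n + 2)) =ᶠ[nhds u] fun _ => 0 := by
      filter_upwards [Iio_mem_nhds h] with v hv
      rw [max_eq_right (le_of_lt hv)]; simp
    rw [max_eq_right h.le]
    simpa using (hasDerivAt_const u (0 : ℝ)).congr_of_eventuallyEq this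
  · subst h
    rw [hasDerivAt_iff_isLittleO]
    simp only [max_self, ne_eq, Nat.add_eq_zero_iff, OfNat.ofNat_ne_zero, and_false,
      not_false_eq_true, zero_pow, one_ne_zero, mul_zero, smul_zero, sub_zero]
    have h1 : (fun v : ℝ => max v 0 ^ (n + 2)) =O[nhds 0] fun v : ℝ => v ^ (n + 2) := by
      refine Asymptotics.isBigO_of_le _ fun v => ?_
      rw [norm_pow, norm_pow]
      gcongr
      rw [Real.norm_eq_abs, Real.norm_eq_abs, abs_of_nonneg (le_max_right _ _)]
      exact max_le (le_abs_self v) (abs_nonneg v)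
    exact h1.trans_isLittleO (Asymptotics.isLittleO_pow_id (by omega))
  · have : (fun u : ℝ => max u 0 ^ (n + 2)) =ᶠ[nhds u] fun u => u ^ (n + 2) := by
      filter_upwards [Ioi_mem_nhds h] with v hv
      rw [max_eq_left (le_of_lt hv)]
    rw [max_eq_left h.le]
    have h2 := (hasDerivAt_pow (n + 2) u).congr_of_eventuallyEq this
    simpa using h2

/-- The truncated power of degree n + 1 has n continuous derivatives. Such factors split the error
of an approximate solution at Σ_s at a finite cost in regularity. -/
lemma contDiff_max_pow (n : ℕ) : ContDiff ℝ n fun u : ℝ => max u 0 ^ (n + 1) := by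
  induction n with
  | zero =>
    rw [Nat.cast_zero, contDiff_zero]
    fun_prop
  | succ n ih =>
    push_cast
    rw [contDiff_succ_iff_deriv]
    refine ⟨fun u => (hasDerivAt_max_pow n u).differentiableAt, by simp, ?_⟩
    have : deriv (fun u : ℝ => max u 0 ^ (n + 1 + 1)) =
        fun u : ℝ => ((n : ℝ) + 2) * max u 0 ^ (n + 1) :=
      funext fun u => (hasDerivAt_max_pow n u).deriv
    rw [this]
    exact contDiff_const.mul ih

lemma pow_eq_max_pow_add (u : ℝ) {k : ℕ} (hk : k ≠ 0) :
    u ^ k = max u 0 ^ k + (-1) ^ k * max (-u) 0 ^ k := by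
  rcases le_total 0 u with h | h
  · rw [max_eq_left h, max_eq_right (by linarith), zero_pow hk]; ring
  · rw [max_eq_right h, max_eq_left (by linarith), zero_pow hk, ← mul_pow]; ring

variable {D : DiracMatrices}

lemma pd_param {P : Type*} [NormedAddCommGroup P] [NormedSpace ℝ P]
    {E : Type*} [NormedAddCommGroup E] [NormedSpace ℝ E] {n : ℕ} {Ψ : P × (Fin n → ℝ) → E}
    (hΨ : Differentiable ℝ Ψ) (a : Fin n) (s : P) (x : Fin n → ℝ) :
    pd a (fun y => Ψ (s, y)) x = fderiv ℝ Ψ (s, x) (0, Pi.single a 1) := by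
  have h := ((hΨ (s, x)).hasFDerivAt.comp x (hasFDerivAt_prodMk_right s x)).fderiv
  change fderiv ℝ (Ψ ∘ fun y => (s, y)) x _ = _
  rw [h]
  simp

lemma contDiff_pd_param {P : Type*} [NormedAddCommGroup P] [NormedSpace ℝ P]
    {E : Type*} [NormedAddCommGroup E] [NormedSpace ℝ E] {n : ℕ} {Ψ : P × (Fin n → ℝ) → E}
    {k m : WithTop ℕ∞} (hΨ : ContDiff ℝ k Ψ) (hm : m + 1 ≤ k) (a : Fin n) :
    ContDiff ℝ m fun q : P × (Fin n → ℝ) => pd a (fun y => Ψ (q.1, y)) q.2 := by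
  have hk : k ≠ 0 := by
    rintro rfl
    simp at hm
  simp only [pd_param (hΨ.differentiable hk)]
  exact (hΨ.fderiv_right hm).clm_apply contDiff_const

lemma contDiff_slash_param {P : Type*} [NormedAddCommGroup P] [NormedSpace ℝ P]
    {Ψ : P × Minkowski → Spinor} {k m : WithTop ℕ∞} (hΨ : ContDiff ℝ k Ψ) (hm : m + 1 ≤ k) :
    ContDiff ℝ m fun q : P × Minkowski => slash D (fun y => Ψ (q.1, y)) q.2 := by
  simp only [slash_eq]
  exact ContDiff.sum fun a _ => (actL _).contDiff.comp (contDiff_pd_param hΨ hm a)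

/-- A zero of a nonnegative function is a minimum, so its gradient vanishes too. Hence the source
(iγ∂ + 1)(cB) used in `Propagator.solve` vanishes wherever c does. -/
lemma slash_smul_eq_zero {c : Minkowski → ℝ} {f : Minkowski → Spinor} {x : Minkowski}
    (hc : DifferentiableAt ℝ c x) (hf : DifferentiableAt ℝ f x) (hc0 : ∀ y, 0 ≤ c y)
    (hx : c x = 0) : slash D (fun y => c y • f y) x = 0 := by
  have hmin : IsLocalMin c x := Filter.Eventually.of_forall fun y => hx ▸ hc0 y
  rw [slash_smul hc hf, hx, gradSlash]
  simp [pd, hmin.fderiv_eq_zero, act]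

namespace CauchyFoliation

variable (F : CauchyFoliation)

lemma contDiff_gInvTau : ContDiff ℝ ∞ F.gInvTau := by
  unfold gInvTau
  exact ContDiff.sum fun a _ => contDiff_const.mul ((contDiff_pd F.smooth (by simp) a).pow 2)

/-- Approximate solutions of the Cauchy problem for all hypersurfaces `Σ_s`, to any finite order. -/
lemma exists_formal_solution {G : Minkowski → Spinor} (hG : ContDiff ℝ ∞ G) (k : ℕ) :
    ∃ A R : ℝ × Minkowski → Spinor, ContDiff ℝ ∞ A ∧ ContDiff ℝ ∞ R ∧
      (∀ s, ∀ x ∉ tsupport G, A (s, x) = 0) ∧ (∀ s, ∀ x ∉ tsupport G, R (s, x) = 0) ∧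
      (∀ x, A (F.τ x, x) = G x) ∧
      ∀ s x, slash D (fun y => A (s, y)) x - A (s, x) = (F.τ x - s) ^ k • R (s, x) := by
  have supp : ∀ {A : ℝ × Minkowski → Spinor}, (∀ s, ∀ x ∉ tsupport G, A (s, x) = 0) →
      ∀ s, ∀ x ∉ tsupport G, slash D (fun y => A (s, y)) x = 0 := by
    intro A hA s x hx
    have : (fun y => A (s, y)) =ᶠ[nhds x] fun _ => 0 := by
      filter_upwards [(isClosed_tsupport G).isOpen_compl.mem_nhds hx] with y hy
      exact hA s y hy
    have h2 : ∀ a, pd a (fun y => A (s, y)) x = 0 := fun a => by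
      rw [(pd_congr this a).self_of_nhds]; simp [pd]
    simp [slash, h2]
  induction k with
  | zero =>
    refine ⟨fun p => G p.2, fun p => slash D G p.2 - G p.2, hG.comp contDiff_snd,
      ((contDiff_slash (m := ∞) hG (by simp)).sub hG).comp contDiff_snd,
      fun s x hx => image_eq_zero_of_notMem_tsupport hx, fun s x hx => ?_, fun x => rfl,
      fun s x => by simp⟩
    have h1 := supp (A := fun p => G p.2) (fun s x hx => image_eq_zero_of_notMem_tsupport hx)
      s x hx
    simp [h1, image_eq_zero_of_notMem_tsupport hx]
  | succ k ih =>
    obtain ⟨A, R, hA, hR, hA0, hR0, hAG, hAR⟩ := ih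
    -- The unique solution of i(k + 1)γ(dτ)W = R, using that the square of γ(dτ) is g^{ττ}.
    set W : ℝ × Minkowski → Spinor := fun p => ((k + 1 : ℝ)⁻¹ * (F.gInvTau p.2)⁻¹) •
      ∑ a, pd a F.τ p.2 • actL (-Complex.I • D.γ a) (R p) with hW
    have hWs : ContDiff ℝ ∞ W := by
      refine ContDiff.smul (contDiff_const.mul ((F.contDiff_gInvTau.comp contDiff_snd).inv
        fun p => (F.gInvTau_pos _).ne')) (ContDiff.sum fun a _ => ContDiff.smul
          ((contDiff_pd F.smooth (by simp) a).comp contDiff_snd) ((actL _).contDiff.comp hR))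
    have hW0 : ∀ s, ∀ x ∉ tsupport G, W (s, x) = 0 := fun s x hx => by
      simp [hW, hR0 s x hx]
    have hWR : ∀ s x, ((k + 1 : ℝ)) • Complex.I • act (gradSlash D F.τ x) (W (s, x))
        = R (s, x) := by
      intro s x
      have e1 : ∑ a, pd a F.τ x • actL (-Complex.I • D.γ a) (R (s, x))
          = act (-Complex.I • gradSlash D F.τ x) (R (s, x)) := by
        rw [gradSlash, Finset.smul_sum, act_sum_matrix]
        refine Finset.sum_congr rfl fun a _ => ?_
        rw [actL_apply, ← Complex.coe_smul, smul_act, smul_comm]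
      have e2 : W (s, x) = ((k + 1 : ℝ)⁻¹ * (F.gInvTau x)⁻¹) •
          act (-Complex.I • gradSlash D F.τ x) (R (s, x)) := by
        simp only [hW, e1]
      have hg := (F.gInvTau_pos x).ne'
      have hk : (k + 1 : ℝ) ≠ 0 := by positivity
      rw [e2, ← actL_apply, map_smul, actL_apply, act_act, Matrix.mul_smul, gradSlash_mul_self,
        ← smul_act, ← smul_act, act_one, smul_comm Complex.I, smul_smul, smul_smul Complex.I]
      have : ((∑ a, eta a * pd a F.τ x ^ 2 : ℝ) : ℂ) = ((F.gInvTau x : ℝ) : ℂ) := rfl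
      rw [this, Complex.coe_smul, mul_neg, Complex.I_mul_I, neg_neg, one_smul, smul_smul,
        mul_inv_cancel_left₀ hk, inv_mul_cancel₀ hg, one_smul]
    have hslice : ∀ {B : ℝ × Minkowski → Spinor}, ContDiff ℝ ∞ B → ∀ s,
        Differentiable ℝ fun y => B (s, y) := fun hB s =>
      (hB.comp (f := fun y : Minkowski => (s, y))
        (contDiff_const.prodMk contDiff_id)).differentiable (by simp)
    have hpow : ∀ s, Differentiable ℝ fun y => (F.τ y - s) ^ (k + 1) := fun s =>
      ((F.smooth.sub contDiff_const).pow (k + 1)).differentiable (by simp)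
    have hgrad : ∀ s x, gradSlash D (fun y => (F.τ y - s) ^ (k + 1)) x
        = (((k + 1) * (F.τ x - s) ^ k : ℝ) : ℂ) • gradSlash D F.τ x := by
      intro s x
      rw [gradSlash, gradSlash, Finset.smul_sum]
      refine Finset.sum_congr rfl fun a _ => ?_
      rw [smul_smul, ← Complex.ofReal_mul]
      congr 2
      have h1 := (F.smooth.differentiable (by simp) x).hasFDerivAt
      rw [pd, ((h1.sub_const s).pow (k + 1)).fderiv]
      simp [pd]
    -- Differentiating the power in the correction yields (τ - s)^k R, which cancels the old error;
    -- what is left carries one more factor τ - s.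
    refine ⟨fun p => A p - (F.τ p.2 - p.1) ^ (k + 1) • W p,
      fun p => W p - slash D (fun y => W (p.1, y)) p.2, ?_, ?_, ?_, ?_, ?_, ?_⟩
    · exact hA.sub ((((F.smooth.comp contDiff_snd).sub contDiff_fst).pow (k + 1)).smul hWs)
    · exact hWs.sub (contDiff_slash_param hWs (by simp))
    · intro s x hx
      simp [hA0 s x hx, hW0 s x hx]
    · intro s x hx
      simp [supp hW0 s x hx, hW0 s x hx]
    · intro x
      simp [hAG]
    · intro s x
      simp only
      rw [slash_sub (f := fun y => A (s, y)) (g := fun y => (F.τ y - s) ^ (k + 1) • W (s, y))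
          (hslice hA s x) ((hpow s x).smul (hslice hWs s x)),
        slash_smul (hpow s x) (hslice hWs s x), hgrad, ← smul_act]
      have h1 := hAR s x
      have h2 := hWR s x
      rw [Complex.coe_smul, smul_comm Complex.I, mul_comm, mul_smul, h2]
      rw [sub_eq_iff_eq_add] at h1
      rw [h1]
      module

/-- Solutions of the Cauchy problem of finite regularity, jointly in the hypersurface and the
point. -/
lemma exists_solution_of_order {G : Minkowski → Spinor} (hG : ContDiff ℝ ∞ G)
    (hGc : HasCompactSupport G) (m : ℕ) :
    ∃ Ψ : ℝ × Minkowski → Spinor, ContDiff ℝ m Ψ ∧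
      ∀ s, ContDiff ℝ 2 (fun y => Ψ (s, y)) ∧
        (∀ x, slash D (fun y => Ψ (s, y)) x - Ψ (s, x) = 0) ∧
        ∀ x, F.τ x = s → Ψ (s, x) = G x := by
  obtain ⟨Qr, hQr⟩ := exists_retarded
  obtain ⟨Qa, hQa⟩ := exists_advanced
  -- With exponent m + 5 the truncated powers are of class C^{m+4}. The source of the Green operator
  -- loses one derivative, which leaves m + 3, enough both for order m and for the C² uniqueness
  -- theorem.
  obtain ⟨A, R, hA, hR, hA0, hR0, hAG, hAR⟩ := F.exists_formal_solution (D := D) hG (m + 5)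
  set c₁ : ℝ × Minkowski → ℝ := fun p => max (F.τ p.2 - p.1) 0 ^ (m + 5) with hc₁
  set c₂ : ℝ × Minkowski → ℝ := fun p => max (-(F.τ p.2 - p.1)) 0 ^ (m + 5) with hc₂
  have hτ : ContDiff ℝ (m + 4 : ℕ) fun p : ℝ × Minkowski => F.τ p.2 - p.1 :=
    ((F.smooth.comp contDiff_snd).sub contDiff_fst).of_le (natCast_le_infty _)
  have hc₁s : ContDiff ℝ (m + 4 : ℕ) c₁ := (contDiff_max_pow (m + 4)).comp hτ
  have hc₂s : ContDiff ℝ (m + 4 : ℕ) c₂ := (contDiff_max_pow (m + 4)).comp hτ.neg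
  have hR' : ContDiff ℝ (m + 4 : ℕ) R := hR.of_le (natCast_le_infty _)
  set S : ℝ × Minkowski → Spinor := fun p => (-1 : ℝ) ^ (m + 5) • R p with hS
  have hS' : ContDiff ℝ (m + 4 : ℕ) S := hR'.const_smul _
  have hle : ((m + 3 : ℕ) : WithTop ℕ∞) + 1 ≤ (m + 4 : ℕ) := by
    exact_mod_cast le_rfl
  have hsl : ∀ {n : WithTop ℕ∞} {E : Type} [NormedAddCommGroup E] [NormedSpace ℝ E]
      {B : ℝ × Minkowski → E}, ContDiff ℝ n B → ∀ s,
      ContDiff ℝ n fun y => B (s, y) := fun hB s =>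
    hB.comp (f := fun y : Minkowski => (s, y)) (contDiff_const.prodMk contDiff_id)
  have hns : ((m + 4 : ℕ) : WithTop ℕ∞) ≠ 0 := by
    exact_mod_cast (by omega : m + 4 ≠ 0)
  have h2le : (2 : WithTop ℕ∞) ≤ (m + 4 : ℕ) := by
    exact_mod_cast (by omega : 2 ≤ m + 4)
  have h2le' : (2 : WithTop ℕ∞) ≤ (m + 3 : ℕ) := by
    exact_mod_cast (by omega : 2 ≤ m + 3)
  have main : ∀ (Q : Propagator) (c : ℝ × Minkowski → ℝ) (B : ℝ × Minkowski → Spinor),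
      ContDiff ℝ (m + 4 : ℕ) c → ContDiff ℝ (m + 4 : ℕ) B →
      (∀ s, ∀ x ∉ tsupport G, B (s, x) = 0) → (∀ p, 0 ≤ c p) →
      ContDiff ℝ (m + 3 : ℕ) (fun p : ℝ × Minkowski =>
        Q.solve D (fun y => c (p.1, y) • B (p.1, y)) p.2) ∧
      (∀ s x, slash D (Q.solve D fun y => c (s, y) • B (s, y)) x
        - Q.solve D (fun y => c (s, y) • B (s, y)) x = c (s, x) • B (s, x)) ∧
      ∀ s x, (∀ y, x - y ∈ Q.cone → c (s, y) = 0) →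
        Q.solve D (fun y => c (s, y) • B (s, y)) x = 0 := by
    intro Q c B hc hB hB0 hc0
    have hj : ContDiff ℝ (m + 4 : ℕ) fun p => c p • B p := hc.smul hB
    have hj0 : ∀ s, ∀ x ∉ tsupport G, c (s, x) • B (s, x) = 0 := fun s x hx => by
      rw [hB0 s x hx, smul_zero]
    have hjc : ∀ s, HasCompactSupport fun y => c (s, y) • B (s, y) := fun s =>
      HasCompactSupport.intro hGc fun x hx => hj0 s x hx
    refine ⟨?_, fun s x => Q.slash_solve ((hsl hj s).of_le h2le) (hjc s) x, fun s x hx => ?_⟩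
    · refine ContDiff.neg ?_
      refine Q.contDiff_apply_param (P := ℝ) (n := (m + 3 : ℕ))
        (j := fun s y => slash D (fun y => c (s, y) • B (s, y)) y + c (s, y) • B (s, y)) hGc
        (fun s x hx => ?_) ?_
      · have : (fun y => c (s, y) • B (s, y)) =ᶠ[nhds x] fun _ => 0 := by
          filter_upwards [(isClosed_tsupport G).isOpen_compl.mem_nhds hx] with y hy
          exact hj0 s y hy
        have h2 : ∀ a, pd a (fun y => c (s, y) • B (s, y)) x = 0 := fun a => by
          rw [(pd_congr this a).self_of_nhds]; simp [pd]
        simp only [slash, h2, hj0 s x hx]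
        simp [act]
      · exact (contDiff_slash_param hj hle).add (hj.of_le (by exact_mod_cast Nat.le_succ _))
    · rw [Propagator.solve, Q.apply_eq_zero, neg_zero]
      intro y hy
      rw [slash_smul_eq_zero ((hsl hc s).differentiable hns y) ((hsl hB s).differentiable hns y)
        (fun y => hc0 _) (hx y hy), hx y hy, zero_smul, add_zero]
  obtain ⟨r1, r2, r3⟩ := main Qr c₁ R hc₁s hR' hR0 fun p => by positivity
  obtain ⟨a1, a2, a3⟩ := main Qa c₂ S hc₂s hS' (fun s x hx => by simp [hS, hR0 s x hx])
    fun p => by positivity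
  have hA' : ContDiff ℝ (m + 3 : ℕ) A := hA.of_le (natCast_le_infty _)
  -- The error in the future of Σ_s is removed by the retarded operator, the error in its past by
  -- the advanced one. Both corrections vanish on Σ_s, because τ is monotone along the cones.
  set Ψ : ℝ × Minkowski → Spinor := fun p => A p
    - Qr.solve D (fun y => c₁ (p.1, y) • R (p.1, y)) p.2
    - Qa.solve D (fun y => c₂ (p.1, y) • S (p.1, y)) p.2 with hΨ
  have hΨs : ContDiff ℝ (m + 3 : ℕ) Ψ := (hA'.sub r1).sub a1
  refine ⟨Ψ, hΨs.of_le (by exact_mod_cast (by omega : m ≤ m + 3)), fun s =>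
    ⟨(hsl hΨs s).of_le h2le', fun x => ?_, fun x hx => ?_⟩⟩
  · have d1 := ((hsl hA' s).of_le h2le').differentiable two_ne_zero x
    have d2 := ((hsl r1 s).of_le h2le').differentiable two_ne_zero x
    have d3 := ((hsl a1 s).of_le h2le').differentiable two_ne_zero x
    simp only [hΨ]
    rw [slash_sub (f := fun y => A (s, y) - Qr.solve D (fun y => c₁ (s, y) • R (s, y)) y)
      (g := fun y => Qa.solve D (fun y => c₂ (s, y) • S (s, y)) y) (d1.sub d2) d3,
      slash_sub (f := fun y => A (s, y))
        (g := fun y => Qr.solve D (fun y => c₁ (s, y) • R (s, y)) y) d1 d2]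
    have e1 := hAR s x
    have e2 := r2 s x
    have e3 := a2 s x
    rw [pow_eq_max_pow_add (F.τ x - s) (by omega : m + 5 ≠ 0)] at e1
    simp only [hc₁, hc₂, hS] at e2 e3 ⊢
    rw [sub_eq_iff_eq_add] at e1 e2 e3
    rw [e1]
    erw [e2, e3]
    module
  · simp only [hΨ]
    rw [r3 s x, a3 s x]
    · rw [sub_zero, sub_zero, ← hx, hAG]
    · intro y hy
      rw [hQa, Set.mem_neg, neg_sub] at hy
      have := F.tau_le hy
      simp only [hc₂]
      rw [max_eq_right (by linarith), zero_pow (by omega)]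
    · intro y hy
      rw [hQr] at hy
      have := F.tau_le hy
      simp only [hc₁]
      rw [max_eq_right (by linarith), zero_pow (by omega)]

/-- The Cauchy problem is solvable, with smooth dependence on the hypersurface. -/
theorem exists_smooth_solution (D : DiracMatrices) {G : Minkowski → Spinor} (hG : ContDiff ℝ ∞ G)
    (hGc : HasCompactSupport G) :
    ∃ Ψ : ℝ × Minkowski → Spinor, ContDiff ℝ ∞ Ψ ∧
      ∀ s, IsDiracSolution D (fun y => Ψ (s, y)) ∧ ∀ x, F.τ x = s → Ψ (s, x) = G x := by
  choose Ψ h1 h2 using fun m => F.exists_solution_of_order (D := D) hG hGc m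
  -- The solutions of different orders have the same data, hence coincide; a single function is
  -- therefore of every finite order.
  have heq : ∀ m, Ψ m = Ψ 0 := by
    intro m
    funext ⟨s, x⟩
    have := eq_of_eqOn_slice (F := F) (D := D) (s := s) (h2 m s).1 (h2 m s).2.1 (h2 0 s).1
      (h2 0 s).2.1 fun y hy => by rw [(h2 m s).2.2 y hy, (h2 0 s).2.2 y hy]
    exact congrFun this x
  have hs : ContDiff ℝ ∞ (Ψ 0) := contDiff_infty.2 fun m => heq m ▸ h1 m
  exact ⟨Ψ 0, hs, fun s => ⟨⟨hs.comp (f := fun y : Minkowski => (s, y))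
    (contDiff_const.prodMk contDiff_id), (h2 0 s).2.1⟩, (h2 0 s).2.2⟩⟩

end CauchyFoliation

end

section

/-! ### The evolution of smooth compactly supported data -/

lemma IsDiracSolution.add {D : DiracMatrices} {ψ φ : Minkowski → Spinor}
    (hψ : IsDiracSolution D ψ) (hφ : IsDiracSolution D φ) :
    IsDiracSolution D fun x => ψ x + φ x := by
  refine ⟨hψ.1.add hφ.1, fun x => ?_⟩
  have h1 : slash D ψ x - ψ x = 0 := hψ.2 x
  have h2 : slash D φ x - φ x = 0 := hφ.2 x
  change slash D (fun x => ψ x + φ x) x - (ψ x + φ x) = 0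
  rw [slash_add (hψ.1.differentiable (by simp) x) (hφ.1.differentiable (by simp) x),
    sub_eq_zero.1 h1, sub_eq_zero.1 h2, sub_self]

lemma IsDiracSolution.const_smul {D : DiracMatrices} {ψ : Minkowski → Spinor}
    (hψ : IsDiracSolution D ψ) (c : ℂ) : IsDiracSolution D fun x => c • ψ x := by
  refine ⟨hψ.1.const_smul c, fun x => ?_⟩
  have h1 := hψ.2 x
  have h2 : ∀ a, pd a (fun x => c • ψ x) x = c • pd a ψ x := fun a => by
    rw [pd, fderiv_fun_const_smul (hψ.1.differentiable (by simp) x)]; rfl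
  simp only [h2, act, map_smul, smul_comm Complex.I c]
  rw [← Finset.smul_sum, ← smul_sub, h1, smul_zero]

namespace CauchyFoliation

variable {F : CauchyFoliation} {D : DiracMatrices} {s t : ℝ}

lemma IsDiracSolution.eq_of_eqOn_slice {ψ φ : Minkowski → Spinor} (hψ : IsDiracSolution D ψ)
    (hφ : IsDiracSolution D φ) (h : ∀ x : F.Slice s, ψ x = φ x) : ψ = φ :=
  CauchyFoliation.eq_of_eqOn_slice (F := F) (D := D) (s := s) (hψ.1.of_le (natCast_le_infty 2))
    hψ.2 (hφ.1.of_le (natCast_le_infty 2)) hφ.2 fun y hy => h ⟨y, hy⟩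

lemma isCompact_image_tsupport (f : F.TestSpinor s) : IsCompact (Subtype.val '' tsupport f.1) :=
  f.2.2.isCompact.image continuous_subtype_val

/-- A cutoff equal to 1 on the support of f does not change the restriction, since f vanishes
elsewhere on Σ_s. -/
lemma exists_compact_extension (f : F.TestSpinor s) :
    ∃ G : Minkowski → Spinor, ContDiff ℝ ∞ G ∧ HasCompactSupport G ∧
      ∀ x : F.Slice s, f.1 x = G x := by
  obtain ⟨⟨G, hG, hf⟩, -⟩ := f.2
  obtain ⟨χ, h1, h2, -, h4⟩ := exists_cutoff (isCompact_image_tsupport f) isOpen_univ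
    (Set.subset_univ _)
  refine ⟨fun x => χ x • G x, h1.smul hG, h2.smul_right, fun x => ?_⟩
  change f.1 x = χ x • G x
  by_cases hx : x ∈ tsupport f.1
  · rw [(h4 x.1 ⟨x, hx, rfl⟩).self_of_nhds, one_smul, hf]
  · have h0 : f.1 x = 0 := image_eq_zero_of_notMem_tsupport hx
    rw [h0]
    rw [hf] at h0
    rw [h0, smul_zero]

/-- Smooth compactly supported data on a Cauchy surface determine a solution of the Dirac
equation. -/
theorem existsUnique_solution (D : DiracMatrices) (f : F.TestSpinor s) :
    ∃! ψ : Minkowski → Spinor, IsDiracSolution D ψ ∧ ∀ x : F.Slice s, ψ x = f.1 x := by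
  obtain ⟨G, hG, hGc, hf⟩ := exists_compact_extension f
  obtain ⟨Ψ, -, h⟩ := F.exists_smooth_solution D hG hGc
  refine ⟨fun y => Ψ (s, y), ⟨(h s).1, fun x => ?_⟩, fun φ hφ => ?_⟩
  · change Ψ (s, x) = f.1 x
    rw [(h s).2 x.1 x.2, hf]
  · refine IsDiracSolution.eq_of_eqOn_slice (F := F) (s := s) hφ.1 (h s).1 fun x => ?_
    rw [hφ.2, (h s).2 x.1 x.2, hf]

/-- The solution of the Dirac equation with given data on a Cauchy surface. -/
def solution (D : DiracMatrices) (f : F.TestSpinor s) : Minkowski → Spinor :=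
  (existsUnique_solution D f).choose

lemma isDiracSolution_solution (f : F.TestSpinor s) : IsDiracSolution D (solution D f) :=
  (existsUnique_solution D f).choose_spec.1.1

lemma solution_apply (f : F.TestSpinor s) (x : F.Slice s) : solution D f x = f.1 x :=
  (existsUnique_solution D f).choose_spec.1.2 x

lemma eq_solution {f : F.TestSpinor s} {ψ : Minkowski → Spinor} (hψ : IsDiracSolution D ψ)
    (h : ∀ x : F.Slice s, ψ x = f.1 x) : ψ = solution D f :=
  (existsUnique_solution D f).choose_spec.2 ψ ⟨hψ, h⟩

lemma solution_eq_zero (f : F.TestSpinor s) {x : Minkowski}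
    (hx : ∀ y ∈ tsupport f.1, ¬ CausallyRelated x y.1) : solution D f x = 0 := by
  have h := isDiracSolution_solution (D := D) f
  refine eq_zero_of_not_causallyRelated (F := F) (D := D) (s := s)
    (h.1.of_le (natCast_le_infty 2)) h.2 (isCompact_image_tsupport f).isClosed
    (fun y hy hys => ?_) ?_
  · rw [solution_apply (D := D) f ⟨y, hys⟩]
    exact image_eq_zero_of_notMem_tsupport fun h => hy ⟨_, h, rfl⟩
  · rintro _ ⟨y, hy, rfl⟩ -
    exact hx y hy

lemma isCompact_preimage_slice {L : Set Minkowski} (hL : IsCompact L) :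
    IsCompact ((Subtype.val : F.Slice t → Minkowski) ⁻¹' L) :=
  (isClosed_eq F.smooth.continuous continuous_const).isClosedEmbedding_subtypeVal.isCompact_preimage
    hL

/-- The restriction of a solution with compactly supported data to another Cauchy surface. -/
def evolve (D : DiracMatrices) (t : ℝ) (f : F.TestSpinor s) : F.TestSpinor t :=
  ⟨fun x => solution D f x, ⟨solution D f, (isDiracSolution_solution f).1, fun _ => rfl⟩, by
    obtain ⟨L, hL, h⟩ := F.exists_isCompact_related (isCompact_image_tsupport f) t t
    refine HasCompactSupport.intro (isCompact_preimage_slice hL) fun x hx => ?_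
    refine solution_eq_zero f fun y hy hxy => hx ?_
    exact h y.1 ⟨y, hy, rfl⟩ x.1 hxy x.2.ge x.2.le⟩

lemma evolve_apply (f : F.TestSpinor s) (x : F.Slice t) : (evolve D t f).1 x = solution D f x :=
  rfl

lemma solution_evolve (f : F.TestSpinor s) : solution D (evolve D t f) = solution D f :=
  (eq_solution (isDiracSolution_solution f) fun _ => rfl).symm

lemma evolve_evolve (r : ℝ) (f : F.TestSpinor s) : evolve D t (evolve D r f) = evolve D t f := by
  apply Subtype.ext
  funext x
  rw [evolve_apply, solution_evolve, evolve_apply]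

lemma evolve_self (f : F.TestSpinor s) : evolve D s f = f :=
  Subtype.ext (funext fun x => solution_apply f x)

/-- The Dirac evolution of smooth compactly supported data between Cauchy surfaces. -/
def evolution (D : DiracMatrices) (F : CauchyFoliation) (t s : ℝ) :
    F.TestSpinor s ≃ₗ[ℂ] F.TestSpinor t where
  toFun := evolve D t
  map_add' f g := by
    apply Subtype.ext
    funext x
    have h := eq_solution (f := f + g) (ψ := fun x => solution D f x + solution D g x)
      ((isDiracSolution_solution f).add (isDiracSolution_solution g)) fun x => by
        rw [solution_apply, solution_apply]; rfl
    exact (congrFun h x).symm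
  map_smul' c f := by
    apply Subtype.ext
    funext x
    have h := eq_solution (f := c • f) (ψ := fun x => c • solution D f x)
      ((isDiracSolution_solution f).const_smul c) fun x => by
        rw [solution_apply]; rfl
    exact (congrFun h x).symm
  invFun := evolve D s
  left_inv f := by rw [evolve_evolve, evolve_self]
  right_inv f := by rw [evolve_evolve, evolve_self]

lemma evolution_apply (f : F.TestSpinor s) : evolution D F t s f = evolve D t f := rfl

/-- The set is the projection of a closed set along a compact factor. -/
lemma isClosed_related {K : Set Minkowski} (hK : IsCompact K) :
    IsClosed {x : Minkowski | ∃ y ∈ K, CausallyRelated x y} := by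
  have := isCompact_iff_compactSpace.1 hK
  have h := isClosedMap_fst_of_compactSpace _ (isClosed_causallyRelated.preimage
    (f := fun p : Minkowski × K => (p.1, p.2.1))
    (continuous_fst.prodMk (continuous_subtype_val.comp continuous_snd)))
  convert! h using 1
  ext x
  simp

/-- The points causally related to a closed subset of a Cauchy surface form a closed set. -/
lemma isClosed_related_slice (F : CauchyFoliation) {B : Set Minkowski} (hB : IsClosed B) (s : ℝ) :
    IsClosed {x : Minkowski | ∃ y ∈ B, F.τ y = s ∧ CausallyRelated x y} := by
  rw [← isOpen_compl_iff, isOpen_iff_mem_nhds]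
  intro x hx
  -- Points near x can be causally related only to a compact part of Σ_s, which reduces the claim to
  -- the compact case.
  obtain ⟨K, hK, hxK⟩ := exists_compact_mem_nhds x
  obtain ⟨L, hL, h⟩ := F.exists_isCompact_related hK s s
  have hK' : IsCompact (L ∩ (B ∩ {y | F.τ y = s})) :=
    hL.inter_right (hB.inter (isClosed_eq F.smooth.continuous continuous_const))
  have hx' : x ∉ {x : Minkowski | ∃ y ∈ L ∩ (B ∩ {y | F.τ y = s}), CausallyRelated x y} :=
    fun ⟨y, hy, hxy⟩ => hx ⟨y, hy.2.1, hy.2.2, hxy⟩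
  filter_upwards [hxK, (isClosed_related hK').isOpen_compl.mem_nhds hx'] with x' h1 h2
  rintro ⟨y, hyB, hys, hxy⟩
  refine h2 ⟨y, ⟨h x' h1 y ?_ hys.ge hys.le, hyB, hys⟩, hxy⟩
  rw [causallyRelated_iff] at hxy ⊢
  exact hxy.symm

/-- The solution vanishes at points unrelated to the support of f; as the related points form a
closed set, the inclusion passes to the topological support. -/
lemma evolve_causal (f : F.TestSpinor s) :
    ∀ x ∈ tsupport (evolve D t f).1, ∃ y ∈ tsupport f.1, CausallyRelated x.1 y.1 := by
  intro x hx
  have hcl := (isClosed_related (isCompact_image_tsupport f)).preimage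
    (continuous_subtype_val (p := fun x => F.τ x = t))
  have h : x.1 ∈ {x : Minkowski | ∃ y ∈ Subtype.val '' tsupport f.1, CausallyRelated x y} := by
    refine closure_minimal (fun x hx => ?_) hcl hx
    by_contra hne
    exact hx (solution_eq_zero f fun y hy hxy => hne ⟨y, ⟨y, hy, rfl⟩, hxy⟩)
  obtain ⟨_, ⟨y, hy, rfl⟩, hxy⟩ := h
  exact ⟨y, hy, hxy⟩

end CauchyFoliation

end

section

/-! ### Algebra of the Dirac matrices -/

namespace DiracMatrices

variable (D : DiracMatrices)

lemma gamma_zero_mul_self : D.γ 0 * D.γ 0 = 1 := by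
  have h := D.clifford 0 0
  rw [if_pos rfl, ← two_smul ℂ] at h
  have h2 := congrArg (fun X => (2 : ℂ)⁻¹ • X) h
  simpa [eta, smul_smul] using h2

lemma gamma_zero_isHermitian : (D.γ 0).conjTranspose = D.γ 0 := by
  simp [D.conjTranspose_eq, eta]

lemma gamma_zero_mul (a : Fin 4) : D.γ 0 * D.γ a = ((eta a : ℝ) : ℂ) • (D.γ a * D.γ 0) := by
  have h := D.clifford 0 a
  by_cases ha : a = 0
  · subst ha; simp [eta]
  · rw [if_neg (Ne.symm ha)] at h
    simp only [eta, if_neg ha]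
    push_cast
    rw [neg_smul, one_smul]
    exact eq_neg_of_add_eq_zero_left h

lemma conjTranspose_gamma (a : Fin 4) : (D.γ a).conjTranspose = D.γ 0 * D.γ a * D.γ 0 := by
  rw [D.conjTranspose_eq, D.gamma_zero_mul, Matrix.smul_mul, Matrix.mul_assoc,
    D.gamma_zero_mul_self, Matrix.mul_one]

/-- The matrices `αᵃ = γ⁰ γᵃ`. -/
def alpha (a : Fin 4) : Matrix (Fin 4) (Fin 4) ℂ := D.γ 0 * D.γ a

lemma alpha_isHermitian (a : Fin 4) : (D.alpha a).conjTranspose = D.alpha a := by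
  rw [alpha, Matrix.conjTranspose_mul, D.conjTranspose_gamma, D.gamma_zero_isHermitian,
    Matrix.mul_assoc, D.gamma_zero_mul_self, Matrix.mul_one]

end DiracMatrices

namespace CauchyFoliation

variable (D : DiracMatrices) (F : CauchyFoliation)

/-- The lapse function `(g^{ττ})^{-1/2}`. -/
def lapse (x : Minkowski) : ℝ := F.gInvTau x ^ (-(1 / 2) : ℝ)

lemma lapse_pos (x : Minkowski) : 0 < F.lapse x := Real.rpow_pos_of_pos (F.gInvTau_pos x) _

lemma lapse_sq (x : Minkowski) : F.lapse x ^ 2 = (F.gInvTau x)⁻¹ := by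
  rw [lapse, ← Real.rpow_natCast, ← Real.rpow_mul (F.gInvTau_pos x).le, ← Real.rpow_neg_one]
  norm_num

lemma lapse_sq_mul (x : Minkowski) : F.lapse x ^ 2 * F.gInvTau x = 1 := by
  rw [lapse_sq, inv_mul_cancel₀ (F.gInvTau_pos x).ne']

lemma normal_eq (a : Fin 4) (x : Minkowski) : F.normal a x = F.lapse x * pd a F.τ x := rfl

lemma normal_zero_pos (x : Minkowski) : 0 < F.normal 0 x :=
  mul_pos (F.lapse_pos x) (F.increasing x)

lemma gammaNormal_eq (x : Minkowski) :
    F.gammaNormal D x = ((F.lapse x : ℝ) : ℂ) • gradSlash D F.τ x := by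
  rw [gammaNormal, gradSlash, Finset.smul_sum]
  refine Finset.sum_congr rfl fun a _ => ?_
  rw [normal_eq, smul_smul, Complex.ofReal_mul]

lemma gammaNormal_mul_self (x : Minkowski) : F.gammaNormal D x * F.gammaNormal D x = 1 := by
  rw [gammaNormal_eq, Matrix.smul_mul, Matrix.mul_smul, gradSlash_mul_self, smul_smul, smul_smul]
  have : ((F.lapse x : ℝ) : ℂ) * (F.lapse x : ℝ) * ((∑ a, eta a * pd a F.τ x ^ 2 : ℝ) : ℂ)
      = ((F.lapse x ^ 2 * F.gInvTau x : ℝ) : ℂ) := by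
    rw [gInvTau]; push_cast; ring
  rw [this, lapse_sq_mul, Complex.ofReal_one, one_smul]

lemma gammaNormal_anticomm (x : Minkowski) :
    F.gammaNormal D x * D.γ 0 + D.γ 0 * F.gammaNormal D x = ((2 * F.normal 0 x : ℝ) : ℂ) • 1 := by
  rw [gammaNormal, Finset.sum_mul, Finset.mul_sum, ← Finset.sum_add_distrib,
    Finset.sum_eq_single 0]
  · rw [Matrix.smul_mul, Matrix.mul_smul, ← smul_add, D.clifford, if_pos rfl, smul_smul]
    congr 1
    simp [eta]; ring
  · intro b _ hb
    rw [Matrix.smul_mul, Matrix.mul_smul, ← smul_add, D.clifford, if_neg hb, smul_zero]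
  · simp

lemma conjTranspose_gammaNormal (x : Minkowski) :
    (F.gammaNormal D x).conjTranspose = D.γ 0 * F.gammaNormal D x * D.γ 0 := by
  rw [gammaNormal, Matrix.conjTranspose_sum, Finset.mul_sum, Finset.sum_mul]
  refine Finset.sum_congr rfl fun a _ => ?_
  rw [Matrix.conjTranspose_smul, D.conjTranspose_gamma, Matrix.mul_smul, Matrix.smul_mul]
  simp

/-- The adjoint of γ·n is γ⁰(γ·n)γ⁰, so (γ·n)γ⁰ is its own adjoint. -/
lemma boost_isHermitian (x : Minkowski) : (F.boost D x).conjTranspose = F.boost D x := by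
  rw [boost, Matrix.conjTranspose_smul, Matrix.conjTranspose_add, Matrix.conjTranspose_mul,
    Matrix.conjTranspose_one, conjTranspose_gammaNormal, D.gamma_zero_isHermitian,
    ← Matrix.mul_assoc, ← Matrix.mul_assoc, D.gamma_zero_mul_self, Matrix.one_mul]
  simp

/-- With N = γ·n and G = γ⁰ both of square 1, N(1 + NG) = N + G = (1 + NG)G. -/
lemma gammaNormal_mul_boost (x : Minkowski) :
    F.gammaNormal D x * F.boost D x = F.boost D x * D.γ 0 := by
  rw [boost, Matrix.mul_smul, Matrix.smul_mul]
  congr 1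
  rw [Matrix.mul_add, Matrix.add_mul, ← Matrix.mul_assoc, gammaNormal_mul_self, Matrix.mul_assoc,
    D.gamma_zero_mul_self, Matrix.mul_one, add_comm]

/-- Up to normalization the left side is (N + G)(1 + NG), which the anticommutator NG + GN = 2n₀
reduces to 2(1 + n₀)G. This explains the normalization of K and gives K⁻¹ = γ⁰Kγ⁰. -/
lemma boost_mul_gamma_mul_boost (x : Minkowski) :
    F.boost D x * D.γ 0 * F.boost D x = D.γ 0 := by
  rw [← gammaNormal_mul_boost]
  set N := F.gammaNormal D x
  set G := D.γ 0
  have hN : N * N = 1 := F.gammaNormal_mul_self D x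
  have hG : G * G = 1 := D.gamma_zero_mul_self
  have hNG : N * G + G * N = ((2 * F.normal 0 x : ℝ) : ℂ) • 1 := F.gammaNormal_anticomm D x
  have h0 := F.normal_zero_pos x
  set c : ℝ := (2 * (1 + F.normal 0 x)) ^ (-(1 / 2) : ℝ) with hc
  have hc2 : c * c * (2 * (1 + F.normal 0 x)) = 1 := by
    rw [hc, ← Real.rpow_add (by linarith), ← Real.rpow_add_one (by linarith)]
    norm_num
  have hb : F.boost D x = (c : ℂ) • (1 + N * G) := rfl
  rw [hb, Matrix.mul_smul, Matrix.mul_smul, Matrix.smul_mul, smul_smul]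
  have e : N * (1 + N * G) * (1 + N * G) = ((2 * (1 + F.normal 0 x) : ℝ) : ℂ) • G := by
    have e1 : N * (1 + N * G) = N + G := by
      rw [Matrix.mul_add, ← Matrix.mul_assoc, hN, Matrix.mul_one, Matrix.one_mul]
    have e2 : G * N = ((2 * F.normal 0 x : ℝ) : ℂ) • 1 - N * G := eq_sub_of_add_eq' hNG
    rw [e1, Matrix.add_mul, Matrix.mul_add, Matrix.mul_add, ← Matrix.mul_assoc, hN,
      ← Matrix.mul_assoc, e2, Matrix.sub_mul, Matrix.mul_assoc N, hG, Matrix.mul_one,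
      Matrix.mul_one, Matrix.one_mul, Matrix.smul_mul, Matrix.one_mul]
    push_cast
    module
  rw [e, smul_smul]
  have : (c : ℂ) * c * ((2 * (1 + F.normal 0 x) : ℝ) : ℂ) = 1 := by
    exact_mod_cast hc2
  rw [this, one_smul]

lemma boost_mul_inv (x : Minkowski) :
    F.boost D x * (D.γ 0 * F.boost D x * D.γ 0) = 1 := by
  rw [← Matrix.mul_assoc, ← Matrix.mul_assoc, boost_mul_gamma_mul_boost, D.gamma_zero_mul_self]

lemma boost_inv (x : Minkowski) : (F.boost D x)⁻¹ = D.γ 0 * F.boost D x * D.γ 0 :=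
  Matrix.inv_eq_right_inv (F.boost_mul_inv D x)

lemma fluxMatrix_eq (x : Minkowski) :
    F.fluxMatrix D x = (((F.normal 0 x)⁻¹ : ℝ) : ℂ) • (D.γ 0 * F.gammaNormal D x) := by
  rw [fluxMatrix, gammaNormal, Finset.mul_sum, Finset.smul_sum]
  refine Finset.sum_congr rfl fun a _ => ?_
  rw [Matrix.mul_smul, smul_smul, ← Complex.ofReal_mul]
  congr 2
  have := F.increasing x
  have := F.lapse_pos x
  rw [conormal, normal_eq, normal_eq]
  field_simp

/-- The flux form is positive but depends on the normal. Moving γ·n through K with the intertwining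
relation leaves Kγ⁰Kγ⁰ = 1, so K reduces the form to a scalar. -/
lemma boost_mul_flux_mul_boost (x : Minkowski) :
    F.boost D x * F.fluxMatrix D x * F.boost D x = (((F.normal 0 x)⁻¹ : ℝ) : ℂ) • 1 := by
  rw [fluxMatrix_eq, Matrix.mul_smul, Matrix.smul_mul, Matrix.mul_assoc, Matrix.mul_assoc,
    gammaNormal_mul_boost, ← Matrix.mul_assoc (D.γ 0), ← Matrix.mul_assoc, ← Matrix.mul_assoc,
    boost_mul_gamma_mul_boost, D.gamma_zero_mul_self]

end CauchyFoliation

/-! ### Jacobians of adapted coordinates -/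

namespace AdaptedCoordinates

variable (D : DiracMatrices) {F : CauchyFoliation} (C : AdaptedCoordinates F)

/-- The Jacobian matrix `∂ξ^μ/∂xᵃ`. -/
def jac (x : Minkowski) : Matrix (Fin 4) (Fin 4) ℝ := Matrix.of fun μ a => pd a C.ξ x μ

/-- The Jacobian matrix `∂xᵃ/∂ξ^μ`. -/
def jacInv (x : Minkowski) : Matrix (Fin 4) (Fin 4) ℝ :=
  Matrix.of fun a μ => pd μ C.ξ.symm (C.ξ x) a

lemma toMatrix'_fderiv {n m : ℕ} (f : (Fin n → ℝ) → (Fin m → ℝ)) (x : Fin n → ℝ) :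
    LinearMap.toMatrix' (fderiv ℝ f x : (Fin n → ℝ) →ₗ[ℝ] (Fin m → ℝ)) =
      Matrix.of fun i j => pd j f x i := by
  ext i j
  rw [LinearMap.toMatrix'_apply]
  rfl

lemma fderiv_comp_symm (x : Minkowski) :
    (fderiv ℝ C.ξ x).comp (fderiv ℝ C.ξ.symm (C.ξ x)) = ContinuousLinearMap.id ℝ _ := by
  have h1 : HasFDerivAt C.ξ (fderiv ℝ C.ξ x) (C.ξ.symm (C.ξ x)) := by
    rw [C.ξ.symm_apply_apply]
    exact (C.smooth.differentiable (by simp) x).hasFDerivAt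
  have h2 : HasFDerivAt C.ξ.symm (fderiv ℝ C.ξ.symm (C.ξ x)) (C.ξ x) :=
    (C.smooth_symm.differentiable (by simp) _).hasFDerivAt
  have h3 := h1.comp (C.ξ x) h2
  have h4 : C.ξ ∘ C.ξ.symm = id := funext fun y => C.ξ.apply_symm_apply y
  rw [h4] at h3
  exact h3.unique (hasFDerivAt_id _)

lemma jac_mul_jacInv (x : Minkowski) : C.jac x * C.jacInv x = 1 := by
  rw [jac, jacInv, ← toMatrix'_fderiv, ← toMatrix'_fderiv, ← LinearMap.toMatrix'_comp,
    ← ContinuousLinearMap.toLinearMap_comp, fderiv_comp_symm]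
  exact LinearMap.toMatrix'_id

lemma jacInv_mul_jac (x : Minkowski) : C.jacInv x * C.jac x = 1 :=
  mul_eq_one_comm.1 (C.jac_mul_jacInv x)

lemma det_jac_mul (x : Minkowski) : (C.jac x).det * (C.jacInv x).det = 1 := by
  rw [← Matrix.det_mul, jac_mul_jacInv, Matrix.det_one]

lemma det_jac_ne_zero (x : Minkowski) : (C.jac x).det ≠ 0 :=
  left_ne_zero_of_mul_eq_one (C.det_jac_mul x)

lemma det_jacInv_ne_zero (x : Minkowski) : (C.jacInv x).det ≠ 0 :=
  right_ne_zero_of_mul_eq_one (C.det_jac_mul x)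

lemma pd_coord (a μ : Fin 4) (x : Minkowski) : pd a C.ξ x μ = pd a (fun y => C.ξ y μ) x :=
  (pd_clm (ContinuousLinearMap.proj (R := ℝ) (φ := fun _ : Fin 4 => ℝ) μ)
    (C.smooth.differentiable (by simp) x) a).symm

lemma jac_zero (a : Fin 4) (x : Minkowski) : C.jac x 0 a = pd a F.τ x := by
  have : (fun y => C.ξ y 0) = F.τ := funext C.time_eq
  rw [jac, Matrix.of_apply, pd_coord, this]

/-- By Cramer's rule the spatial minor of the metric is its determinant times the component g^{ττ}
of the inverse; the determinant is -(det ∂x/∂ξ)². -/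
lemma gz_eq (x : Minkowski) : C.gz x = -((C.jacInv x).det ^ 2 * F.gInvTau x) := by
  set B := C.jacInv x with hB
  set A := C.jac x with hA
  set E : Matrix (Fin 4) (Fin 4) ℝ := Matrix.diagonal eta with hE
  have hEE : E * E = 1 := by
    rw [hE, Matrix.diagonal_mul_diagonal, ← Matrix.diagonal_one]
    congr 1
    funext a
    simp only [eta]
    split_ifs <;> norm_num
  have hdE : E.det = -1 := by
    rw [hE, Matrix.det_diagonal, Fin.prod_univ_four]
    simp [eta]
  have hg : Matrix.of (C.metric x) = B.transpose * E * B := by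
    ext μ ν
    rw [Matrix.of_apply, metric, Matrix.mul_apply]
    refine Finset.sum_congr rfl fun a _ => ?_
    rw [hE, Matrix.mul_diagonal, Matrix.transpose_apply, hB, jacInv, Matrix.of_apply,
      Matrix.of_apply]
    ring
  have hinv : Matrix.of (C.metric x) * (A * E * A.transpose) = 1 := by
    rw [hg]
    calc B.transpose * E * B * (A * E * A.transpose)
        = B.transpose * E * (B * A) * E * A.transpose := by simp only [Matrix.mul_assoc]
      _ = B.transpose * (E * E) * A.transpose := by
          rw [hB, hA, jacInv_mul_jac, Matrix.mul_one, Matrix.mul_assoc B.transpose]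
      _ = (A * B).transpose := by rw [hEE, Matrix.mul_one, Matrix.transpose_mul]
      _ = 1 := by rw [hA, hB, jac_mul_jacInv, Matrix.transpose_one]
  have hdet : (Matrix.of (C.metric x)).det = -(B.det ^ 2) := by
    rw [hg, Matrix.det_mul, Matrix.det_mul, Matrix.det_transpose, hdE]; ring
  have hadj : (Matrix.of (C.metric x)).adjugate = (Matrix.of (C.metric x)).det •
      (A * E * A.transpose) := by
    calc (Matrix.of (C.metric x)).adjugate
        = (Matrix.of (C.metric x)).adjugate * (Matrix.of (C.metric x) * (A * E * A.transpose)) := by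
          rw [hinv, Matrix.mul_one]
      _ = _ := by rw [← Matrix.mul_assoc, Matrix.adjugate_mul, Matrix.smul_mul, Matrix.one_mul]
  have h00 := congrFun (congrFun hadj 0) 0
  rw [Matrix.adjugate_fin_succ_eq_det_submatrix] at h00
  simp only [Fin.val_zero, add_zero, pow_zero, one_mul, Fin.succAbove_zero] at h00
  have hgz : C.gz x = ((Matrix.of (C.metric x)).submatrix Fin.succ Fin.succ).det := rfl
  rw [hgz, h00, Matrix.smul_apply, hdet, smul_eq_mul, neg_mul]
  congr 2
  rw [Matrix.mul_apply, CauchyFoliation.gInvTau]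
  refine Finset.sum_congr rfl fun a _ => ?_
  rw [hE, Matrix.mul_diagonal, Matrix.transpose_apply, hA, jac_zero]
  ring

lemma abs_gz (x : Minkowski) : |C.gz x| = (C.jacInv x).det ^ 2 * F.gInvTau x := by
  rw [gz_eq, abs_neg, abs_of_nonneg (mul_nonneg (sq_nonneg _) (F.gInvTau_pos x).le)]

lemma abs_gz_pos (x : Minkowski) : 0 < |C.gz x| := by
  rw [abs_gz]
  exact mul_pos (sq_pos_of_ne_zero (C.det_jacInv_ne_zero x)) (F.gInvTau_pos x)

/-- The scalar factor `|g_z|^{-1/4}` of the transfer matrix. -/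
def weight (x : Minkowski) : ℝ := |C.gz x| ^ (-(1 / 4) : ℝ)

lemma weight_pos (x : Minkowski) : 0 < C.weight x := Real.rpow_pos_of_pos (C.abs_gz_pos x) _

/-- In terms of Jacobians, |g_z|^{-1/2} = |det ∂ξ/∂x| (g^{ττ})^{-1/2}. -/
lemma weight_sq (x : Minkowski) : C.weight x ^ 2 = |(C.jac x).det| * F.lapse x := by
  have h1 : C.weight x ^ 2 = |C.gz x| ^ (-(1 / 2) : ℝ) := by
    rw [weight, ← Real.rpow_natCast, ← Real.rpow_mul (abs_nonneg _)]
    norm_num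
  have h2 : (C.jacInv x).det = (C.jac x).det⁻¹ := eq_inv_of_mul_eq_one_right (C.det_jac_mul x)
  have h3 : 0 < |(C.jac x).det| := abs_pos.2 (C.det_jac_ne_zero x)
  rw [h1, abs_gz, Real.mul_rpow (sq_nonneg _) (F.gInvTau_pos x).le, CauchyFoliation.lapse, h2]
  congr 1
  rw [← sq_abs, ← Real.rpow_natCast, ← Real.rpow_mul (abs_nonneg _), abs_inv]
  norm_num
  rw [Real.rpow_neg_one, inv_inv]

lemma transfer_eq (x : Minkowski) : C.transfer D x = ((C.weight x : ℝ) : ℂ) • F.boost D x := rfl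

lemma flux_transfer (x : Minkowski) (v w : Spinor) :
    F.flux D x (act (C.transfer D x) v) (act (C.transfer D x) w)
      = ((|(C.jac x).det| / pd 0 F.τ x : ℝ) : ℂ) * inner ℂ v w := by
  have hT : (C.transfer D x).IsHermitian := by
    rw [Matrix.IsHermitian, transfer_eq, Matrix.conjTranspose_smul, F.boost_isHermitian]
    simp
  have e : C.transfer D x * F.fluxMatrix D x * C.transfer D x
      = ((|(C.jac x).det| / pd 0 F.τ x : ℝ) : ℂ) • 1 := by
    rw [transfer_eq, Matrix.smul_mul, Matrix.smul_mul, Matrix.mul_smul,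
      F.boost_mul_flux_mul_boost, smul_smul, smul_smul, ← Complex.ofReal_mul,
      ← Complex.ofReal_mul]
    congr 2
    have h1 := C.weight_sq x
    have h2 := (F.lapse_pos x).ne'
    have h3 := (F.increasing x).ne'
    rw [← sq, h1, F.normal_eq]
    field_simp
  rw [CauchyFoliation.flux, CauchyFoliation.inner_act_left hT, act_act, act_act,
    e, ← smul_act, act_one, inner_smul_right]

lemma transfer_mul_inv (x : Minkowski) :
    C.transfer D x * (((C.weight x)⁻¹ : ℝ) : ℂ) • (D.γ 0 * F.boost D x * D.γ 0) = 1 := by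
  rw [transfer_eq, Matrix.smul_mul, Matrix.mul_smul, F.boost_mul_inv, smul_smul,
    ← Complex.ofReal_mul, mul_inv_cancel₀ (C.weight_pos x).ne', Complex.ofReal_one, one_smul]

/-- The inverse of the transfer matrix. -/
def transferInv (x : Minkowski) : Matrix (Fin 4) (Fin 4) ℂ :=
  (((C.weight x)⁻¹ : ℝ) : ℂ) • (D.γ 0 * F.boost D x * D.γ 0)

lemma transfer_mul_transferInv (x : Minkowski) : C.transfer D x * C.transferInv D x = 1 :=
  C.transfer_mul_inv D x

lemma transferInv_mul_transfer (x : Minkowski) : C.transferInv D x * C.transfer D x = 1 :=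
  mul_eq_one_comm.1 (C.transfer_mul_inv D x)

/-! ### Smoothness -/

lemma contDiff_det {E : Type*} [NormedAddCommGroup E] [NormedSpace ℝ E] {n : ℕ}
    {k : WithTop ℕ∞} {M : E → Matrix (Fin n) (Fin n) ℝ} (h : ∀ i j, ContDiff ℝ k fun x => M x i j) :
    ContDiff ℝ k fun x => (M x).det := by
  simp only [Matrix.det_apply']
  exact ContDiff.sum fun σ _ => contDiff_const.mul (contDiff_prod fun i _ => h _ _)

lemma contDiff_jac (μ a : Fin 4) : ContDiff ℝ ∞ fun x => C.jac x μ a :=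
  contDiff_pi.1 (contDiff_pd C.smooth (by simp) a) μ

lemma contDiff_det_jac : ContDiff ℝ ∞ fun x => (C.jac x).det := contDiff_det C.contDiff_jac

lemma contDiff_weight : ContDiff ℝ ∞ C.weight := by
  have h : C.weight = fun x => ((C.jacInv x).det ^ 2 * F.gInvTau x) ^ (-(1 / 4) : ℝ) := by
    funext x
    rw [weight, abs_gz]
  rw [h]
  have h2 : ∀ x, (C.jacInv x).det ^ 2 * F.gInvTau x = ((C.jac x).det ^ 2)⁻¹ * F.gInvTau x := by
    intro x
    rw [eq_inv_of_mul_eq_one_right (C.det_jac_mul x), inv_pow]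
  simp only [h2]
  refine ContDiff.rpow_const_of_ne (((C.contDiff_det_jac.pow 2).inv fun x => ?_).mul
    F.contDiff_gInvTau) fun x => ?_
  · exact pow_ne_zero 2 (C.det_jac_ne_zero x)
  · rw [← h2, ← abs_gz]
    exact (C.abs_gz_pos x).ne'

end AdaptedCoordinates

namespace CauchyFoliation

variable (D : DiracMatrices) (F : CauchyFoliation)

lemma contDiff_lapse : ContDiff ℝ ∞ F.lapse :=
  F.contDiff_gInvTau.rpow_const_of_ne fun x => (F.gInvTau_pos x).ne'

lemma contDiff_normal (a : Fin 4) : ContDiff ℝ ∞ (F.normal a) :=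
  F.contDiff_lapse.mul (contDiff_pd F.smooth (by simp) a)

/-! ### Differentiability of matrix functions. -/

section MatrixCalculus

attribute [local instance] Matrix.linftyOpNormedRing Matrix.linftyOpNormedAlgebra

lemma contDiff_gammaNormal : ContDiff ℝ ∞ (F.gammaNormal D) := by
  unfold gammaNormal
  simp only [Complex.coe_smul]
  exact ContDiff.sum fun a _ => (F.contDiff_normal a).smul contDiff_const

lemma contDiff_boost : ContDiff ℝ ∞ (F.boost D) := by
  have h : F.boost D = fun x => (2 * (1 + F.normal 0 x)) ^ (-(1 / 2) : ℝ) •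
      (1 + F.gammaNormal D x * D.γ 0) := funext fun x => Complex.coe_smul _ _
  rw [h]
  refine ContDiff.smul (ContDiff.rpow_const_of_ne (contDiff_const.mul (contDiff_const.add
    (F.contDiff_normal 0))) fun x => ?_) (contDiff_const.add ((F.contDiff_gammaNormal D).mul
    contDiff_const))
  have := F.normal_zero_pos x
  positivity

/-- The action of matrices on spinors, as a real bilinear map. -/
def actCLM : Matrix (Fin 4) (Fin 4) ℂ →L[ℝ] Spinor →L[ℝ] Spinor :=
  LinearMap.toContinuousLinearMap
    { toFun := actL
      map_add' := fun A B => by ext1 v; exact act_add_matrix A B v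
      map_smul' := fun c A => by
        ext1 v
        simp only [actL_apply, RingHom.id_apply, smul_apply]
        rw [← Complex.coe_smul c, ← smul_act, Complex.coe_smul] }

lemma actCLM_apply (A : Matrix (Fin 4) (Fin 4) ℂ) (v : Spinor) : actCLM A v = act A v := rfl

lemma contDiff_act {E : Type*} [NormedAddCommGroup E] [NormedSpace ℝ E] {k : WithTop ℕ∞}
    {M : E → Matrix (Fin 4) (Fin 4) ℂ} {v : E → Spinor} (hM : ContDiff ℝ k M)
    (hv : ContDiff ℝ k v) : ContDiff ℝ k fun x => act (M x) (v x) :=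
  (actCLM.contDiff.comp hM).clm_apply hv

lemma pd_act {n : ℕ} {M : (Fin n → ℝ) → Matrix (Fin 4) (Fin 4) ℂ} {v : (Fin n → ℝ) → Spinor}
    {x : Fin n → ℝ} (hM : DifferentiableAt ℝ M x) (hv : DifferentiableAt ℝ v x) (a : Fin n) :
    pd a (fun y => act (M y) (v y)) x = act (M x) (pd a v x) + act (pd a M x) (v x) := by
  have h := ((actCLM.hasFDerivAt.comp x hM.hasFDerivAt).clm_apply hv.hasFDerivAt).fderiv
  change fderiv ℝ (fun y => (actCLM ∘ M) y (v y)) x _ = _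
  rw [h]
  simp only [pd, add_apply, ContinuousLinearMap.comp_apply, ContinuousLinearMap.flip_apply,
    Function.comp_apply, actCLM_apply]
  rfl

lemma pd_mul {n : ℕ} {M N : (Fin n → ℝ) → Matrix (Fin 4) (Fin 4) ℂ}
    {x : Fin n → ℝ} (hM : DifferentiableAt ℝ M x) (hN : DifferentiableAt ℝ N x) (a : Fin n) :
    pd a (fun y => M y * N y) x = M x * pd a N x + pd a M x * N x := by
  rw [pd, fderiv_fun_mul' hM hN]
  simp [pd]

lemma pd_conjTranspose {n : ℕ} {M : (Fin n → ℝ) → Matrix (Fin 4) (Fin 4) ℂ}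
    {x : Fin n → ℝ} (hM : DifferentiableAt ℝ M x) (a : Fin n) :
    pd a (fun y => (M y).conjTranspose) x = (pd a M x).conjTranspose :=
  pd_clm (LinearMap.toContinuousLinearMap
    { toFun := Matrix.conjTranspose
      map_add' := Matrix.conjTranspose_add
      map_smul' := fun c A => by simp [Matrix.conjTranspose_smul] }) hM a

end MatrixCalculus

end CauchyFoliation

end

section

/-! ### The canonical coordinates and the measure on a Cauchy surface -/

namespace CauchyFoliation

variable (F : CauchyFoliation)

/-- The Cauchy surfaces are graphs over `ℝ³`. -/
lemma existsUnique_slice (s : ℝ) (y : Space) :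
    ∃! x : Minkowski, F.τ x = s ∧ ∀ i : Fin 3, x i.succ = y i := by
  -- The line of velocity zero over y meets Σ_s; two intersections would be causally related points
  -- with equal τ, contradicting strict monotonicity.
  obtain ⟨r, hr⟩ := F.exists_tau_eq_on_ray (Fin.cons 0 y) (v := 0) (by simp [velocities]) s
  refine ⟨_, ⟨hr, fun i => by simp [ray]⟩, ?_⟩
  have key : ∀ x x' : Minkowski, F.τ x = s → F.τ x' = s → (∀ i : Fin 3, x i.succ = x' i.succ) →
      x 0 ≤ x' 0 → x = x' := by
    intro x x' h h' hi h0
    by_contra hne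
    refine (F.tau_lt (x := x) (y := x') ⟨by simpa using h0, ?_⟩ hne).ne (h.trans h'.symm)
    simp only [Pi.sub_apply, hi, sub_self]
    simp [sq_nonneg]
  rintro x ⟨hx, hxi⟩
  have hi : ∀ i : Fin 3, x i.succ =
      ((Fin.cons 0 y : Minkowski) + r • ray 0 : Minkowski) i.succ := fun i => by
    rw [hxi]; simp [ray]
  rcases le_total (x 0) (((Fin.cons 0 y : Minkowski) + r • ray 0 : Minkowski) 0) with h | h
  · exact key _ _ hx hr hi h
  · exact (key _ _ hr hx (fun i => (hi i).symm) h).symm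

/-- The map `x ↦ (τ(x), 𝐱)`. -/
def graphMap (x : Minkowski) : Fin 4 → ℝ := Fin.cons (F.τ x) fun i : Fin 3 => x i.succ

lemma contDiff_graphMap : ContDiff ℝ ∞ F.graphMap := by
  refine contDiff_pi.2 fun a => ?_
  refine Fin.cases ?_ (fun i => ?_) a
  · exact F.smooth
  · exact contDiff_apply ℝ ℝ i.succ

lemma graphMap_bijective : Function.Bijective F.graphMap := by
  constructor
  · intro x x' h
    have h0 : F.τ x = F.τ x' := congrFun h 0
    have hi : ∀ i : Fin 3, x i.succ = x' i.succ := fun i => congrFun h i.succ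
    exact (F.existsUnique_slice (F.τ x') fun i => x' i.succ).unique ⟨h0, hi⟩ ⟨rfl, fun _ => rfl⟩
  · intro y
    obtain ⟨x, ⟨h0, hi⟩, -⟩ := F.existsUnique_slice (y 0) fun i => y i.succ
    refine ⟨x, funext fun a => ?_⟩
    refine Fin.cases ?_ (fun i => ?_) a
    · exact h0
    · exact hi i

lemma fderiv_graphMap_apply (x v : Minkowski) :
    fderiv ℝ F.graphMap x v = Fin.cons (fderiv ℝ F.τ x v) fun i : Fin 3 => v i.succ := by
  have hd := F.contDiff_graphMap.differentiable (by simp) x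
  funext a
  have h1 := (hasFDerivAt_pi'.1 hd.hasFDerivAt a).fderiv
  have h2 : fderiv ℝ F.graphMap x v a = fderiv ℝ (fun y => F.graphMap y a) x v := by
    rw [h1]; rfl
  rw [h2]
  refine Fin.cases ?_ (fun i => ?_) a
  · rfl
  · change fderiv ℝ (fun y : Minkowski => y i.succ) x v = v i.succ
    have h := (ContinuousLinearMap.proj (R := ℝ) (φ := fun _ : Fin 4 => ℝ) i.succ).hasFDerivAt
      (x := x) |>.fderiv
    exact congrArg (fun L : Minkowski →L[ℝ] ℝ => L v) h

/-- The derivative of the map `x ↦ (τ(x), 𝐱)`. -/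
def graphDeriv (x : Minkowski) : Minkowski ≃L[ℝ] (Fin 4 → ℝ) :=
  (LinearEquiv.ofInjectiveEndo (fderiv ℝ F.graphMap x : Minkowski →ₗ[ℝ] Minkowski) (by
    rw [← LinearMap.ker_eq_bot, LinearMap.ker_eq_bot']
    intro v hv
    have hv' : fderiv ℝ F.graphMap x v = 0 := hv
    rw [fderiv_graphMap_apply] at hv'
    have hi : ∀ i : Fin 3, v i.succ = 0 := fun i => congrFun hv' i.succ
    have h0 : fderiv ℝ F.τ x v = 0 := congrFun hv' 0
    rw [fderiv_apply_eq_sum, Fin.sum_univ_succ] at h0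
    rw [Finset.sum_eq_zero fun i _ => by rw [hi, zero_smul], add_zero, smul_eq_mul] at h0
    funext a
    exact Fin.cases ((mul_eq_zero.1 h0).resolve_right (F.increasing x).ne') hi a)).toContinuousLinearEquiv

lemma hasStrictFDerivAt_graphMap (x : Minkowski) :
    HasStrictFDerivAt F.graphMap (F.graphDeriv x : Minkowski →L[ℝ] (Fin 4 → ℝ)) x := by
  have h := F.contDiff_graphMap.contDiffAt.hasStrictFDerivAt (x := x) (by simp)
  have e : (F.graphDeriv x : Minkowski →L[ℝ] (Fin 4 → ℝ)) = fderiv ℝ F.graphMap x := by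
    ext1 v; rfl
  rw [e]
  exact h

/-- The coordinates `(τ, x¹, x², x³)`. -/
def canonicalCoordinates : AdaptedCoordinates F where
  ξ := Equiv.ofBijective F.graphMap F.graphMap_bijective
  smooth := F.contDiff_graphMap
  smooth_symm := ((Equiv.ofBijective F.graphMap F.graphMap_bijective).toHomeomorphOfContinuousOpen
    F.contDiff_graphMap.continuous (isOpenMap_of_hasStrictFDerivAt_equiv
      F.hasStrictFDerivAt_graphMap)).contDiff_symm
      (fun x => (F.hasStrictFDerivAt_graphMap x).hasFDerivAt) F.contDiff_graphMap
  time_eq _ := rfl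

end CauchyFoliation

namespace AdaptedCoordinates

variable {D : DiracMatrices} {F : CauchyFoliation} (C : AdaptedCoordinates F)

lemma tau_point (s : ℝ) (z : Space) : F.τ (C.point s z) = s := by
  rw [← C.time_eq, point, Equiv.apply_symm_apply, Fin.cons_zero]

lemma space_point (s : ℝ) (z : Space) : C.space (C.point s z) = z := by
  funext i
  rw [space, point, Equiv.apply_symm_apply, Fin.cons_succ]

lemma point_space {s : ℝ} {x : Minkowski} (hx : F.τ x = s) : C.point s (C.space x) = x := by
  rw [point, Equiv.symm_apply_eq]
  funext a
  refine Fin.cases ?_ (fun i => ?_) a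
  · rw [Fin.cons_zero, C.time_eq, hx]
  · rfl

lemma contDiff_space : ContDiff ℝ ∞ C.space :=
  contDiff_pi.2 fun i => contDiff_pi.1 C.smooth i.succ

lemma contDiff_point : ContDiff ℝ ∞ fun p : ℝ × Space => C.point p.1 p.2 := by
  refine C.smooth_symm.comp (contDiff_pi.2 fun a => ?_)
  refine Fin.cases ?_ (fun i => ?_) a
  · exact contDiff_fst
  · exact (contDiff_apply ℝ ℝ i).comp contDiff_snd

lemma contDiff_point_right (s : ℝ) : ContDiff ℝ ∞ (C.point s) :=
  C.contDiff_point.comp (contDiff_const.prodMk contDiff_id)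

/-- The coordinates `(z¹, z², z³)` identify `Σ_s` with `ℝ³`. -/
def sliceHomeo (s : ℝ) : F.Slice s ≃ₜ Space where
  toFun x := C.space x.1
  invFun z := ⟨C.point s z, C.tau_point s z⟩
  left_inv x := Subtype.ext (C.point_space x.2)
  right_inv z := C.space_point s z
  continuous_toFun := C.contDiff_space.continuous.comp continuous_subtype_val
  continuous_invFun := (C.contDiff_point_right s).continuous.subtype_mk _

lemma pd_point (i : Fin 3) (s : ℝ) (z : Space) (a : Fin 4) :
    pd i (C.point s) z a = C.jacInv (C.point s z) a i.succ := by
  have hl : HasFDerivAt (fun z : Space => (Fin.cons s z : Fin 4 → ℝ))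
      (ContinuousLinearMap.pi (Fin.cons 0 fun i : Fin 3 =>
        ContinuousLinearMap.proj (R := ℝ) (φ := fun _ : Fin 3 => ℝ) i)) z := by
    refine hasFDerivAt_pi.2 fun a => ?_
    refine Fin.cases ?_ (fun i => ?_) a
    · exact hasFDerivAt_const s z
    · exact (ContinuousLinearMap.proj (R := ℝ) (φ := fun _ : Fin 3 => ℝ) i).hasFDerivAt
  have h := ((C.smooth_symm.differentiable (by simp) (Fin.cons s z)).hasFDerivAt.comp z hl).fderiv
  change fderiv ℝ (C.ξ.symm ∘ fun z : Space => (Fin.cons s z : Fin 4 → ℝ)) z _ _ = _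
  rw [h, jacInv, Matrix.of_apply, point, Equiv.apply_symm_apply, pd]
  simp only [ContinuousLinearMap.comp_apply]
  refine congrArg (fun v => fderiv ℝ C.ξ.symm (Fin.cons s z) v a) ?_
  funext b
  refine Fin.cases ?_ (fun j => ?_) b
  · simp
  · simp [Pi.single_apply]

/-- The parametrization of `ℝ³` by the coordinates `(z¹, z², z³)` on `Σ_s`. -/
def spatial (s : ℝ) (z : Space) : Space := fun i => C.point s z i.succ

lemma contDiff_spatial (s : ℝ) : ContDiff ℝ ∞ (C.spatial s) :=
  contDiff_pi.2 fun i => contDiff_pi.1 (C.contDiff_point_right s) i.succ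

/-- The derivative of z ↦ 𝐱 is the spatial minor of ∂x/∂ξ, which Cramer's rule expresses through the
determinant and the entry ∂₀τ of the inverse matrix. -/
lemma det_fderiv_spatial (s : ℝ) (z : Space) :
    (fderiv ℝ (C.spatial s) z).det
      = (C.jacInv (C.point s z)).det * pd 0 F.τ (C.point s z) := by
  set x := C.point s z with hx
  have h1 : (fderiv ℝ (C.spatial s) z).det
      = ((C.jacInv x).submatrix Fin.succ Fin.succ).det := by
    rw [ContinuousLinearMap.det, ← LinearMap.det_toMatrix', toMatrix'_fderiv]
    congr 1
    ext i j
    rw [Matrix.of_apply, Matrix.submatrix_apply, hx, ← C.pd_point j s z i.succ]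
    have h := pd_clm (ContinuousLinearMap.proj (R := ℝ) (φ := fun _ : Fin 3 => ℝ) i)
      ((C.contDiff_spatial s).differentiable (by simp) z) j
    have h' := pd_clm (ContinuousLinearMap.proj (R := ℝ) (φ := fun _ : Fin 4 => ℝ) i.succ)
      ((C.contDiff_point_right s).differentiable (by simp) z) j
    exact h.symm.trans h'
  have h2 : (C.jacInv x).adjugate = (C.jacInv x).det • C.jac x := by
    calc (C.jacInv x).adjugate
        = (C.jacInv x).adjugate * (C.jacInv x * C.jac x) := by
          rw [jacInv_mul_jac, Matrix.mul_one]
      _ = _ := by rw [← Matrix.mul_assoc, Matrix.adjugate_mul, Matrix.smul_mul, Matrix.one_mul]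
  have h3 := congrFun (congrFun h2 0) 0
  rw [Matrix.adjugate_fin_succ_eq_det_submatrix] at h3
  simp only [Fin.val_zero, add_zero, pow_zero, one_mul, Fin.succAbove_zero] at h3
  rw [h1, h3, Matrix.smul_apply, jac_zero, smul_eq_mul]

lemma spatial_bijective (s : ℝ) : Function.Bijective (C.spatial s) := by
  constructor
  · intro z z' h
    have h1 : C.point s z = C.point s z' :=
      (F.existsUnique_slice s (C.spatial s z')).unique
        ⟨C.tau_point s z, fun i => congrFun h i⟩ ⟨C.tau_point s z', fun i => rfl⟩
    rw [← C.space_point s z, h1, space_point]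
  · intro y
    obtain ⟨x, ⟨h0, hi⟩, -⟩ := F.existsUnique_slice s y
    exact ⟨C.space x, funext fun i => by rw [spatial, C.point_space h0, hi]⟩

/-- The density of `dx¹ dx² dx³` with respect to `dz¹ dz² dz³` on `Σ_s`. -/
def density (s : ℝ) (z : Space) : ℝ :=
  |(C.jacInv (C.point s z)).det| * pd 0 F.τ (C.point s z)

lemma density_pos (s : ℝ) (z : Space) : 0 < C.density s z :=
  mul_pos (abs_pos.2 (C.det_jacInv_ne_zero _)) (F.increasing _)

lemma continuous_density (s : ℝ) : Continuous (C.density s) := by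
  have h : C.density s = fun z => |(fderiv ℝ (C.spatial s) z).det| := by
    funext z
    rw [det_fderiv_spatial, abs_mul, abs_of_pos (F.increasing _), density]
  rw [h]
  exact (ContinuousLinearMap.continuous_det.comp
    ((C.contDiff_spatial s).continuous_fderiv (by simp))).abs

/-- The change of variables formula for the bijection z ↦ 𝐱(s, z) of ℝ³. It reduces all integrals
over Σ_s to weighted Lebesgue integrals in z. -/
lemma surfMeasure_eq (s : ℝ) : F.surfMeasure s =
    Measure.map (C.sliceHomeo s).symm
      (volume.withDensity fun z => ENNReal.ofReal (C.density s z)) := by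
  have hq : (volume : Measure Space) = Measure.map (C.spatial s)
      (volume.withDensity fun z => ENNReal.ofReal (C.density s z)) := by
    have h := map_withDensity_abs_det_fderiv_eq_addHaar (volume : Measure Space)
      (s := Set.univ) (f := C.spatial s) (f' := fderiv ℝ (C.spatial s))
      MeasurableSet.univ.nullMeasurableSet
      (fun z _ => ((C.contDiff_spatial s).differentiable (by simp) z).hasFDerivAt.hasFDerivWithinAt)
      (C.spatial_bijective s).1.injOn
    rw [Set.image_univ, (C.spatial_bijective s).2.range_eq, Measure.restrict_univ] at h
    conv_lhs => rw [← h]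
    congr 2
    funext z
    rw [det_fderiv_spatial, abs_mul, abs_of_pos (F.increasing _), density]
  have hp : (fun x (i : Fin 3) => x.1 i.succ : F.Slice s → Space)
      = C.spatial s ∘ C.sliceHomeo s := by
    funext x i
    change x.1 i.succ = C.point s (C.space x.1) i.succ
    rw [C.point_space x.2]
  have hemb : MeasurableEmbedding (C.spatial s ∘ C.sliceHomeo s) :=
    ((C.contDiff_spatial s).continuous.measurableEmbedding (C.spatial_bijective s).1).comp
      (C.sliceHomeo s).measurableEmbedding
  rw [CauchyFoliation.surfMeasure, hp]
  have hmap : (volume : Measure Space) = Measure.map (C.spatial s ∘ C.sliceHomeo s)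
      (Measure.map (C.sliceHomeo s).symm
        (volume.withDensity fun z => ENNReal.ofReal (C.density s z))) := by
    rw [Measure.map_map hemb.measurable (C.sliceHomeo s).symm.continuous.measurable]
    conv_lhs => rw [hq]
    congr 1
    funext z
    simp
  conv_lhs => rw [hmap]
  rw [hemb.comap_map]

lemma ae_surfMeasure_iff {s : ℝ} {p : F.Slice s → Prop} :
    (∀ᵐ x ∂F.surfMeasure s, p x) ↔ ∀ᵐ z, p ((C.sliceHomeo s).symm z) := by
  rw [C.surfMeasure_eq, (C.sliceHomeo s).symm.measurableEmbedding.ae_map_iff,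
    ae_withDensity_iff (C.continuous_density s).measurable.ennreal_ofReal]
  simp [C.density_pos]

lemma integral_surfMeasure {s : ℝ} {E : Type*} [NormedAddCommGroup E] [NormedSpace ℝ E]
    (f : F.Slice s → E) :
    ∫ x, f x ∂F.surfMeasure s = ∫ z, C.density s z • f ((C.sliceHomeo s).symm z) := by
  rw [C.surfMeasure_eq, (C.sliceHomeo s).symm.measurableEmbedding.integral_map,
    integral_withDensity_eq_integral_toReal_smul
      (C.continuous_density s).measurable.ennreal_ofReal (by simp)]
  simp [(C.density_pos s _).le]

lemma integrable_surfMeasure_iff {s : ℝ} {E : Type*} [NormedAddCommGroup E] [NormedSpace ℝ E]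
    {f : F.Slice s → E} : Integrable f (F.surfMeasure s) ↔
      Integrable fun z => C.density s z • f ((C.sliceHomeo s).symm z) := by
  rw [C.surfMeasure_eq, (C.sliceHomeo s).symm.measurableEmbedding.integrable_map_iff,
    integrable_withDensity_iff_integrable_smul'
      (C.continuous_density s).measurable.ennreal_ofReal (by simp)]
  simp [(C.density_pos s _).le]

end AdaptedCoordinates

end

section

/-! ### The unitary transfer to `ℂ⁴ ⊗ L²(ℝ³)` -/

lemma toL2_coeFn (φ : TestSpinor) : (toL2 φ : Space → Spinor) =ᵐ[volume] φ.1 :=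
  MemLp.coeFn_toLp (φ.2.1.continuous.memLp_of_hasCompactSupport φ.2.2)

namespace CauchyFoliation

variable {D : DiracMatrices} {F : CauchyFoliation} {s : ℝ}

/-- The element of `𝓗(Σ_s)` represented by a function. -/
def Hilbert.mk (f : F.Slice s → Spinor) (hm : AEStronglyMeasurable f (F.surfMeasure s))
    (hf : Integrable (fun x : F.Slice s => F.flux D x (f x) (f x)) (F.surfMeasure s)) :
    F.Hilbert D s :=
  ⟨AEEqFun.mk f hm, hf.congr (by
    filter_upwards [AEEqFun.coeFn_mk f hm] with x hx
    rw [hx])⟩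

lemma Hilbert.mk_fn (f : F.Slice s → Spinor) (hm : AEStronglyMeasurable f (F.surfMeasure s))
    (hf : Integrable (fun x : F.Slice s => F.flux D x (f x) (f x)) (F.surfMeasure s)) :
    (Hilbert.mk f hm hf).fn =ᵐ[F.surfMeasure s] f :=
  AEEqFun.coeFn_mk f hm

lemma Hilbert.fn_add (f g : F.Hilbert D s) : (f + g).fn =ᵐ[F.surfMeasure s] f.fn + g.fn :=
  AEEqFun.coeFn_add f.1 g.1

lemma Hilbert.fn_smul (c : ℂ) (f : F.Hilbert D s) : (c • f).fn =ᵐ[F.surfMeasure s] c • f.fn :=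
  AEEqFun.coeFn_smul c f.1

lemma Hilbert.ext {f g : F.Hilbert D s} (h : f.fn =ᵐ[F.surfMeasure s] g.fn) : f = g :=
  Subtype.ext (AEEqFun.ext h)

lemma Hilbert.inner_eq (f g : F.Hilbert D s) : inner ℂ f g = F.prod D s f.fn g.fn := rfl

lemma toHilbert_fn (f : F.TestSpinor s) : (F.toHilbert D s f).fn =ᵐ[F.surfMeasure s] f.1 :=
  AEEqFun.coeFn_mk _ _

lemma prod_congr {f f' g g' : F.Slice s → Spinor} (hf : f =ᵐ[F.surfMeasure s] f')
    (hg : g =ᵐ[F.surfMeasure s] g') : F.prod D s f g = F.prod D s f' g' := by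
  refine integral_congr_ae ?_
  filter_upwards [hf, hg] with x h1 h2
  rw [h1, h2]

lemma inner_toHilbert (f g : F.TestSpinor s) :
    inner ℂ (F.toHilbert D s f) (F.toHilbert D s g) = F.prod D s f.1 g.1 :=
  prod_congr (toHilbert_fn f) (toHilbert_fn g)

end CauchyFoliation

namespace AdaptedCoordinates

variable (D : DiracMatrices) {F : CauchyFoliation} (C : AdaptedCoordinates F)

section

attribute [local instance] Matrix.linftyOpNormedRing Matrix.linftyOpNormedAlgebra

lemma contDiff_transfer : ContDiff ℝ ∞ (C.transfer D) := by
  have h : C.transfer D = fun x => C.weight x • F.boost D x :=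
    funext fun x => Complex.coe_smul _ _
  rw [h]
  exact C.contDiff_weight.smul (F.contDiff_boost D)

lemma contDiff_transferInv : ContDiff ℝ ∞ (C.transferInv D) := by
  have h : C.transferInv D = fun x => (C.weight x)⁻¹ • (D.γ 0 * F.boost D x * D.γ 0) :=
    funext fun x => Complex.coe_smul _ _
  rw [h]
  exact (C.contDiff_weight.inv fun x => (C.weight_pos x).ne').smul
    ((contDiff_const.mul (F.contDiff_boost D)).mul contDiff_const)

lemma contDiff_act_transfer {E : Type*} [NormedAddCommGroup E] [NormedSpace ℝ E]
    {k : ℕ∞} {x : E → Minkowski} {v : E → Spinor} (hx : ContDiff ℝ k x)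
    (hv : ContDiff ℝ k v) : ContDiff ℝ k fun p => act (C.transfer D (x p)) (v p) :=
  CauchyFoliation.contDiff_act (((C.contDiff_transfer D).of_le (by exact_mod_cast le_top)).comp hx)
    hv

lemma contDiff_act_transferInv {E : Type*} [NormedAddCommGroup E] [NormedSpace ℝ E]
    {k : ℕ∞} {x : E → Minkowski} {v : E → Spinor} (hx : ContDiff ℝ k x)
    (hv : ContDiff ℝ k v) : ContDiff ℝ k fun p => act (C.transferInv D (x p)) (v p) :=
  CauchyFoliation.contDiff_act
    (((C.contDiff_transferInv D).of_le (by exact_mod_cast le_top)).comp hx) hv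

end

lemma act_transferInv_transfer (x : Minkowski) (v : Spinor) :
    act (C.transferInv D x) (act (C.transfer D x) v) = v := by
  rw [act_act, transferInv_mul_transfer, act_one]

lemma act_transfer_transferInv (x : Minkowski) (v : Spinor) :
    act (C.transfer D x) (act (C.transferInv D x) v) = v := by
  rw [act_act, transfer_mul_transferInv, act_one]

/-- The factor |g_z|^{-1/2}, the factor 1/n₀ left by the boost, and the density of d³x with respect
to d³z multiply to 1. This pointwise identity is the isometry of T_s. -/
lemma density_smul_flux (s : ℝ) (z : Space) (v w : Spinor) :
    C.density s z • F.flux D (C.point s z) (act (C.transfer D (C.point s z)) v)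
      (act (C.transfer D (C.point s z)) w) = inner ℂ v w := by
  rw [flux_transfer, density, ← Complex.coe_smul, smul_eq_mul, ← mul_assoc, ← Complex.ofReal_mul]
  have h1 := C.det_jac_mul (C.point s z)
  have h2 : |(C.jacInv (C.point s z)).det| * |(C.jac (C.point s z)).det| = 1 := by
    rw [← abs_mul, mul_comm, h1, abs_one]
  have h3 := (F.increasing (C.point s z)).ne'
  have h4 : |(C.jacInv (C.point s z)).det| * pd 0 F.τ (C.point s z) *
      (|(C.jac (C.point s z)).det| / pd 0 F.τ (C.point s z)) = 1 := by
    rw [← h2]; field_simp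
  rw [h4, Complex.ofReal_one, one_mul]

/-- Multiplication by the transfer matrix. -/
def transferFn (s : ℝ) (χ : Space → Spinor) (x : F.Slice s) : Spinor :=
  act (C.transfer D x.1) (χ (C.space x.1))

lemma transferFn_symm (s : ℝ) (χ : Space → Spinor) (z : Space) :
    C.transferFn D s χ ((C.sliceHomeo s).symm z) = act (C.transfer D (C.point s z)) (χ z) := by
  change act (C.transfer D (C.point s z)) (χ (C.space (C.point s z))) = _
  rw [space_point]

lemma density_smul_flux_transferFn (s : ℝ) (χ φ : Space → Spinor) (z : Space) :
    C.density s z • F.flux D ((C.sliceHomeo s).symm z : F.Slice s).1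
      (C.transferFn D s χ ((C.sliceHomeo s).symm z)) (C.transferFn D s φ ((C.sliceHomeo s).symm z))
      = inner ℂ (χ z) (φ z) := by
  rw [transferFn_symm, transferFn_symm]
  exact C.density_smul_flux D s z _ _

lemma prod_transferFn (s : ℝ) (χ φ : Space → Spinor) :
    F.prod D s (C.transferFn D s χ) (C.transferFn D s φ) = ∫ z, inner ℂ (χ z) (φ z) := by
  rw [CauchyFoliation.prod, C.integral_surfMeasure]
  exact integral_congr_ae (ae_of_all _ fun z => C.density_smul_flux_transferFn D s χ φ z)

lemma quasiMeasurePreserving_sliceHomeo (s : ℝ) :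
    Measure.QuasiMeasurePreserving (C.sliceHomeo s) (F.surfMeasure s) volume := by
  refine ⟨(C.sliceHomeo s).continuous.measurable, Measure.AbsolutelyContinuous.mk fun A hA h => ?_⟩
  rw [Measure.map_apply (C.sliceHomeo s).continuous.measurable hA]
  have h2 : ∀ᵐ x ∂F.surfMeasure s, C.sliceHomeo s x ∉ A := by
    rw [C.ae_surfMeasure_iff]
    simpa using measure_eq_zero_iff_ae_notMem.1 h
  exact measure_eq_zero_iff_ae_notMem.2 h2

lemma quasiMeasurePreserving_sliceHomeo_symm (s : ℝ) :
    Measure.QuasiMeasurePreserving (C.sliceHomeo s).symm volume (F.surfMeasure s) := by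
  refine ⟨(C.sliceHomeo s).symm.continuous.measurable,
    Measure.AbsolutelyContinuous.mk fun A hA h => ?_⟩
  rw [Measure.map_apply (C.sliceHomeo s).symm.continuous.measurable hA]
  have h2 : ∀ᵐ x ∂F.surfMeasure s, x ∉ A := measure_eq_zero_iff_ae_notMem.1 h
  rw [C.ae_surfMeasure_iff] at h2
  exact measure_eq_zero_iff_ae_notMem.2 h2

lemma aestronglyMeasurable_act {X : Type*} [MeasurableSpace X] {μ : Measure X} {M : Minkowski → Matrix (Fin 4) (Fin 4) ℂ}
    (hM : Continuous fun p : Minkowski × Spinor => act (M p.1) p.2) {x : X → Minkowski}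
    (hx : AEStronglyMeasurable x μ) {v : X → Spinor} (hv : AEStronglyMeasurable v μ) :
    AEStronglyMeasurable (fun y => act (M (x y)) (v y)) μ :=
  hM.comp_aestronglyMeasurable (g := fun p : Minkowski × Spinor => act (M p.1) p.2)
    (f := fun y => (x y, v y)) (hx.prodMk hv)

lemma aestronglyMeasurable_transferFn (s : ℝ) {χ : Space → Spinor}
    (hχ : AEStronglyMeasurable χ volume) :
    AEStronglyMeasurable (C.transferFn D s χ) (F.surfMeasure s) :=
  aestronglyMeasurable_act ((C.contDiff_act_transfer D (k := 0) contDiff_fst contDiff_snd).continuous)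
    continuous_subtype_val.aestronglyMeasurable
    (hχ.comp_quasiMeasurePreserving (C.quasiMeasurePreserving_sliceHomeo s))

lemma integrable_flux_transferFn_iff (s : ℝ) {χ : Space → Spinor} :
    Integrable (fun x : F.Slice s => F.flux D x (C.transferFn D s χ x) (C.transferFn D s χ x))
      (F.surfMeasure s) ↔ Integrable fun z => ‖χ z‖ ^ 2 := by
  rw [C.integrable_surfMeasure_iff]
  simp only [density_smul_flux_transferFn, inner_self_eq_norm_sq_to_K]
  have h : (fun z => (RCLike.ofReal ‖χ z‖ : ℂ) ^ 2) = fun z => ((‖χ z‖ ^ 2 : ℝ) : ℂ) := by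
    funext z; push_cast; rfl
  rw [h]
  exact ⟨fun h => h.re.congr (ae_of_all _ fun z => Complex.ofReal_re _), fun h => h.ofReal⟩

lemma transferFn_mem (s : ℝ) (χ : L2Spinor) :
    Integrable (fun x : F.Slice s => F.flux D x (C.transferFn D s χ x) (C.transferFn D s χ x))
      (F.surfMeasure s) :=
  (C.integrable_flux_transferFn_iff D s (χ := χ)).2
    ((memLp_two_iff_integrable_sq_norm (Lp.aestronglyMeasurable χ)).1 (Lp.memLp χ))

/-- Multiplication by the transfer matrix, as a linear map. -/
def transferLinear (s : ℝ) : L2Spinor →ₗ[ℂ] F.Hilbert D s where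
  toFun χ := CauchyFoliation.Hilbert.mk (C.transferFn D s χ)
    (C.aestronglyMeasurable_transferFn D s (Lp.aestronglyMeasurable χ)) (C.transferFn_mem D s χ)
  map_add' χ φ := by
    apply CauchyFoliation.Hilbert.ext
    refine (CauchyFoliation.Hilbert.mk_fn _ _ _).trans (Filter.EventuallyEq.trans ?_
      ((CauchyFoliation.Hilbert.fn_add _ _).trans ((CauchyFoliation.Hilbert.mk_fn _ _ _).add
        (CauchyFoliation.Hilbert.mk_fn _ _ _))).symm)
    rw [Filter.EventuallyEq, C.ae_surfMeasure_iff]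
    filter_upwards [Lp.coeFn_add χ φ] with z hz
    rw [transferFn_symm, hz, Pi.add_apply, Pi.add_apply, transferFn_symm, transferFn_symm, act,
      map_add]
  map_smul' c χ := by
    apply CauchyFoliation.Hilbert.ext
    refine (CauchyFoliation.Hilbert.mk_fn _ _ _).trans (Filter.EventuallyEq.trans ?_
      ((CauchyFoliation.Hilbert.fn_smul _ _).trans
        ((CauchyFoliation.Hilbert.mk_fn _ _ _).const_smul c)).symm)
    rw [Filter.EventuallyEq, C.ae_surfMeasure_iff]
    filter_upwards [Lp.coeFn_smul c χ] with z hz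
    rw [transferFn_symm, hz, Pi.smul_apply, Pi.smul_apply, transferFn_symm, act, map_smul]

lemma transferLinear_fn (s : ℝ) (χ : L2Spinor) :
    (C.transferLinear D s χ).fn =ᵐ[F.surfMeasure s] C.transferFn D s χ :=
  CauchyFoliation.Hilbert.mk_fn _ _ (C.transferFn_mem D s χ)

lemma inner_transferLinear (s : ℝ) (χ φ : L2Spinor) :
    inner ℂ (C.transferLinear D s χ) (C.transferLinear D s φ) = inner ℂ χ φ := by
  rw [L2.inner_def, ← C.prod_transferFn D s, CauchyFoliation.Hilbert.inner_eq]
  exact CauchyFoliation.prod_congr (C.transferLinear_fn D s χ) (C.transferLinear_fn D s φ)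

/-- Multiplication by the transfer matrix, as an isometry. -/
def transferIsometry (s : ℝ) : L2Spinor →ₗᵢ[ℂ] F.Hilbert D s :=
  (C.transferLinear D s).isometryOfInner (C.inner_transferLinear D s)

lemma transferIsometry_fn (s : ℝ) (χ : L2Spinor) :
    (C.transferIsometry D s χ).fn =ᵐ[F.surfMeasure s] C.transferFn D s χ :=
  C.transferLinear_fn D s χ

/-- The preimage is obtained by the pointwise inverse matrix; the norm identity, read backwards,
shows that it is square-integrable. -/
lemma transferIsometry_surjective (s : ℝ) : Function.Surjective (C.transferIsometry D s) := by
  intro f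
  set χ₀ : Space → Spinor := fun z =>
    act (C.transferInv D (C.point s z)) (f.fn ((C.sliceHomeo s).symm z)) with hχ₀
  have hm : AEStronglyMeasurable χ₀ volume :=
    aestronglyMeasurable_act
      ((C.contDiff_act_transferInv D (k := 0) contDiff_fst contDiff_snd).continuous)
      (C.contDiff_point_right s).continuous.aestronglyMeasurable
      (f.1.aestronglyMeasurable.comp_quasiMeasurePreserving
        (C.quasiMeasurePreserving_sliceHomeo_symm s))
  have hT : C.transferFn D s χ₀ = f.fn := by
    funext x
    rw [← (C.sliceHomeo s).symm_apply_apply x, transferFn_symm, hχ₀]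
    exact C.act_transfer_transferInv D _ _
  have hL : MemLp χ₀ 2 volume := by
    rw [memLp_two_iff_integrable_sq_norm hm, ← C.integrable_flux_transferFn_iff D s, hT]
    exact f.2
  refine ⟨hL.toLp χ₀, CauchyFoliation.Hilbert.ext ?_⟩
  refine (C.transferIsometry_fn D s _).trans ?_
  rw [Filter.EventuallyEq, C.ae_surfMeasure_iff]
  filter_upwards [hL.coeFn_toLp] with z hz
  rw [transferFn_symm, hz, ← hT, transferFn_symm]

/-- Multiplication by the transfer matrix, as a unitary operator. -/
def transferUnitary (s : ℝ) : L2Spinor ≃ₗᵢ[ℂ] F.Hilbert D s :=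
  LinearIsometryEquiv.ofSurjective (C.transferIsometry D s) (C.transferIsometry_surjective D s)

lemma transferUnitary_fn (s : ℝ) (χ : L2Spinor) :
    (C.transferUnitary D s χ).fn =ᵐ[F.surfMeasure s] C.transferFn D s χ :=
  C.transferIsometry_fn D s χ

/-- Multiplication by the transfer matrix, on smooth compactly supported functions. -/
def transferTest (s : ℝ) : TestSpinor ≃ₗ[ℂ] F.TestSpinor s where
  toFun φ := ⟨C.transferFn D s φ.1, ⟨fun x => act (C.transfer D x) (φ.1 (C.space x)),
      C.contDiff_act_transfer D (k := ⊤) contDiff_id (φ.2.1.comp C.contDiff_space),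
      fun _ => rfl⟩,
    (φ.2.2.comp_homeomorph (C.sliceHomeo s)).mono fun x hx h => hx (by
      have : φ.1 (C.space x.1) = 0 := h
      simp [transferFn, this])⟩
  map_add' φ φ' := by
    apply Subtype.ext
    funext x
    simp [transferFn, act]
  map_smul' c φ := by
    apply Subtype.ext
    funext x
    simp [transferFn, act]
  invFun f := ⟨fun z => act (C.transferInv D (C.point s z)) (f.1 ((C.sliceHomeo s).symm z)), by
    obtain ⟨⟨G, hG, hf⟩, -⟩ := f.2
    simp only [hf]
    exact C.contDiff_act_transferInv D (k := ⊤) (C.contDiff_point_right s)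
      (hG.comp (C.contDiff_point_right s)),
    (f.2.2.comp_homeomorph (C.sliceHomeo s).symm).mono fun z hz h => hz (by
      have : f.1 ((C.sliceHomeo s).symm z) = 0 := h
      simp [this])⟩
  left_inv φ := by
    apply Subtype.ext
    funext z
    simp only [transferFn_symm]
    exact C.act_transferInv_transfer D _ _
  right_inv f := by
    apply Subtype.ext
    funext x
    change C.transferFn D s _ x = _
    rw [← (C.sliceHomeo s).symm_apply_apply x, transferFn_symm]
    exact C.act_transfer_transferInv D _ _

lemma transferTest_apply (s : ℝ) (φ : TestSpinor) :
    (C.transferTest D s φ).1 = C.transferFn D s φ.1 := rfl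

lemma transferUnitary_toL2 (s : ℝ) (φ : TestSpinor) :
    C.transferUnitary D s (toL2 φ) = F.toHilbert D s (C.transferTest D s φ) := by
  apply CauchyFoliation.Hilbert.ext
  refine (C.transferUnitary_fn D s _).trans (Filter.EventuallyEq.trans ?_
    (CauchyFoliation.toHilbert_fn _).symm)
  rw [Filter.EventuallyEq, C.ae_surfMeasure_iff]
  filter_upwards [toL2_coeFn φ] with z hz
  rw [transferFn_symm, transferTest_apply, transferFn_symm, hz]

end AdaptedCoordinates

lemma denseRange_toL2 : DenseRange toL2 := by
  refine (Lp.dense_hasCompactSupport_contDiff (E := Space) (F := Spinor) (μ := volume) (p := 2)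
    (by simp)).mono ?_
  rintro f ⟨g, hfg, hg, hg'⟩
  refine ⟨⟨g, hg', hg⟩, Lp.ext ((toL2_coeFn _).trans hfg.symm)⟩

namespace CauchyFoliation

variable (D : DiracMatrices) (F : CauchyFoliation)

/-- Completeness is carried over from L² by the unitary T_s of the coordinates (τ, 𝐱). -/
lemma completeSpace_hilbert (s : ℝ) : CompleteSpace (F.Hilbert D s) :=
  (F.canonicalCoordinates.transferUnitary D s).symm.toIsometryEquiv.completeSpace

/-- In the same coordinates T_s maps test functions on ℝ³ to test spinors on Σ_s, so density follows
from that in L². -/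
lemma denseRange_toHilbert (s : ℝ) : DenseRange (F.toHilbert D s) := by
  set T := F.canonicalCoordinates.transferUnitary D s
  have h : DenseRange (T ∘ toL2) := T.surjective.denseRange.comp denseRange_toL2 T.continuous
  refine h.mono ?_
  rintro _ ⟨φ, rfl⟩
  exact ⟨_, (F.canonicalCoordinates.transferUnitary_toL2 D s φ).symm⟩

end CauchyFoliation

end

section

/-! ### Derivative of a determinant -/

/-- The determinant as a continuous multilinear function of the rows. -/
def detRows (n : ℕ) : ContinuousMultilinearMap ℝ (fun _ : Fin n => Fin n → ℝ) ℝ where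
  toMultilinearMap := Matrix.detRowAlternating.toMultilinearMap
  cont := Continuous.matrix_det (A := fun M : Matrix (Fin n) (Fin n) ℝ => M) continuous_id

/-- Jacobi's formula. -/
lemma pd_det {m n : ℕ} {M : (Fin m → ℝ) → Matrix (Fin n) (Fin n) ℝ} {x : Fin m → ℝ}
    (hM : ∀ i j, DifferentiableAt ℝ (fun y => M y i j) x) (a : Fin m) :
    pd a (fun y => (M y).det) x
      = ∑ i, ∑ j, (M x).adjugate j i * pd a (fun y => M y i j) x := by
  set N : (Fin m → ℝ) → Fin n → Fin n → ℝ := fun y => M y with hN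
  have hd : HasFDerivAt N (fderiv ℝ N x) x :=
    (differentiableAt_pi.2 fun i => differentiableAt_pi.2 fun j => hM i j).hasFDerivAt
  have h := (((detRows n).hasFDerivAt (N x)).comp x hd).fderiv
  have hpd : ∀ i j, fderiv ℝ N x (Pi.single a 1) i j = pd a (fun y => M y i j) x := by
    intro i j
    have h1 := (hasFDerivAt_pi'.1 (hasFDerivAt_pi'.1 hd i) j).fderiv
    rw [pd, h1]
    rfl
  change fderiv ℝ (detRows n ∘ N) x _ = _
  rw [h, ContinuousLinearMap.comp_apply, ContinuousMultilinearMap.linearDeriv_apply]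
  refine Finset.sum_congr rfl fun i _ => ?_
  have h2 : (detRows n) (Function.update (N x) i (fderiv ℝ N x (Pi.single a 1) i))
      = ((M x).updateRow i (fderiv ℝ N x (Pi.single a 1) i)).det := rfl
  rw [h2, ← Matrix.cramer_transpose_apply, Matrix.cramer_eq_adjugate_mulVec, Matrix.mulVec,
    dotProduct]
  refine Finset.sum_congr rfl fun j _ => ?_
  rw [← Matrix.adjugate_transpose, Matrix.transpose_apply, hpd]

/-! ### Rotation-invariant functions -/

/-- The function depends only on `x⁰` and `|𝐱|`. -/
def RotInv (f : Minkowski → ℝ) : Prop :=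
  ∀ x y : Minkowski, x 0 = y 0 → ∑ i : Fin 3, x i.succ ^ 2 = ∑ i : Fin 3, y i.succ ^ 2 → f x = f y

lemma CauchyFoliation.RotationallySymmetric.rotInv {F : CauchyFoliation}
    (hF : F.RotationallySymmetric) : RotInv F.τ := by
  obtain ⟨f, hf⟩ := hF
  intro x y h0 h1
  rw [hf, hf, h0, h1]

lemma hasDerivAt_line {f : Minkowski → ℝ} (hf : Differentiable ℝ f) (x v : Minkowski) :
    HasDerivAt (fun r : ℝ => f (x + r • v)) (fderiv ℝ f x v) 0 := by
  have h1 : HasDerivAt (fun r : ℝ => x + r • v) v 0 := by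
    simpa using ((hasDerivAt_id (0 : ℝ)).smul_const v).const_add x
  have h2 : HasFDerivAt f (fderiv ℝ f x) (x + (0 : ℝ) • v) := by
    simpa using (hf x).hasFDerivAt
  exact h2.comp_hasDerivAt (0 : ℝ) h1

namespace RotInv

variable {f g : Minkowski → ℝ}

/-- If u is tangent to the sphere through x, then x + ru and x - ru have equal spatial norm, so f is
even along the line and its derivative at 0 vanishes. -/
lemma fderiv_eq_zero (h : RotInv f) (hf : Differentiable ℝ f) {x u : Minkowski} (hu0 : u 0 = 0)
    (hu : ∑ i : Fin 3, x i.succ * u i.succ = 0) : fderiv ℝ f x u = 0 := by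
  have h1 := hasDerivAt_line hf x u
  have h2 := hasDerivAt_line hf x (-u)
  have h3 : (fun r : ℝ => f (x + r • -u)) = fun r => f (x + r • u) := by
    funext r
    refine h _ _ (by simp [hu0]) ?_
    have e : ∀ s : ℝ, ∑ i : Fin 3, (x + s • u) i.succ ^ 2
        = ∑ i : Fin 3, x i.succ ^ 2 + s ^ 2 * ∑ i : Fin 3, u i.succ ^ 2 := by
      intro s
      have : ∑ i : Fin 3, (x + s • u) i.succ ^ 2 = ∑ i : Fin 3, x i.succ ^ 2
          + 2 * s * ∑ i : Fin 3, x i.succ * u i.succ + s ^ 2 * ∑ i : Fin 3, u i.succ ^ 2 := by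
        rw [Finset.mul_sum, Finset.mul_sum, ← Finset.sum_add_distrib, ← Finset.sum_add_distrib]
        refine Finset.sum_congr rfl fun i _ => ?_
        simp only [Pi.add_apply, Pi.smul_apply, smul_eq_mul]
        ring
      rw [this, hu]; ring
    have e2 : x + r • -u = x + (-r) • u := by module
    rw [e2, e, e]
    ring
  rw [h3] at h2
  have h4 := h1.unique h2
  rw [map_neg] at h4
  linarith

lemma mul_pd (h : RotInv f) (hf : Differentiable ℝ f) (x : Minkowski) (i j : Fin 3) :
    x i.succ * pd j.succ f x = x j.succ * pd i.succ f x := by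
  have h1 := h.fderiv_eq_zero hf (x := x)
    (u := x i.succ • Pi.single j.succ 1 - x j.succ • Pi.single i.succ 1) (by simp) (by
      simp only [Pi.sub_apply, Pi.smul_apply, smul_eq_mul, Pi.single_apply, mul_sub,
        Finset.sum_sub_distrib, Fin.succ_inj, mul_ite, mul_one, mul_zero, Finset.sum_ite_eq',
        Finset.mem_univ, if_true]
      ring)
  rw [map_sub, map_smul, map_smul, sub_eq_zero] at h1
  exact h1

lemma pd_eq_zero (h : RotInv f) (hf : Differentiable ℝ f) {x : Minkowski}
    (hx : ∀ i : Fin 3, x i.succ = 0) (i : Fin 3) : pd i.succ f x = 0 :=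
  h.fderiv_eq_zero hf (by simp) (by simp [hx])

/-- Spatial gradients of rotation-invariant functions are radial off the time axis and vanish on it;
in either case they are parallel. -/
lemma pd_mul_pd (h : RotInv f) (hf : Differentiable ℝ f) (h' : RotInv g)
    (hg : Differentiable ℝ g) (x : Minkowski) (i j : Fin 3) :
    pd i.succ f x * pd j.succ g x = pd j.succ f x * pd i.succ g x := by
  by_cases hx : ∀ i : Fin 3, x i.succ = 0
  · rw [h.pd_eq_zero hf hx, h.pd_eq_zero hf hx, zero_mul, zero_mul]
  · push Not at hx
    obtain ⟨k, hk⟩ := hx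
    have e1 := h.mul_pd hf x k i
    have e2 := h.mul_pd hf x k j
    have e3 := h'.mul_pd hg x k i
    have e4 := h'.mul_pd hg x k j
    refine mul_left_cancel₀ (mul_ne_zero hk hk) ?_
    calc x k.succ * x k.succ * (pd i.succ f x * pd j.succ g x)
        = (x k.succ * pd i.succ f x) * (x k.succ * pd j.succ g x) := by ring
      _ = (x k.succ * pd j.succ f x) * (x k.succ * pd i.succ g x) := by
          rw [e1, e2, e3, e4]; ring
      _ = _ := by ring

lemma rotInv_pd_zero (h : RotInv f) (hf : Differentiable ℝ f) : RotInv (pd 0 f) := by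
  intro x y h0 h1
  have e1 := hasDerivAt_line hf x (Pi.single 0 1)
  have e2 := hasDerivAt_line hf y (Pi.single 0 1)
  have e : (fun r : ℝ => f (x + r • Pi.single 0 1)) = fun r => f (y + r • Pi.single 0 1) := by
    funext r
    refine h _ _ (by simp [h0]) ?_
    simpa using h1
  rw [e] at e1
  exact e1.unique e2

/-- Off the axis the gradient is radial, so |𝐱|²|∇f|² is the square of the derivative of f along the
spatial position vector, which is invariant. On the axis both sides vanish. -/
lemma rotInv_sum_sq (h : RotInv f) (hf : Differentiable ℝ f) :
    RotInv fun x => ∑ i : Fin 3, pd i.succ f x ^ 2 := by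
  set P : Minkowski → Minkowski := fun x => Fin.cons 0 fun i : Fin 3 => x i.succ with hP
  have hE : RotInv fun x => fderiv ℝ f x (P x) := by
    intro x y h0 h1
    have e1 := hasDerivAt_line hf x (P x)
    have e2 := hasDerivAt_line hf y (P y)
    have e : (fun r : ℝ => f (x + r • P x)) = fun r => f (y + r • P y) := by
      funext r
      refine h _ _ (by simp [h0, hP]) ?_
      have e3 : ∀ x : Minkowski, ∑ i : Fin 3, (x + r • P x) i.succ ^ 2
          = (1 + r) ^ 2 * ∑ i : Fin 3, x i.succ ^ 2 := by
        intro x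
        rw [Finset.mul_sum]
        refine Finset.sum_congr rfl fun i _ => ?_
        simp [hP]; ring
      rw [e3, e3, h1]
    rw [e] at e1
    exact e1.unique e2
  have key : ∀ x : Minkowski, (∑ i : Fin 3, x i.succ ^ 2) * ∑ i : Fin 3, pd i.succ f x ^ 2
      = fderiv ℝ f x (P x) ^ 2 := by
    intro x
    have e1 : fderiv ℝ f x (P x) = ∑ i : Fin 3, x i.succ * pd i.succ f x := by
      rw [CauchyFoliation.fderiv_apply_eq_sum, Fin.sum_univ_succ]
      simp [hP]
    rw [e1, sq, Finset.sum_mul_sum, Finset.sum_mul_sum]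
    refine Finset.sum_congr rfl fun i _ => Finset.sum_congr rfl fun j _ => ?_
    have e2 := h.mul_pd hf x i j
    calc x i.succ ^ 2 * pd j.succ f x ^ 2
        = (x i.succ * pd j.succ f x) * (x i.succ * pd j.succ f x) := by ring
      _ = (x j.succ * pd i.succ f x) * (x i.succ * pd j.succ f x) := by rw [e2]
      _ = _ := by ring
  intro x y h0 h1
  by_cases hx : ∑ i : Fin 3, x i.succ ^ 2 = 0
  · have hz : ∀ x : Minkowski, ∑ i : Fin 3, x i.succ ^ 2 = 0 → ∀ i : Fin 3, x i.succ = 0 := by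
      intro x hx i
      have := (Finset.sum_eq_zero_iff_of_nonneg fun i _ => sq_nonneg (x i.succ)).1 hx i
        (Finset.mem_univ i)
      exact pow_eq_zero_iff two_ne_zero |>.1 this
    simp only [h.pd_eq_zero hf (hz x hx), h.pd_eq_zero hf (hz y (h1 ▸ hx))]
  · refine mul_left_cancel₀ hx ?_
    have e3 : fderiv ℝ f x (P x) = fderiv ℝ f y (P y) := hE x y h0 h1
    change (∑ i : Fin 3, x i.succ ^ 2) * ∑ i : Fin 3, pd i.succ f x ^ 2
      = (∑ i : Fin 3, x i.succ ^ 2) * ∑ i : Fin 3, pd i.succ f y ^ 2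
    rw [key x, h1, key y, e3]

end RotInv

/-! ### The boost in terms of the matrices `αⁱ` -/

namespace DiracMatrices

variable (D : DiracMatrices)

lemma alpha_zero : D.alpha 0 = 1 := D.gamma_zero_mul_self

lemma alpha_anticomm (i j : Fin 3) :
    D.alpha i.succ * D.alpha j.succ + D.alpha j.succ * D.alpha i.succ
      = if i = j then (2 : ℂ) • 1 else 0 := by
  have g0 : ∀ i : Fin 3, D.γ i.succ * D.γ 0 = -(D.γ 0 * D.γ i.succ) := by
    intro i
    have h := D.clifford i.succ 0
    rw [if_neg (Fin.succ_ne_zero i)] at h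
    exact eq_neg_of_add_eq_zero_left h
  have hp : ∀ i j : Fin 3, D.alpha i.succ * D.alpha j.succ = -(D.γ i.succ * D.γ j.succ) := by
    intro i j
    calc (D.γ 0 * D.γ i.succ) * (D.γ 0 * D.γ j.succ)
        = D.γ 0 * (D.γ i.succ * D.γ 0) * D.γ j.succ := by simp only [Matrix.mul_assoc]
      _ = - ((D.γ 0 * D.γ 0) * (D.γ i.succ * D.γ j.succ)) := by
          rw [g0]; simp only [Matrix.mul_assoc, Matrix.mul_neg, Matrix.neg_mul]
      _ = _ := by rw [gamma_zero_mul_self, Matrix.one_mul]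
  rw [hp, hp, ← neg_add, D.clifford]
  by_cases hij : i = j
  · rw [if_pos (by rw [hij]), if_pos hij, ← neg_smul]
    congr 1
    simp [eta]
  · rw [if_neg (fun h => hij (Fin.succ_injective _ h)), if_neg hij, neg_zero]

/-- A symmetric tensor contracted with the matrices `αⁱ` yields its trace. -/
lemma sum_alpha_mul_alpha {S : Fin 3 → Fin 3 → ℝ} (hS : ∀ i j, S i j = S j i) :
    ∑ i, ∑ j, S i j • (D.alpha i.succ * D.alpha j.succ)
      = (∑ i, S i i) • (1 : Matrix (Fin 4) (Fin 4) ℂ) := by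
  set X := ∑ i, ∑ j, S i j • (D.alpha i.succ * D.alpha j.succ) with hX
  have e : X = ∑ i, ∑ j, S i j • (D.alpha j.succ * D.alpha i.succ) := by
    rw [hX, Finset.sum_comm]
    refine Finset.sum_congr rfl fun i _ => Finset.sum_congr rfl fun j _ => ?_
    rw [hS]
  have e2 : X + X = (2 : ℝ) • (∑ i, S i i) • (1 : Matrix (Fin 4) (Fin 4) ℂ) := by
    nth_rewrite 1 [hX]
    rw [e, ← Finset.sum_add_distrib, smul_smul, Finset.mul_sum, Finset.sum_smul]
    refine Finset.sum_congr rfl fun i _ => ?_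
    rw [← Finset.sum_add_distrib, Finset.sum_eq_single i]
    · rw [← smul_add, alpha_anticomm, if_pos rfl, mul_comm, mul_smul]
      congr 1
    · intro j _ hj
      rw [← smul_add, alpha_anticomm, if_neg (Ne.symm hj), smul_zero]
    · simp
  rw [← two_smul ℝ] at e2
  exact smul_right_injective _ (two_ne_zero (α := ℝ)) e2

/-- The matrix `vᵢ αⁱ`. -/
def alphaVec (v : Fin 3 → ℝ) : Matrix (Fin 4) (Fin 4) ℂ := ∑ i, v i • D.alpha i.succ

lemma alphaVec_isHermitian (v : Fin 3 → ℝ) : (D.alphaVec v).conjTranspose = D.alphaVec v := by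
  rw [alphaVec, Matrix.conjTranspose_sum]
  refine Finset.sum_congr rfl fun i _ => ?_
  rw [Matrix.conjTranspose_smul, alpha_isHermitian]
  simp

lemma alphaVec_mul_alphaVec {v w : Fin 3 → ℝ} (h : ∀ i j, v i * w j = v j * w i) :
    D.alphaVec v * D.alphaVec w = (∑ i, v i * w i) • (1 : Matrix (Fin 4) (Fin 4) ℂ) := by
  rw [← D.sum_alpha_mul_alpha (S := fun i j => v i * w j) h, alphaVec, alphaVec,
    Finset.sum_mul_sum]
  refine Finset.sum_congr rfl fun i _ => Finset.sum_congr rfl fun j _ => ?_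
  rw [Matrix.smul_mul, Matrix.mul_smul, smul_smul]

end DiracMatrices

namespace CauchyFoliation

variable (D : DiracMatrices) (F : CauchyFoliation)

/-- The normalization factor of the boost. -/
def boostFactor (x : Minkowski) : ℝ := (2 * (1 + F.normal 0 x)) ^ (-(1 / 2) : ℝ)

/-- The scalar part of the boost. -/
def boostScalar (x : Minkowski) : ℝ := F.boostFactor x * (1 + F.normal 0 x)

/-- The ratio of the vector part of the boost to the gradient of `τ`. -/
def boostRatio (x : Minkowski) : ℝ := F.boostFactor x * F.lapse x

lemma contDiff_boostFactor : ContDiff ℝ ∞ F.boostFactor :=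
  ContDiff.rpow_const_of_ne (contDiff_const.mul (contDiff_const.add (F.contDiff_normal 0)))
    fun x => by have := F.normal_zero_pos x; positivity

lemma contDiff_boostScalar : ContDiff ℝ ∞ F.boostScalar :=
  F.contDiff_boostFactor.mul (contDiff_const.add (F.contDiff_normal 0))

lemma contDiff_boostRatio : ContDiff ℝ ∞ F.boostRatio :=
  F.contDiff_boostFactor.mul F.contDiff_lapse

/-- In terms of the Hermitian matrices α the boost is a scalar minus a vector part parallel to the
spatial gradient of τ; rotational symmetry can then be applied to its derivatives. -/
lemma boost_eq (x : Minkowski) : F.boost D x = F.boostScalar x • 1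
    - D.alphaVec fun i => F.boostRatio x * pd i.succ F.τ x := by
  have h1 : F.gammaNormal D x * D.γ 0 = F.normal 0 x • 1
      - D.alphaVec fun i => F.normal i.succ x := by
    rw [gammaNormal, Finset.sum_mul, Fin.sum_univ_succ, DiracMatrices.alphaVec, sub_eq_add_neg,
      ← Finset.sum_neg_distrib]
    congr 1
    · rw [Matrix.smul_mul, D.gamma_zero_mul_self, Complex.coe_smul]
    · refine Finset.sum_congr rfl fun i _ => ?_
      rw [Matrix.smul_mul, DiracMatrices.alpha, D.gamma_zero_mul, Complex.coe_smul]
      simp [eta]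
  have h2 : F.boost D x = F.boostFactor x • (1 + F.gammaNormal D x * D.γ 0) :=
    Complex.coe_smul _ _
  rw [h2, h1, boostScalar, DiracMatrices.alphaVec, DiracMatrices.alphaVec]
  have h3 : ∑ i : Fin 3, (F.boostRatio x * pd i.succ F.τ x) • D.alpha i.succ
      = F.boostFactor x • ∑ i : Fin 3, F.normal i.succ x • D.alpha i.succ := by
    rw [Finset.smul_sum]
    refine Finset.sum_congr rfl fun i _ => ?_
    rw [smul_smul, boostRatio, normal_eq, mul_assoc]
  rw [h3]
  module

variable {F}

lemma rotInv_gInvTau (hF : RotInv F.τ) : RotInv F.gInvTau := by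
  have hd := F.smooth.differentiable (by simp : (∞ : WithTop ℕ∞) ≠ 0)
  intro x y h0 h1
  have e1 := hF.rotInv_pd_zero hd x y h0 h1
  have e2 := hF.rotInv_sum_sq hd x y h0 h1
  simp only [gInvTau, Fin.sum_univ_succ (n := 3), eta, if_true, Fin.succ_ne_zero, if_false,
    one_mul, neg_one_mul, Finset.sum_neg_distrib] at e2 ⊢
  rw [e1, e2]

lemma rotInv_lapse (hF : RotInv F.τ) : RotInv F.lapse := fun x y h0 h1 => by
  rw [lapse, lapse, rotInv_gInvTau hF x y h0 h1]

lemma rotInv_normal_zero (hF : RotInv F.τ) : RotInv (F.normal 0) := fun x y h0 h1 => by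
  rw [normal_eq, normal_eq, rotInv_lapse hF x y h0 h1,
    hF.rotInv_pd_zero (F.smooth.differentiable (by simp)) x y h0 h1]

lemma rotInv_boostFactor (hF : RotInv F.τ) : RotInv F.boostFactor := fun x y h0 h1 => by
  rw [boostFactor, boostFactor, rotInv_normal_zero hF x y h0 h1]

lemma rotInv_boostScalar (hF : RotInv F.τ) : RotInv F.boostScalar := fun x y h0 h1 => by
  rw [boostScalar, boostScalar, rotInv_normal_zero hF x y h0 h1, rotInv_boostFactor hF x y h0 h1]

lemma rotInv_boostRatio (hF : RotInv F.τ) : RotInv F.boostRatio := fun x y h0 h1 => by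
  rw [boostRatio, boostRatio, rotInv_lapse hF x y h0 h1, rotInv_boostFactor hF x y h0 h1]

/-! ### The spin connection of the boost. -/

section

attribute [local instance] Matrix.linftyOpNormedRing Matrix.linftyOpNormedAlgebra

lemma pd_smul_const {n : ℕ} {E : Type*} [NormedAddCommGroup E] [NormedSpace ℝ E]
    {c : (Fin n → ℝ) → ℝ} {x : Fin n → ℝ} (hc : DifferentiableAt ℝ c x) (B : E) (a : Fin n) :
    pd a (fun y => c y • B) x = pd a c x • B := by
  rw [pd_smul hc (differentiableAt_const B)]
  simp [pd]

lemma pd_boost (a : Fin 4) (x : Minkowski) : pd a (F.boost D) x = pd a F.boostScalar x • 1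
    - D.alphaVec fun i => pd a (fun y => F.boostRatio y * pd i.succ F.τ y) x := by
  have hp := F.contDiff_boostScalar.differentiable (by simp) x
  have hq : ∀ i : Fin 3, DifferentiableAt ℝ (fun y => F.boostRatio y * pd i.succ F.τ y) x :=
    fun i => (F.contDiff_boostRatio.mul (contDiff_pd (m := ∞) F.smooth (by simp)
      i.succ)).differentiable (by simp) x
  have h : F.boost D = fun y => F.boostScalar y • (1 : Matrix (Fin 4) (Fin 4) ℂ)
      - ∑ i : Fin 3, (F.boostRatio y * pd i.succ F.τ y) • D.alpha i.succ := by
    funext y; rw [boost_eq]; rfl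
  rw [h, pd_sub (hp.smul_const _) (DifferentiableAt.fun_sum fun i _ => (hq i).smul_const _),
    pd_smul_const hp, pd_sum _ fun i => (hq i).smul_const _]
  simp only [pd_smul_const (hq _)]
  rfl

/-- For a rotationally symmetric foliation the spin connection term is Hermitian. -/
lemma boost_connection_isHermitian (hF : RotInv F.τ) (x : Minkowski) :
    (∑ a, F.boost D x * D.alpha a * pd a (F.boost D) x).conjTranspose
      = ∑ a, F.boost D x * D.alpha a * pd a (F.boost D) x := by
  have hτd : Differentiable ℝ F.τ := F.smooth.differentiable (by simp)
  have hpd := F.contDiff_boostScalar.differentiable (by simp : (∞ : WithTop ℕ∞) ≠ 0)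
  have hmd := F.contDiff_boostRatio.differentiable (by simp : (∞ : WithTop ℕ∞) ≠ 0)
  have hτ1 : ∀ a, ContDiff ℝ ∞ (pd a F.τ) := fun a => contDiff_pd F.smooth (by simp) a
  have hτ1d : ∀ a, Differentiable ℝ (pd a F.τ) := fun a => (hτ1 a).differentiable (by simp)
  set p := F.boostScalar with hp
  set m := F.boostRatio with hm
  set q : Fin 3 → Minkowski → ℝ := fun i y => m y * pd i.succ F.τ y with hq
  have hdq : ∀ a i, pd a (q i) x = m x * pd a (pd i.succ F.τ) x + pd a m x * pd i.succ F.τ x :=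
    fun a i => pd_smul (hmd x) (hτ1d i.succ x) a
  set u : ℝ := pd 0 p x - ∑ i : Fin 3, pd i.succ (q i) x with hu
  set w : Fin 3 → ℝ := fun j => pd j.succ p x - pd 0 (q j) x with hw
  -- The field q = m∇τ is curl-free, because m is rotation-invariant and ∇m is parallel to ∇τ.
  have hsym : ∀ i j : Fin 3, pd i.succ (q j) x = pd j.succ (q i) x := by
    intro i j
    rw [hdq, hdq, pd_comm F.smooth (natCast_le_infty 2) i.succ j.succ x,
      (rotInv_boostRatio hF).pd_mul_pd hmd hF hτd x i j]
  -- Up to scalar factors, each contribution to w is the gradient of a rotation-invariant function,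
  -- so w is parallel to q.
  have hpar : ∀ i j, q i x * w j = q j x * w i := by
    intro i j
    have e1 := (rotInv_boostScalar hF).pd_mul_pd hpd hF hτd x i j
    have e2 := (hF.rotInv_pd_zero hτd).pd_mul_pd (hτ1d 0) hF hτd x i j
    have e3 : ∀ k : Fin 3, pd 0 (pd k.succ F.τ) x = pd k.succ (pd 0 F.τ) x := fun k =>
      pd_comm F.smooth (natCast_le_infty 2) 0 k.succ x
    simp only [hw, hdq, e3]
    simp only [hq]
    linear_combination (-m x) * e1 + m x * m x * e2
  -- Symmetry of ∂_i q_j leaves only the trace of the quadratic terms, so no products of distinct α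
  -- survive. Multiplying by K adds none, because q and w are parallel, and the result is Hermitian.
  have hZ : ∑ a, D.alpha a * pd a (F.boost D) x = u • 1 + D.alphaVec w := by
    have e1 : ∑ i : Fin 3, D.alpha i.succ * pd i.succ (F.boost D) x
        = D.alphaVec (fun i => pd i.succ p x) - (∑ i : Fin 3, pd i.succ (q i) x) • 1 := by
      rw [← D.sum_alpha_mul_alpha (S := fun i j => pd i.succ (q j) x) hsym,
        DiracMatrices.alphaVec, ← Finset.sum_sub_distrib]
      refine Finset.sum_congr rfl fun i _ => ?_
      rw [pd_boost, Matrix.mul_sub, Matrix.mul_smul, Matrix.mul_one, DiracMatrices.alphaVec,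
        Finset.mul_sum]
      congr 1
      refine Finset.sum_congr rfl fun j _ => ?_
      rw [Matrix.mul_smul]
    have e2 : D.alphaVec w = D.alphaVec (fun i => pd i.succ p x)
        - D.alphaVec fun i => pd 0 (q i) x := by
      simp only [DiracMatrices.alphaVec, hw, sub_smul, Finset.sum_sub_distrib]
    rw [Fin.sum_univ_succ, D.alpha_zero, Matrix.one_mul, e1, pd_boost, e2, hu, sub_smul]
    abel
  have hX : ∑ a, F.boost D x * D.alpha a * pd a (F.boost D) x
      = (p x * u - ∑ i, q i x * w i) • (1 : Matrix (Fin 4) (Fin 4) ℂ)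
        + (p x • D.alphaVec w - u • D.alphaVec fun i => q i x) := by
    simp only [Matrix.mul_assoc]
    rw [← Finset.mul_sum, hZ, boost_eq, Matrix.sub_mul, Matrix.mul_add, Matrix.mul_add,
      D.alphaVec_mul_alphaVec (v := fun i => m x * pd i.succ F.τ x) hpar]
    simp only [Matrix.smul_mul, Matrix.mul_smul, Matrix.one_mul, Matrix.mul_one]
    module
  rw [hX, Matrix.conjTranspose_add, Matrix.conjTranspose_sub, Matrix.conjTranspose_smul,
    Matrix.conjTranspose_smul, Matrix.conjTranspose_smul, D.alphaVec_isHermitian,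
    D.alphaVec_isHermitian, Matrix.conjTranspose_one]
  simp

end
end CauchyFoliation

end

section

/-! ### The Dirac equation in adapted coordinates -/

namespace AdaptedCoordinates

variable (D : DiracMatrices) {F : CauchyFoliation} (C : AdaptedCoordinates F)

/-- The matrices `(g^{ττ})^{-1/2} K αᵃ K`. -/
def current (F : CauchyFoliation) (a : Fin 4) (x : Minkowski) : Matrix (Fin 4) (Fin 4) ℂ :=
  F.lapse x • (F.boost D x * D.alpha a * F.boost D x)

lemma current_isHermitian (a : Fin 4) (x : Minkowski) :
    (current D F a x).conjTranspose = current D F a x := by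
  rw [current, Matrix.conjTranspose_smul, Matrix.conjTranspose_mul, Matrix.conjTranspose_mul,
    F.boost_isHermitian, D.alpha_isHermitian, Matrix.mul_assoc]
  simp

/-- The components `λ^μ` of the current in adapted coordinates. -/
def lambda (μ : Fin 4) (x : Minkowski) : Matrix (Fin 4) (Fin 4) ℂ :=
  ∑ a, C.jac x μ a • current D F a x

lemma lambda_isHermitian (μ : Fin 4) (x : Minkowski) :
    (C.lambda D μ x).conjTranspose = C.lambda D μ x := by
  rw [lambda, Matrix.conjTranspose_sum]
  refine Finset.sum_congr rfl fun a _ => ?_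
  rw [Matrix.conjTranspose_smul, current_isHermitian]
  simp

lemma sum_smul_current (v : Fin 4 → ℝ) (x : Minkowski) :
    ∑ a, v a • current D F a x
      = F.lapse x • (F.boost D x * (D.γ 0 * ∑ a, ((v a : ℝ) : ℂ) • D.γ a) * F.boost D x) := by
  rw [Finset.mul_sum, Finset.mul_sum, Finset.sum_mul, Finset.smul_sum]
  refine Finset.sum_congr rfl fun a _ => ?_
  rw [current, Complex.coe_smul, Matrix.mul_smul, Matrix.mul_smul, Matrix.smul_mul, smul_comm]
  rfl

/-- With K⁻¹ = γ⁰Kγ⁰, the product μK⁻¹γ̂ⁱK becomes (g^{ττ})^{-1/2} Kγ⁰γ̂ⁱK, whose Hermiticity is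
visible. -/
lemma lambdaMatrix_eq (i : Fin 3) (x : Minkowski) :
    C.lambdaMatrix D i x = C.lambda D i.succ x := by
  rw [lambda, sum_smul_current, lambdaMatrix, F.boost_inv, CauchyFoliation.muMatrix,
    Complex.coe_smul, Matrix.smul_mul, ← Matrix.mul_assoc, ← Matrix.mul_assoc, ← Matrix.mul_assoc,
    ← Matrix.mul_assoc, D.gamma_zero_mul_self, Matrix.one_mul, ← Matrix.mul_assoc]
  rfl

/-- The time component contains γ(dτ), which is proportional to γ·n; the relations for K reduce it
to (γ⁰)² = 1. Thus the equation comes out already solved for the time derivative. -/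
lemma lambda_zero (x : Minkowski) : C.lambda D 0 x = 1 := by
  have h : ∑ a, ((C.jac x 0 a : ℝ) : ℂ) • D.γ a = gradSlash D F.τ x := by
    rw [gradSlash]
    exact Finset.sum_congr rfl fun a _ => by rw [jac_zero]
  rw [lambda, sum_smul_current, h]
  have h2 : F.lapse x • (F.boost D x * (D.γ 0 * gradSlash D F.τ x) * F.boost D x)
      = F.boost D x * D.γ 0 * (F.gammaNormal D x * F.boost D x) := by
    rw [F.gammaNormal_eq, Complex.coe_smul, Matrix.smul_mul, Matrix.mul_smul]
    simp only [Matrix.mul_assoc]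
  rw [h2, F.gammaNormal_mul_boost, ← Matrix.mul_assoc, F.boost_mul_gamma_mul_boost,
    D.gamma_zero_mul_self]

lemma muMatrix_isHermitian (x : Minkowski) :
    (F.muMatrix D x).conjTranspose = F.muMatrix D x := by
  rw [CauchyFoliation.muMatrix, Matrix.conjTranspose_smul, D.gamma_zero_isHermitian]
  simp

/-! ### Divergence of the current and the Schrödinger equation. -/

section

attribute [local instance] Matrix.linftyOpNormedRing Matrix.linftyOpNormedAlgebra

lemma contDiff_current (a : Fin 4) : ContDiff ℝ ∞ (current D F a) :=
  F.contDiff_lapse.smul (((F.contDiff_boost D).mul contDiff_const).mul (F.contDiff_boost D))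

lemma contDiff_lambda (μ : Fin 4) : ContDiff ℝ ∞ (C.lambda D μ) :=
  ContDiff.sum fun a _ => (C.contDiff_jac μ a).smul (contDiff_current D a)

lemma contDiff_muMatrix : ContDiff ℝ ∞ (F.muMatrix D) := by
  have h : F.muMatrix D = fun x => F.lapse x • D.γ 0 := funext fun x => Complex.coe_smul _ _
  rw [h]
  exact F.contDiff_lapse.smul contDiff_const

lemma hasDerivAt_cons (s : ℝ) (z : Space) : HasDerivAt (fun t : ℝ => (Fin.cons t z : Fin 4 → ℝ))
    (Pi.single 0 1) s := by
  refine hasDerivAt_pi.2 fun a => ?_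
  refine Fin.cases ?_ (fun i => ?_) a
  · exact (hasDerivAt_id' s).congr_deriv (by simp)
  · exact (hasDerivAt_const s (z i)).congr_deriv (by simp)

lemma hasDerivAt_comp_point {E : Type*} [NormedAddCommGroup E] [NormedSpace ℝ E]
    {f : Minkowski → E} (hf : Differentiable ℝ f) (s : ℝ) (z : Space) :
    HasDerivAt (fun t => f (C.point t z))
      (∑ b, C.jacInv (C.point s z) b 0 • pd b f (C.point s z)) s := by
  have h1 : HasDerivAt (fun t => C.point t z) (pd 0 C.ξ.symm (Fin.cons s z)) s :=
    (C.smooth_symm.differentiable (by simp) _).hasFDerivAt.comp_hasDerivAt s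
      (hasDerivAt_cons s z)
  have h2 := (hf (C.point s z)).hasFDerivAt.comp_hasDerivAt s h1
  rw [CauchyFoliation.fderiv_apply_eq_sum] at h2
  refine h2.congr_deriv (Finset.sum_congr rfl fun b _ => ?_)
  rw [jacInv, Matrix.of_apply, point, Equiv.apply_symm_apply]

lemma pd_comp_point {E : Type*} [NormedAddCommGroup E] [NormedSpace ℝ E]
    {f : Minkowski → E} (hf : Differentiable ℝ f) (i : Fin 3) (s : ℝ) (z : Space) :
    pd i (fun z => f (C.point s z)) z
      = ∑ b, C.jacInv (C.point s z) b i.succ • pd b f (C.point s z) := by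
  have h := ((hf (C.point s z)).hasFDerivAt.comp z
    ((C.contDiff_point_right s).differentiable (by simp) z).hasFDerivAt).fderiv
  change fderiv ℝ (f ∘ C.point s) z _ = _
  rw [h, ContinuousLinearMap.comp_apply, CauchyFoliation.fderiv_apply_eq_sum]
  refine Finset.sum_congr rfl fun b _ => ?_
  rw [← C.pd_point i s z b]
  rfl

lemma sum_jacInv_mul_jac (x : Minkowski) (b a : Fin 4) :
    ∑ μ, C.jacInv x b μ * C.jac x μ a = if b = a then 1 else 0 := by
  rw [← Matrix.mul_apply, jacInv_mul_jac, Matrix.one_apply]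

lemma pd_jac_comm (x : Minkowski) (a b μ : Fin 4) :
    pd b (fun y => C.jac y μ a) x = pd a (fun y => C.jac y μ b) x := by
  have h : ∀ a, (fun y => C.jac y μ a) = pd a fun y => C.ξ y μ := fun a =>
    funext fun y => C.pd_coord a μ y
  rw [h, h]
  exact pd_comm (contDiff_pi.1 C.smooth μ) (natCast_le_infty 2) b a x

/-- Jacobi's formula for the coordinate transformation. -/
lemma sum_jacInv_pd_jac (x : Minkowski) (a : Fin 4) :
    ∑ μ, ∑ b, C.jacInv x b μ * pd b (fun y => C.jac y μ a) x
      = pd a (fun y => (C.jac y).det) x / (C.jac x).det := by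
  rw [pd_det (fun i j => (C.contDiff_jac i j).differentiable (by simp) x), Finset.sum_div]
  refine Finset.sum_congr rfl fun μ _ => ?_
  rw [Finset.sum_div]
  refine Finset.sum_congr rfl fun b _ => ?_
  have h : (C.jac x).adjugate = (C.jac x).det • C.jacInv x := by
    calc (C.jac x).adjugate
        = (C.jac x).adjugate * (C.jac x * C.jacInv x) := by
          rw [jac_mul_jacInv, Matrix.mul_one]
      _ = _ := by rw [← Matrix.mul_assoc, Matrix.adjugate_mul, Matrix.smul_mul, Matrix.one_mul]
  have hd := C.det_jac_ne_zero x
  rw [h, Matrix.smul_apply, smul_eq_mul, pd_jac_comm]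
  field_simp

lemma pd_mul_real {n : ℕ} {f g : (Fin n → ℝ) → ℝ} {x : Fin n → ℝ} (hf : DifferentiableAt ℝ f x)
    (hg : DifferentiableAt ℝ g x) (a : Fin n) :
    pd a (fun y => f y * g y) x = f x * pd a g x + pd a f x * g x :=
  pd_smul hf hg a

/-- The logarithmic derivative of `|g_z|^{-1/4}`. -/
lemma log_deriv_weight (x : Minkowski) (a : Fin 4) :
    2 * (pd a C.weight x / C.weight x) = pd a (fun y => (C.jac y).det) x / (C.jac x).det
      + pd a F.lapse x / F.lapse x := by
  have hw := C.contDiff_weight.differentiable (by simp) x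
  have hd := C.contDiff_det_jac.differentiable (by simp) x
  have hl := F.contDiff_lapse.differentiable (by simp) x
  -- Fourth powers avoid both the fractional exponent and the absolute value of the Jacobian.
  have key : (fun y => C.weight y * C.weight y * (C.weight y * C.weight y))
      = fun y => (C.jac y).det * (C.jac y).det * (F.lapse y * F.lapse y) := by
    funext y
    rw [← sq, ← sq, ← sq, ← sq, weight_sq, mul_pow, sq_abs]
  have h : pd a (fun y => C.weight y * C.weight y * (C.weight y * C.weight y)) x
      = pd a (fun y => (C.jac y).det * (C.jac y).det * (F.lapse y * F.lapse y)) x := by rw [key]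
  rw [pd_mul_real (f := fun y => C.weight y * C.weight y) (g := fun y => C.weight y * C.weight y)
      (hw.mul hw) (hw.mul hw), pd_mul_real hw hw,
    pd_mul_real (f := fun y => (C.jac y).det * (C.jac y).det)
      (g := fun y => F.lapse y * F.lapse y) (hd.mul hd) (hl.mul hl), pd_mul_real hd hd, pd_mul_real hl hl] at h
  have h0 : C.weight x * C.weight x * (C.weight x * C.weight x)
      = (C.jac x).det * (C.jac x).det * (F.lapse x * F.lapse x) := congrFun key x
  have hw0 := (C.weight_pos x).ne'
  have hd0 := C.det_jac_ne_zero x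
  have hl0 := (F.lapse_pos x).ne'
  have e1 : 2 * (pd a C.weight x / C.weight x) =
      (4 * C.weight x ^ 3 * pd a C.weight x) / (2 * (C.weight x * C.weight x *
        (C.weight x * C.weight x))) := by
    field_simp; ring
  rw [e1, h0]
  have e2 : 4 * C.weight x ^ 3 * pd a C.weight x = (C.jac x).det * (C.jac x).det *
      (F.lapse x * pd a F.lapse x + pd a F.lapse x * F.lapse x) + ((C.jac x).det *
      pd a (fun y => (C.jac y).det) x + pd a (fun y => (C.jac y).det) x * (C.jac x).det) *
      (F.lapse x * F.lapse x) := by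
    rw [← h]; ring
  rw [e2]
  field_simp
  ring

/-- The zeroth order term of the Dirac operator in adapted coordinates. -/
def connection (x : Minkowski) : Matrix (Fin 4) (Fin 4) ℂ :=
  ∑ a, (F.lapse x / C.weight x) • (F.boost D x * D.alpha a * pd a (C.transfer D) x)

lemma pd_transfer (x : Minkowski) (a : Fin 4) :
    pd a (C.transfer D) x = C.weight x • pd a (F.boost D) x + pd a C.weight x • F.boost D x := by
  have h : C.transfer D = fun y => C.weight y • F.boost D y :=
    funext fun y => Complex.coe_smul _ _
  rw [h]
  exact pd_smul (C.contDiff_weight.differentiable (by simp) x)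
    ((F.contDiff_boost D).differentiable (by simp) x) a

lemma pd_current (x : Minkowski) (a b : Fin 4) :
    pd b (current D F a) x = F.lapse x • (F.boost D x * D.alpha a * pd b (F.boost D) x
      + pd b (F.boost D) x * D.alpha a * F.boost D x)
      + pd b F.lapse x • (F.boost D x * D.alpha a * F.boost D x) := by
  have hK := (F.contDiff_boost D).differentiable (by simp : (∞ : WithTop ℕ∞) ≠ 0) x
  have hl := F.contDiff_lapse.differentiable (by simp) x
  have h1 : pd b (fun y => F.boost D y * D.alpha a) x = pd b (F.boost D) x * D.alpha a := by
    rw [CauchyFoliation.pd_mul hK (differentiableAt_const _)]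
    simp [pd]
  have h2 := CauchyFoliation.pd_mul (hK.mul (differentiableAt_const (D.alpha a))) hK b
  have h3 := pd_smul hl ((hK.mul (differentiableAt_const (D.alpha a))).mul hK) b
  have e : current D F a = fun y => F.lapse y • (F.boost D y * D.alpha a * F.boost D y) := rfl
  rw [e]
  refine h3.trans ?_
  congr 2
  exact h2.trans (congrArg (fun M => _ + M * F.boost D x) h1)

/-- The derivative falls on either factor K. The two sums are adjoint to each other, and rotational
symmetry makes each of them Hermitian, so they are equal. -/
lemma sum_pd_current (hF : F.RotationallySymmetric) (x : Minkowski) :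
    ∑ a, pd a (current D F a) x = (2 * F.lapse x) • ∑ a, F.boost D x * D.alpha a *
      pd a (F.boost D) x + ∑ a, (pd a F.lapse x / F.lapse x) • current D F a x := by
  have hK := (F.contDiff_boost D).differentiable (by simp : (∞ : WithTop ℕ∞) ≠ 0) x
  have hX := CauchyFoliation.boost_connection_isHermitian D hF.rotInv x
  have hX' : ∑ a, pd a (F.boost D) x * D.alpha a * F.boost D x
      = ∑ a, F.boost D x * D.alpha a * pd a (F.boost D) x := by
    rw [← hX, Matrix.conjTranspose_sum]
    refine Finset.sum_congr rfl fun a _ => ?_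
    have h1 : (pd a (F.boost D) x).conjTranspose = pd a (F.boost D) x := by
      rw [← CauchyFoliation.pd_conjTranspose hK]
      congr 1
      funext y
      exact F.boost_isHermitian D y
    rw [Matrix.conjTranspose_mul, Matrix.conjTranspose_mul, h1, D.alpha_isHermitian,
      F.boost_isHermitian, Matrix.mul_assoc]
  simp only [pd_current, Finset.sum_add_distrib, smul_add, ← Finset.smul_sum]
  rw [hX', ← add_smul, two_mul]
  congr 1
  refine Finset.sum_congr rfl fun a _ => ?_
  rw [current, smul_smul, div_mul_cancel₀ _ (F.lapse_pos x).ne']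

lemma two_smul_connection (x : Minkowski) :
    (2 : ℝ) • C.connection D x = (2 * F.lapse x) • ∑ a, F.boost D x * D.alpha a *
      pd a (F.boost D) x + ∑ a, (2 * (pd a C.weight x / C.weight x)) • current D F a x := by
  rw [connection, Finset.smul_sum, Finset.smul_sum, ← Finset.sum_add_distrib]
  refine Finset.sum_congr rfl fun a _ => ?_
  have hw0 := (C.weight_pos x).ne'
  rw [pd_transfer, Matrix.mul_add, Matrix.mul_smul, Matrix.mul_smul, current, smul_add, smul_add,
    smul_smul, smul_smul, smul_smul, smul_smul, smul_smul]
  congr 2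
  · field_simp
  · field_simp

/-- The divergence in adapted coordinates collects derivatives of K, of the lapse and of the
Jacobian. The exponent -1/4 makes twice the logarithmic derivative of |g_z|^{-1/4} equal to the sum
of the last two contributions. -/
lemma sum_pd_lambda (hF : F.RotationallySymmetric) (x : Minkowski) :
    ∑ μ, ∑ b, C.jacInv x b μ • pd b (C.lambda D μ) x = (2 : ℝ) • C.connection D x := by
  have hA : ∀ μ a, DifferentiableAt ℝ (fun y => C.jac y μ a) x := fun μ a =>
    (C.contDiff_jac μ a).differentiable (by simp) x
  have hL : ∀ a, DifferentiableAt ℝ (current D F a) x := fun a =>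
    (contDiff_current D a).differentiable (by simp) x
  have h1 : ∀ μ b, pd b (C.lambda D μ) x = ∑ a, (C.jac x μ a • pd b (current D F a) x
      + pd b (fun y => C.jac y μ a) x • current D F a x) := by
    intro μ b
    have h := pd_sum Finset.univ (f := fun a y => C.jac y μ a • current D F a y)
      (fun a => (hA μ a).smul (hL a)) b
    refine h.trans (Finset.sum_congr rfl fun a _ => ?_)
    exact pd_smul (hA μ a) (hL a) b
  have h2 : ∑ μ, ∑ b, C.jacInv x b μ • pd b (C.lambda D μ) x
      = ∑ a, ∑ b, (∑ μ, C.jacInv x b μ * C.jac x μ a) • pd b (current D F a) x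
        + ∑ a, (∑ μ, ∑ b, C.jacInv x b μ * pd b (fun y => C.jac y μ a) x) •
          current D F a x := by
    simp only [h1, Finset.smul_sum, smul_add, Finset.sum_add_distrib, smul_smul, Finset.sum_smul]
    congr 1
    · rw [Finset.sum_comm]
      conv_rhs => rw [Finset.sum_comm]
      refine Finset.sum_congr rfl fun b _ => ?_
      rw [Finset.sum_comm]
    · conv_rhs => rw [Finset.sum_comm]
      refine Finset.sum_congr rfl fun μ _ => ?_
      rw [Finset.sum_comm]
  rw [h2]
  simp only [sum_jacInv_mul_jac, sum_jacInv_pd_jac, ite_smul, one_smul, zero_smul,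
    Finset.sum_ite_eq', Finset.mem_univ, if_true]
  rw [sum_pd_current D hF, two_smul_connection, add_assoc, ← Finset.sum_add_distrib]
  congr 1
  refine Finset.sum_congr rfl fun a _ => ?_
  rw [← add_smul, log_deriv_weight, add_comm]

/-- As λ⁰ = 1 is constant, the spatial divergence on Σ_s is already the full divergence. -/
lemma sum_pd_lambdaMatrix (hF : F.RotationallySymmetric) (s : ℝ) (z : Space) :
    ∑ i, pd i (fun z => C.lambdaMatrix D i (C.point s z)) z
      = (2 : ℝ) • C.connection D (C.point s z) := by
  rw [← C.sum_pd_lambda D hF]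
  conv_rhs => rw [Fin.sum_univ_succ]
  have h0 : ∀ b, pd b (C.lambda D 0) (C.point s z) = 0 := by
    intro b
    have : C.lambda D 0 = fun _ => 1 := funext fun x => C.lambda_zero D x
    rw [this]; simp [pd]
  simp only [h0, smul_zero, Finset.sum_const_zero, zero_add, lambdaMatrix_eq]
  refine Finset.sum_congr rfl fun i _ => ?_
  exact C.pd_comp_point ((C.contDiff_lambda D i.succ).differentiable (by simp)) i s z

/-- The anticommutator differs from -iλ^i∂_i by half the divergence of λ, which is exactly the
connection term. -/
lemma hamiltonian_eq (hF : F.RotationallySymmetric) (s : ℝ) {f : Space → Spinor}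
    (hf : Differentiable ℝ f) (z : Space) :
    C.hamiltonian D s f z = -(Complex.I • ∑ i : Fin 3,
        act (C.lambda D i.succ (C.point s z)) (pd i f z))
      - Complex.I • act (C.connection D (C.point s z)) (f z)
      + act (F.muMatrix D (C.point s z)) (f z) := by
  have hM : ∀ i, DifferentiableAt ℝ (fun z => C.lambdaMatrix D i (C.point s z)) z := by
    intro i
    have h : (fun z => C.lambdaMatrix D i (C.point s z))
        = fun z => C.lambda D i.succ (C.point s z) := funext fun z => C.lambdaMatrix_eq D i _
    rw [h]
    exact ((C.contDiff_lambda D i.succ).comp (C.contDiff_point_right s)).differentiable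
      (by simp) z
  have h1 : ∀ i, (1 / 2 : ℂ) • (act (C.lambdaMatrix D i (C.point s z)) (momentum i f z) +
      momentum i (fun z' => act (C.lambdaMatrix D i (C.point s z')) (f z')) z)
      = -(Complex.I • act (C.lambda D i.succ (C.point s z)) (pd i f z))
        - Complex.I • (1 / 2 : ℝ) • act (pd i (fun z => C.lambdaMatrix D i (C.point s z)) z)
          (f z) := by
    intro i
    rw [momentum, momentum, CauchyFoliation.pd_act (hM i) (hf z), lambdaMatrix_eq,
      ← Complex.coe_smul (1 / 2)]
    simp only [act, map_smul]
    push_cast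
    module
  have h2 := C.sum_pd_lambdaMatrix D hF s z
  have h3 : ∑ i, (1 / 2 : ℝ) • act (pd i (fun z => C.lambdaMatrix D i (C.point s z)) z) (f z)
      = act (C.connection D (C.point s z)) (f z) := by
    rw [← Finset.smul_sum, ← act_sum_matrix, h2, ← Complex.coe_smul (2 : ℝ), ← smul_act,
      Complex.coe_smul, smul_smul]
    norm_num
  rw [hamiltonian]
  simp only [h1]
  rw [Finset.sum_sub_distrib, Finset.sum_neg_distrib, ← Finset.smul_sum, ← Finset.smul_sum, h3]

/-- The Dirac equation in adapted coordinates, before separating the time derivative. -/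
lemma dirac_transferInv {ψ : Minkowski → Spinor} (hψ : IsDiracSolution D ψ) (x : Minkowski) :
    Complex.I • ∑ a, act (current D F a x)
        (pd a (fun y => act (C.transferInv D y) (ψ y)) x)
      + Complex.I • act (C.connection D x) (act (C.transferInv D x) (ψ x))
      = act (F.muMatrix D x) (act (C.transferInv D x) (ψ x)) := by
  set χ : Minkowski → Spinor := fun y => act (C.transferInv D y) (ψ y) with hχ
  have hχs : ContDiff ℝ ∞ χ := C.contDiff_act_transferInv D (k := ⊤) contDiff_id hψ.1
  have hψχ : ψ = fun y => act (C.transfer D y) (χ y) :=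
    funext fun y => (C.act_transfer_transferInv D y (ψ y)).symm
  have hd : ∀ a, pd a ψ x = act (C.transfer D x) (pd a χ x) + act (pd a (C.transfer D) x) (χ x) := by
    intro a
    conv_lhs => rw [hψχ]
    exact CauchyFoliation.pd_act ((C.contDiff_transfer D).differentiable (by simp) x)
      (hχs.differentiable (by simp) x) a
  have hw0 := (C.weight_pos x).ne'
  -- Multiplying the Dirac equation from the left by this matrix turns γᵃT into the Hermitian
  -- current and the mass term T into μ.
  set M : Matrix (Fin 4) (Fin 4) ℂ := (F.lapse x / C.weight x) • (F.boost D x * D.γ 0) with hM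
  have e1 : ∀ a, M * D.γ a * C.transfer D x = current D F a x := by
    intro a
    have hT : C.transfer D x = C.weight x • F.boost D x := Complex.coe_smul _ _
    rw [hM, hT, current, Matrix.mul_smul, Matrix.smul_mul, Matrix.smul_mul, smul_smul,
      DiracMatrices.alpha, ← Matrix.mul_assoc, mul_div_cancel₀ _ hw0]
  have e2 : ∀ a, M * D.γ a * pd a (C.transfer D) x
      = (F.lapse x / C.weight x) • (F.boost D x * D.alpha a * pd a (C.transfer D) x) := by
    intro a
    rw [hM, Matrix.smul_mul, Matrix.smul_mul, DiracMatrices.alpha, ← Matrix.mul_assoc]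
  have e3 : M * C.transfer D x = F.muMatrix D x := by
    have hT : C.transfer D x = C.weight x • F.boost D x := Complex.coe_smul _ _
    have hm : F.muMatrix D x = F.lapse x • D.γ 0 := Complex.coe_smul _ _
    rw [hM, hT, hm, Matrix.mul_smul, Matrix.smul_mul, smul_smul, F.boost_mul_gamma_mul_boost,
      mul_div_cancel₀ _ hw0]
  have h := congrArg (act M) (sub_eq_zero.1 (hψ.2 x))
  rw [show ψ x = act (C.transfer D x) (χ x) from congrFun hψχ x, act_act, e3] at h
  rw [← h, connection, act_sum_matrix, ← smul_add, ← Finset.sum_add_distrib, ← Finset.smul_sum]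
  simp only [act, map_smul, map_sum]
  congr 1
  refine Finset.sum_congr rfl fun a _ => ?_
  change act _ _ + act _ _ = act _ (act _ _)
  rw [hd, ← e1, ← e2, act_act M]
  simp only [← act_act]
  simp only [act, map_add]
  rfl

/-- The Schrödinger form of the Dirac equation. -/
theorem schroedinger (hF : F.RotationallySymmetric) {ψ : Minkowski → Spinor}
    (hψ : IsDiracSolution D ψ) (t : ℝ) (z : Space) :
    HasDerivAt (fun t => act (C.transferInv D (C.point t z)) (ψ (C.point t z)))
      (-Complex.I • C.hamiltonian D t
        (fun z => act (C.transferInv D (C.point t z)) (ψ (C.point t z))) z) t := by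
  set χ : Minkowski → Spinor := fun y => act (C.transferInv D y) (ψ y) with hχ
  have hχs : ContDiff ℝ ∞ χ := C.contDiff_act_transferInv D (k := ⊤) contDiff_id hψ.1
  have hχd : Differentiable ℝ χ := hχs.differentiable (by simp)
  set x := C.point t z with hx
  have hf : Differentiable ℝ fun z => χ (C.point t z) :=
    (hχs.comp (C.contDiff_point_right t)).differentiable (by simp)
  set d : Fin 4 → Spinor := fun μ => ∑ b, C.jacInv x b μ • pd b χ x with hd
  have h1 := C.hasDerivAt_comp_point hχd t z
  have h2 := C.hamiltonian_eq D hF t hf z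
  have h3 := C.dirac_transferInv D hψ x
  -- The chain rule: contracting the current with Cartesian derivatives equals contracting λ^μ with
  -- derivatives in ξ^μ.
  have h4 : ∑ a, act (current D F a x) (pd a χ x) = ∑ μ, act (C.lambda D μ x) (d μ) := by
    have e : ∀ μ, act (C.lambda D μ x) (d μ) = ∑ a, ∑ b, (C.jacInv x b μ * C.jac x μ a) •
        act (current D F a x) (pd b χ x) := by
      intro μ
      rw [lambda, act_sum_matrix]
      refine Finset.sum_congr rfl fun a _ => ?_
      rw [hd, ← actL_apply, map_sum]
      refine Finset.sum_congr rfl fun b _ => ?_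
      rw [map_smul, actL_apply, ← Complex.coe_smul (C.jac x μ a), ← smul_act, Complex.coe_smul,
        smul_smul]
    simp only [e]
    rw [Finset.sum_comm]
    refine Finset.sum_congr rfl fun a _ => ?_
    rw [Finset.sum_comm]
    simp only [← Finset.sum_smul, sum_jacInv_mul_jac, ite_smul, one_smul, zero_smul,
      Finset.sum_ite_eq', Finset.mem_univ, if_true]
  refine h1.congr_deriv ?_
  change d 0 = _
  have h5 : ∀ i : Fin 3, pd i (fun z => χ (C.point t z)) z = d i.succ := fun i =>
    C.pd_comp_point hχd i t z
  change _ = -Complex.I • C.hamiltonian D t (fun z => χ (C.point t z)) z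
  rw [h2]
  simp only [h5]
  rw [h4, Fin.sum_univ_succ, lambda_zero, act_one] at h3
  change Complex.I • (d 0 + ∑ i : Fin 3, act (C.lambda D i.succ x) (d i.succ))
    + Complex.I • act (C.connection D x) (χ x) = act (F.muMatrix D x) (χ x) at h3
  rw [← h3, neg_smul, smul_add, smul_sub, smul_neg, smul_add, smul_add, smul_add]
  simp only [smul_smul, Complex.I_mul_I]
  module

end
end AdaptedCoordinates

end

section

/-! ### Families of smooth compactly supported functions in `L²` -/

/-- On a fixed compact set the L² norm is bounded by the supremum times the square root of the
volume. This converts uniform estimates into norm estimates. -/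
lemma exists_norm_toL2_le {L : Set Space} (hL : IsCompact L) :
    ∃ c : ℝ, 0 ≤ c ∧ ∀ (φ : TestSpinor) (M : ℝ), 0 ≤ M → (∀ z ∉ L, φ.1 z = 0) →
      (∀ z ∈ L, ‖φ.1 z‖ ≤ M) → ‖toL2 φ‖ ≤ c * M := by
  refine ⟨((volume L) ^ (2 : ENNReal).toReal⁻¹).toReal, ENNReal.toReal_nonneg,
    fun φ M hM h0 hb => ?_⟩
  have hfin : (volume L) ^ (2 : ENNReal).toReal⁻¹ ≠ ⊤ :=
    ENNReal.rpow_ne_top_of_nonneg (by positivity) hL.measure_lt_top.ne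
  have h1 : ‖toL2 φ‖ = (eLpNorm φ.1 2 volume).toReal :=
    Lp.norm_toLp _ (φ.2.1.continuous.memLp_of_hasCompactSupport φ.2.2)
  have h2 : eLpNorm φ.1 2 volume ≤ (volume L) ^ (2 : ENNReal).toReal⁻¹ * ENNReal.ofReal M := by
    rw [← eLpNorm_restrict_eq_of_support_subset (s := L) (fun z hz => by
      by_contra h
      exact hz (h0 z h))]
    have h3 := eLpNorm_le_of_ae_bound (p := 2) (μ := volume.restrict L) (f := φ.1) (C := M)
      (ae_of_all _ fun z => by
        by_cases hz : z ∈ L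
        · exact hb z hz
        · rw [h0 z hz, norm_zero]; exact hM)
    rwa [Measure.restrict_apply_univ] at h3
  rw [h1]
  refine (ENNReal.toReal_mono (ENNReal.mul_ne_top hfin ENNReal.ofReal_ne_top) h2).trans ?_
  rw [ENNReal.toReal_mul, ENNReal.toReal_ofReal hM]

/-- The tube lemma over the compact set L makes the continuity in p uniform in z. -/
lemma eventually_norm_sub_lt {P : Type*} [TopologicalSpace P] {L : Set Space} (hL : IsCompact L)
    {g : P × Space → Spinor} (hg : Continuous g) (p₀ : P) {ε : ℝ} (hε : 0 < ε) :
    ∀ᶠ p in nhds p₀, ∀ z ∈ L, ‖g (p, z) - g (p₀, z)‖ < ε := by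
  have hO : IsOpen {q : P × Space | ‖g q - g (p₀, q.2)‖ < ε} :=
    isOpen_lt (by fun_prop) continuous_const
  obtain ⟨u, v, hu, -, hpu, hLv, huv⟩ := generalized_tube_lemma (isCompact_singleton (x := p₀)) hL
    hO (by
      rintro ⟨p, z⟩ ⟨hp, -⟩
      have hp : p = p₀ := hp
      simpa [hp] using hε)
  filter_upwards [hu.mem_nhds (hpu rfl)] with p hp z hz
  exact huv (show (p, z) ∈ u ×ˢ v from ⟨hp, hLv hz⟩)

lemma continuousAt_toL2 {P : Type*} [TopologicalSpace P] {f : P → TestSpinor} {p₀ : P}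
    {L : Set Space} (hL : IsCompact L) {g : P × Space → Spinor} (hg : Continuous g)
    (h : ∀ᶠ p in nhds p₀, ∀ z, (f p).1 z = g (p, z) ∧ (z ∉ L → (f p).1 z = 0)) :
    ContinuousAt (fun p => toL2 (f p)) p₀ := by
  obtain ⟨c, hc, hb⟩ := exists_norm_toL2_le hL
  rw [Metric.continuousAt_iff']
  intro ε hε
  have hε' : 0 < ε / (c + 1) := by positivity
  filter_upwards [h, eventually_norm_sub_lt hL hg p₀ hε'] with p hp hp2
  have h0 := h.self_of_nhds
  rw [dist_eq_norm, ← map_sub]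
  refine (hb (f p - f p₀) (ε / (c + 1)) hε'.le (fun z hz => ?_) fun z hz => ?_).trans_lt ?_
  · change (f p).1 z - (f p₀).1 z = 0
    rw [(hp z).2 hz, (h0 z).2 hz, sub_zero]
  · change ‖(f p).1 z - (f p₀).1 z‖ ≤ _
    rw [(hp z).1, (h0 z).1]
    exact (hp2 z hz).le
  · rw [mul_div_assoc', div_lt_iff₀ (by positivity)]
    nlinarith

/-- The mean value inequality, uniform over the common compact support, upgrades pointwise
differentiability to differentiability in L². -/
lemma hasDerivAt_toL2 {f d : ℝ → TestSpinor} {t₀ δ : ℝ} (hδ : 0 < δ) {L : Set Space}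
    (hL : IsCompact L) {g : ℝ × Space → Spinor} (hg : Continuous g)
    (hd : ∀ t ∈ Metric.ball t₀ δ, ∀ z, HasDerivAt (fun r => (f r).1 z) ((d t).1 z) t)
    (hdg : ∀ t ∈ Metric.ball t₀ δ, ∀ z, (d t).1 z = g (t, z))
    (hf : ∀ t ∈ Metric.ball t₀ δ, ∀ z ∉ L, (f t).1 z = 0) :
    HasDerivAt (fun t => toL2 (f t)) (toL2 (d t₀)) t₀ := by
  obtain ⟨c, hc, hb⟩ := exists_norm_toL2_le hL
  have ht₀ : t₀ ∈ Metric.ball t₀ δ := Metric.mem_ball_self hδ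
  have hd0 : ∀ z ∉ L, (d t₀).1 z = 0 := by
    intro z hz
    have h1 : (fun r => (f r).1 z) =ᶠ[nhds t₀] fun _ => 0 := by
      filter_upwards [Metric.ball_mem_nhds t₀ hδ] with r hr
      exact hf r hr z hz
    exact (hd t₀ ht₀ z).unique ((hasDerivAt_const t₀ (0 : Spinor)).congr_of_eventuallyEq h1)
  rw [hasDerivAt_iff_isLittleO, Asymptotics.isLittleO_iff]
  intro ε hε
  have hε' : 0 < ε / (c + 1) := by positivity
  obtain ⟨δ', hδ', h'⟩ := Metric.eventually_nhds_iff_ball.1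
    (eventually_norm_sub_lt hL hg t₀ hε')
  filter_upwards [Metric.ball_mem_nhds t₀ (lt_min hδ hδ')] with t ht
  have hsub1 : Metric.ball t₀ (min δ δ') ⊆ Metric.ball t₀ δ :=
    Metric.ball_subset_ball (min_le_left _ _)
  have hsub2 : Metric.ball t₀ (min δ δ') ⊆ Metric.ball t₀ δ' :=
    Metric.ball_subset_ball (min_le_right _ _)
  have e : toL2 (f t) - toL2 (f t₀) - (t - t₀) • toL2 (d t₀)
      = toL2 (f t - f t₀ - ((t - t₀ : ℝ) : ℂ) • d t₀) := by
    rw [map_sub, map_sub, map_smul, Complex.coe_smul]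
    rfl
  rw [e]
  refine (hb _ (ε / (c + 1) * ‖t - t₀‖) (by positivity) (fun z hz => ?_) fun z hz => ?_).trans ?_
  · change (f t).1 z - (f t₀).1 z - ((t - t₀ : ℝ) : ℂ) • (d t₀).1 z = 0
    rw [hf t (hsub1 ht) z hz, hf t₀ ht₀ z hz, hd0 z hz]
    simp
  · change ‖(f t).1 z - (f t₀).1 z - ((t - t₀ : ℝ) : ℂ) • (d t₀).1 z‖ ≤ _
    have hF : ∀ r ∈ Metric.ball t₀ (min δ δ'), HasDerivWithinAt
        (fun r => (f r).1 z - ((r - t₀ : ℝ)) • (d t₀).1 z) ((d r).1 z - (d t₀).1 z)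
        (Metric.ball t₀ (min δ δ')) r := by
      intro r hr
      have h2 : HasDerivAt (fun r : ℝ => (r - t₀) • (d t₀).1 z) ((d t₀).1 z) r := by
        simpa using ((hasDerivAt_id r).sub_const t₀).smul_const ((d t₀).1 z)
      exact ((hd r (hsub1 hr) z).sub h2).hasDerivWithinAt
    have h3 := (convex_ball t₀ (min δ δ')).norm_image_sub_le_of_norm_hasDerivWithin_le hF
      (C := ε / (c + 1)) (fun r hr => by
        rw [hdg r (hsub1 hr), hdg t₀ ht₀]
        exact (h' r (hsub2 hr) z hz).le) (Metric.mem_ball_self (lt_min hδ hδ')) ht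
    rw [Complex.coe_smul]
    refine le_of_eq_of_le (congrArg norm ?_) h3
    simp only [sub_self, zero_smul, sub_zero]
    abel
  · rw [← mul_assoc, mul_div_assoc']
    gcongr
    rw [div_le_iff₀ (by positivity)]
    nlinarith

/-! ### Differential operators on smooth compactly supported functions -/

lemma inner_toL2 (φ χ : TestSpinor) :
    inner ℂ (toL2 φ) (toL2 χ) = ∫ z, inner ℂ (φ.1 z) (χ.1 z) := by
  rw [L2.inner_def]
  refine integral_congr_ae ?_
  filter_upwards [toL2_coeFn φ, toL2_coeFn χ] with z h1 h2
  rw [h1, h2]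

/-- The momentum operator on smooth compactly supported functions. -/
def momentumTest (i : Fin 3) : TestSpinor →ₗ[ℂ] TestSpinor where
  toFun φ := ⟨fun z => momentum i φ.1 z,
    (contDiff_pd (m := ∞) φ.2.1 (by simp) i).const_smul (-Complex.I),
    (hasCompactSupport_pd φ.2.2 i).mono fun z hz h => hz (by simp [momentum, h])⟩
  map_add' φ χ := by
    apply Subtype.ext
    funext z
    change momentum i (fun y => φ.1 y + χ.1 y) z = momentum i φ.1 z + momentum i χ.1 z
    rw [momentum, pd_add (φ.2.1.differentiable (by simp) z) (χ.2.1.differentiable (by simp) z),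
      smul_add]
    rfl
  map_smul' c φ := by
    apply Subtype.ext
    funext z
    change momentum i (fun y => c • φ.1 y) z = c • momentum i φ.1 z
    have h : pd i (fun y => c • φ.1 y) z = c • pd i φ.1 z := by
      rw [pd, fderiv_fun_const_smul (φ.2.1.differentiable (by simp) z)]; rfl
    rw [momentum, momentum, h, smul_comm]

lemma momentumTest_apply (i : Fin 3) (φ : TestSpinor) :
    (momentumTest i φ).1 = momentum i φ.1 := rfl

lemma integrable_inner_test {f g : Space → Spinor} (hf : Continuous f) (hg : Continuous g)
    (hfc : HasCompactSupport f) : Integrable fun z => inner ℂ (f z) (g z) :=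
  (hf.inner hg).integrable_of_hasCompactSupport (hfc.mono fun z hz h => hz (by simp [h]))

/-- The Hermitian product of spinors as a real bilinear map. -/
def innerBilin : Spinor →L[ℝ] Spinor →L[ℝ] ℂ :=
  LinearMap.toContinuousLinearMap
    { toFun := fun v => (innerSL ℂ v).restrictScalars ℝ
      map_add' := fun v w => by ext1 u; simp
      map_smul' := fun c v => by
        ext1 u
        simp [← Complex.coe_smul] }

lemma integral_inner_pd (i : Fin 3) (φ χ : TestSpinor) :
    ∫ z, inner ℂ (φ.1 z) (pd i χ.1 z) = -∫ z, inner ℂ (pd i φ.1 z) (χ.1 z) :=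
  integral_bilinear_fderiv_right_eq_neg_left_of_integrable (B := innerBilin) (μ := volume)
    (f := φ.1) (g := χ.1) (v := Pi.single i 1)
    (integrable_inner_test (continuous_pd φ.2.1 (by simp) i) χ.2.1.continuous
      (hasCompactSupport_pd φ.2.2 i))
    (integrable_inner_test φ.2.1.continuous (continuous_pd χ.2.1 (by simp) i) φ.2.2)
    (integrable_inner_test φ.2.1.continuous χ.2.1.continuous φ.2.2)
    (fun z _ => φ.2.1.differentiable (by simp) z) (fun z _ => χ.2.1.differentiable (by simp) z)

lemma momentumTest_symmetric (i : Fin 3) (φ χ : TestSpinor) :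
    inner ℂ (toL2 (momentumTest i φ)) (toL2 χ) = inner ℂ (toL2 φ) (toL2 (momentumTest i χ)) := by
  rw [inner_toL2, inner_toL2]
  have h := integral_inner_pd i φ χ
  simp only [momentumTest_apply, momentum, inner_smul_left, inner_smul_right]
  rw [integral_const_mul, integral_const_mul, h]
  simp

section

attribute [local instance] Matrix.linftyOpNormedRing Matrix.linftyOpNormedAlgebra

/-- Multiplication by a smooth matrix function. -/
def mulTest (M : Space → Matrix (Fin 4) (Fin 4) ℂ) (hM : ContDiff ℝ ∞ M) :
    TestSpinor →ₗ[ℂ] TestSpinor where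
  toFun φ := ⟨fun z => act (M z) (φ.1 z), CauchyFoliation.contDiff_act hM φ.2.1,
    φ.2.2.mono fun z hz h => hz (by simp [h])⟩
  map_add' φ χ := by
    apply Subtype.ext
    funext z
    simp [act]
  map_smul' c φ := by
    apply Subtype.ext
    funext z
    simp [act]

lemma mulTest_symmetric {M : Space → Matrix (Fin 4) (Fin 4) ℂ} (hM : ContDiff ℝ ∞ M)
    (h : ∀ z, (M z).conjTranspose = M z) (φ χ : TestSpinor) :
    inner ℂ (toL2 (mulTest M hM φ)) (toL2 χ) = inner ℂ (toL2 φ) (toL2 (mulTest M hM χ)) := by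
  rw [inner_toL2, inner_toL2]
  exact integral_congr_ae (ae_of_all _ fun z => CauchyFoliation.inner_act_left (h z) _ _)

lemma contDiff_sq_smul_one : ContDiff ℝ ∞ fun z : Space =>
    (∑ i, z i ^ 2 : ℝ) • (1 : Matrix (Fin 4) (Fin 4) ℂ) := by
  have h : ContDiff ℝ ∞ fun z : Space => (∑ i, z i ^ 2 : ℝ) :=
    ContDiff.sum fun i _ => (contDiff_apply ℝ ℝ i).pow 2
  exact h.smul contDiff_const

/-- The operator `h₀` on smooth compactly supported functions. -/
def oscillatorTest : TestSpinor →ₗ[ℂ] TestSpinor :=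
  (1 / 2 : ℂ) • (∑ i, momentumTest i ∘ₗ momentumTest i
    + mulTest _ contDiff_sq_smul_one)

lemma testSpinor_sum_apply {ι : Type*} (s : Finset ι) (φ : ι → TestSpinor) (z : Space) :
    (∑ i ∈ s, φ i).1 z = ∑ i ∈ s, (φ i).1 z := by
  have h := map_sum TestSpinor.subtype φ s
  have h' : (∑ i ∈ s, φ i).1 = ∑ i ∈ s, (φ i).1 := h
  rw [h', Finset.sum_apply]

lemma oscillatorTest_apply (φ : TestSpinor) (z : Space) :
    (oscillatorTest φ).1 z = oscillator φ.1 z := by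
  have h : (oscillatorTest φ).1 z = (1 / 2 : ℂ) • ((∑ i, momentumTest i (momentumTest i φ)).1 z
      + act ((∑ i, z i ^ 2 : ℝ) • (1 : Matrix (Fin 4) (Fin 4) ℂ)) (φ.1 z)) := by
    rw [oscillatorTest, LinearMap.smul_apply, LinearMap.add_apply, LinearMap.sum_apply]
    rfl
  have h1 : act ((∑ i, z i ^ 2 : ℝ) • (1 : Matrix (Fin 4) (Fin 4) ℂ)) (φ.1 z)
      = ((∑ i, z i ^ 2 : ℝ) : ℂ) • φ.1 z := by
    rw [← Complex.coe_smul]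
    simp [act]
  rw [h, testSpinor_sum_apply, oscillator, h1]
  rfl

namespace AdaptedCoordinates

variable (D : DiracMatrices) {F : CauchyFoliation} (C : AdaptedCoordinates F)

lemma contDiff_lambdaMatrix_point (i : Fin 3) (s : ℝ) :
    ContDiff ℝ ∞ fun z => C.lambdaMatrix D i (C.point s z) := by
  simp only [lambdaMatrix_eq]
  exact (C.contDiff_lambda D i.succ).comp (C.contDiff_point_right s)

/-- The operator `H₀(s)` on smooth compactly supported functions. -/
def hamiltonianTest (s : ℝ) : TestSpinor →ₗ[ℂ] TestSpinor :=
  ∑ i, (1 / 2 : ℂ) • (mulTest _ (C.contDiff_lambdaMatrix_point D i s) ∘ₗ momentumTest i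
    + momentumTest i ∘ₗ mulTest _ (C.contDiff_lambdaMatrix_point D i s))
  + mulTest (fun z => F.muMatrix D (C.point s z))
      ((contDiff_muMatrix D).comp (C.contDiff_point_right s))

lemma hamiltonianTest_apply (s : ℝ) (φ : TestSpinor) (z : Space) :
    (C.hamiltonianTest D s φ).1 z = C.hamiltonian D s φ.1 z := by
  have h : (C.hamiltonianTest D s φ).1 z = (∑ i, (1 / 2 : ℂ) •
      (mulTest _ (C.contDiff_lambdaMatrix_point D i s) (momentumTest i φ)
      + momentumTest i (mulTest _ (C.contDiff_lambdaMatrix_point D i s) φ))).1 z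
      + act (F.muMatrix D (C.point s z)) (φ.1 z) := by
    rw [hamiltonianTest, LinearMap.add_apply, LinearMap.sum_apply]
    rfl
  rw [h, testSpinor_sum_apply, hamiltonian]
  rfl

/-- Multiplication by λ^i and the momenta are symmetric; taking adjoints exchanges the two products
in each anticommutator. -/
lemma hamiltonianTest_symmetric (s : ℝ) (φ χ : TestSpinor) :
    inner ℂ (toL2 (C.hamiltonianTest D s φ)) (toL2 χ)
      = inner ℂ (toL2 φ) (toL2 (C.hamiltonianTest D s χ)) := by
  have hl : ∀ i z, (C.lambdaMatrix D i (C.point s z)).conjTranspose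
      = C.lambdaMatrix D i (C.point s z) := fun i z => by
    rw [lambdaMatrix_eq, lambda_isHermitian]
  simp only [hamiltonianTest, LinearMap.add_apply, LinearMap.sum_apply, LinearMap.smul_apply,
    LinearMap.comp_apply, map_add, map_sum, map_smul, inner_add_left, inner_add_right, sum_inner,
    inner_sum, inner_smul_left, inner_smul_right]
  rw [mulTest_symmetric _ fun z => muMatrix_isHermitian D _]
  congr 1
  refine Finset.sum_congr rfl fun i _ => ?_
  rw [mulTest_symmetric _ (hl i), momentumTest_symmetric, momentumTest_symmetric,
    mulTest_symmetric _ (hl i), add_comm]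
  congr 1
  simp [Complex.conj_ofNat]

end AdaptedCoordinates
end

end

section

/-! ### The evolution of smooth compactly supported functions in adapted coordinates -/

lemma act_zero (M : Matrix (Fin 4) (Fin 4) ℂ) : act M 0 = 0 := map_zero _

namespace AdaptedCoordinates

variable (D : DiracMatrices) {F : CauchyFoliation} (C : AdaptedCoordinates F)

section

attribute [local instance] Matrix.linftyOpNormedRing Matrix.linftyOpNormedAlgebra

variable {P : Type*} [NormedAddCommGroup P] [NormedSpace ℝ P]

lemma contDiff_act_lambdaMatrix (i : Fin 3) {r : P → ℝ} (hr : ContDiff ℝ ∞ r)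
    {v : P × Space → Spinor} (hv : ContDiff ℝ ∞ v) : ContDiff ℝ ∞ fun q : P × Space =>
      act (C.lambdaMatrix D i (C.point (r q.1) q.2)) (v q) := by
  simp only [lambdaMatrix_eq]
  exact CauchyFoliation.contDiff_act ((C.contDiff_lambda D i.succ).comp
    (C.contDiff_point.comp ((hr.comp contDiff_fst).prodMk contDiff_snd))) hv

lemma contDiff_act_muMatrix {r : P → ℝ} (hr : ContDiff ℝ ∞ r)
    {v : P × Space → Spinor} (hv : ContDiff ℝ ∞ v) : ContDiff ℝ ∞ fun q : P × Space =>
      act (F.muMatrix D (C.point (r q.1) q.2)) (v q) :=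
  CauchyFoliation.contDiff_act ((contDiff_muMatrix D).comp
    (C.contDiff_point.comp ((hr.comp contDiff_fst).prodMk contDiff_snd))) hv

end

variable {P : Type*} [NormedAddCommGroup P] [NormedSpace ℝ P]

lemma contDiff_momentum_param (i : Fin 3) {v : P × Space → Spinor} (hv : ContDiff ℝ ∞ v) :
    ContDiff ℝ ∞ fun q : P × Space => momentum i (fun z => v (q.1, z)) q.2 :=
  (contDiff_pd_param (m := ∞) hv (by simp) i).const_smul (-Complex.I)

lemma contDiff_hamiltonian_param {r : P → ℝ} (hr : ContDiff ℝ ∞ r) {v : P × Space → Spinor}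
    (hv : ContDiff ℝ ∞ v) : ContDiff ℝ ∞ fun q : P × Space =>
      C.hamiltonian D (r q.1) (fun z => v (q.1, z)) q.2 := by
  refine ContDiff.add (ContDiff.sum fun i _ => ContDiff.const_smul _ (ContDiff.add ?_ ?_)) ?_
  · exact C.contDiff_act_lambdaMatrix D i hr (contDiff_momentum_param i hv)
  · exact contDiff_momentum_param i (C.contDiff_act_lambdaMatrix D i hr hv)
  · exact C.contDiff_act_muMatrix D hr hv

lemma contDiff_oscillator_param {v : P × Space → Spinor} (hv : ContDiff ℝ ∞ v) :
    ContDiff ℝ ∞ fun q : P × Space => oscillator (fun z => v (q.1, z)) q.2 := by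
  refine ContDiff.const_smul _ (ContDiff.add (ContDiff.sum fun i _ => ?_) ?_)
  · exact contDiff_momentum_param i (contDiff_momentum_param i hv)
  · simp only [Complex.coe_smul]
    have h : ContDiff ℝ ∞ fun q : P × Space => (∑ i, q.2 i ^ 2 : ℝ) :=
      ContDiff.sum fun i _ => ((contDiff_apply ℝ ℝ i).comp contDiff_snd).pow 2
    exact h.smul hv

/-- The Dirac evolution on `C₀^∞(ℝ³, ℂ⁴)`. -/
def evolutionTest (t s : ℝ) : TestSpinor ≃ₗ[ℂ] TestSpinor :=
  (C.transferTest D s).trans ((CauchyFoliation.evolution D F t s).trans (C.transferTest D t).symm)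

lemma evolutionTest_apply (t s : ℝ) (φ : TestSpinor) (z : Space) :
    (C.evolutionTest D t s φ).1 z = act (C.transferInv D (C.point t z))
      (CauchyFoliation.solution D (C.transferTest D s φ) (C.point t z)) := rfl

lemma transferTest_evolutionTest (t s : ℝ) (φ : TestSpinor) :
    C.transferTest D t (C.evolutionTest D t s φ)
      = CauchyFoliation.evolution D F t s (C.transferTest D s φ) :=
  (C.transferTest D t).apply_symm_apply _

lemma evolutionTest_self (s : ℝ) (φ : TestSpinor) : C.evolutionTest D s s φ = φ := by
  apply (C.transferTest D s).injective
  rw [transferTest_evolutionTest, CauchyFoliation.evolution_apply, CauchyFoliation.evolve_self]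

lemma evolutionTest_evolutionTest (t r s : ℝ) (φ : TestSpinor) :
    C.evolutionTest D t r (C.evolutionTest D r s φ) = C.evolutionTest D t s φ := by
  apply (C.transferTest D t).injective
  simp only [transferTest_evolutionTest, CauchyFoliation.evolution_apply,
    CauchyFoliation.evolve_evolve]

lemma space_mem_tsupport {s : ℝ} {φ : TestSpinor} {x : F.Slice s}
    (hx : x ∈ tsupport (C.transferTest D s φ).1) : C.space x.1 ∈ tsupport φ.1 := by
  have hcl : IsClosed ((C.sliceHomeo s) ⁻¹' tsupport φ.1) :=
    (isClosed_tsupport _).preimage (C.sliceHomeo s).continuous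
  have hsub : Function.support (C.transferTest D s φ).1 ⊆ (C.sliceHomeo s) ⁻¹' tsupport φ.1 := by
    intro y hy
    refine subset_tsupport φ.1 fun h => hy ?_
    have h : φ.1 (C.space y.1) = 0 := h
    change act (C.transfer D y.1) (φ.1 (C.space y.1)) = 0
    rw [h, act_zero]
  exact closure_minimal hsub hcl hx

lemma exists_related_of_solution_ne_zero {s : ℝ} {φ : TestSpinor} {x : Minkowski}
    (hx : CauchyFoliation.solution D (C.transferTest D s φ) x ≠ 0) :
    ∃ w ∈ tsupport φ.1, CausallyRelated x (C.point s w) := by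
  by_contra! h
  refine hx (CauchyFoliation.solution_eq_zero _ fun y hy => ?_)
  have h1 := h _ (C.space_mem_tsupport D hy)
  rwa [C.point_space y.2] at h1

lemma evolutionTest_causal (t s : ℝ) (φ : TestSpinor) :
    ∀ z ∈ tsupport (C.evolutionTest D t s φ).1,
      ∃ w ∈ tsupport φ.1, CausallyRelated (C.point t z) (C.point s w) := by
  intro z hz
  have hcl := (CauchyFoliation.isClosed_related (φ.2.2.isCompact.image
    (C.contDiff_point_right s).continuous)).preimage (C.contDiff_point_right t).continuous
  obtain ⟨-, ⟨w, hw, rfl⟩, h⟩ := closure_minimal (fun z hz => by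
    have h0 : CauchyFoliation.solution D (C.transferTest D s φ) (C.point t z) ≠ 0 := fun h =>
      hz (by rw [evolutionTest_apply, h, act_zero])
    obtain ⟨w, hw, h⟩ := C.exists_related_of_solution_ne_zero D h0
    exact ⟨_, ⟨w, hw, rfl⟩, h⟩) hcl hz
  exact ⟨w, hw, h⟩

/-- For |s| ≤ R all transferred data T_sφ are restrictions of one compactly supported function on
Minkowski space, so a single jointly smooth family of solutions describes them. The supports stay in
one compact set by causality. All regularity in (t, s) rests on this. -/
lemma exists_smooth_evolutionTest (φ : TestSpinor) (R : ℝ) :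
    ∃ v : (ℝ × ℝ) × Space → Spinor, ContDiff ℝ ∞ v ∧ ∃ L : Set Space, IsCompact L ∧
      ∀ t s : ℝ, |t| ≤ R → |s| ≤ R → ∀ z, (C.evolutionTest D t s φ).1 z = v ((t, s), z) ∧
        (z ∉ L → (C.evolutionTest D t s φ).1 z = 0) := by
  set K : Set Minkowski := (fun p : ℝ × Space => C.point p.1 p.2) '' (Set.Icc (-R) R ×ˢ tsupport φ.1)
  have hK : IsCompact K :=
    (isCompact_Icc.prod φ.2.2.isCompact).image C.contDiff_point.continuous
  obtain ⟨θ, hθ, hθc, -, hθ1⟩ := exists_cutoff hK isOpen_univ (Set.subset_univ K)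
  have hG : ContDiff ℝ ∞ fun x => θ x • act (C.transfer D x) (φ.1 (C.space x)) :=
    hθ.smul (C.contDiff_act_transfer D (k := ⊤) contDiff_id (φ.2.1.comp C.contDiff_space))
  have hGc : HasCompactSupport fun x => θ x • act (C.transfer D x) (φ.1 (C.space x)) :=
    hθc.smul_right
  obtain ⟨Ψ, hΨ, hs⟩ := F.exists_smooth_solution D hG hGc
  obtain ⟨L, hL, hKL⟩ := F.exists_isCompact_related hK (-R) R
  have hsol : ∀ s : ℝ, |s| ≤ R →
      (fun x => Ψ (s, x)) = CauchyFoliation.solution D (C.transferTest D s φ) := by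
    intro s hsR
    refine CauchyFoliation.eq_solution (hs s).1 fun x => ?_
    rw [(hs s).2 x.1 x.2]
    change θ x.1 • act (C.transfer D x.1) (φ.1 (C.space x.1))
      = act (C.transfer D x.1) (φ.1 (C.space x.1))
    by_cases hx : C.space x.1 ∈ tsupport φ.1
    · have hxK : x.1 ∈ K := ⟨(s, C.space x.1), ⟨abs_le.1 hsR, hx⟩, C.point_space x.2⟩
      rw [(hθ1 x.1 hxK).self_of_nhds, one_smul]
    · rw [image_eq_zero_of_notMem_tsupport hx, act_zero, smul_zero]
  refine ⟨fun q => act (C.transferInv D (C.point q.1.1 q.2)) (Ψ (q.1.2, C.point q.1.1 q.2)), ?_,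
    C.space '' L, hL.image C.contDiff_space.continuous, fun t s ht hsR z => ⟨?_, fun hz => ?_⟩⟩
  · have hp : ContDiff ℝ ∞ fun q : (ℝ × ℝ) × Space => C.point q.1.1 q.2 :=
      C.contDiff_point.comp ((contDiff_fst.comp contDiff_fst).prodMk contDiff_snd)
    exact C.contDiff_act_transferInv D (k := ⊤) hp
      (hΨ.comp ((contDiff_snd.comp contDiff_fst).prodMk hp))
  · rw [evolutionTest_apply, ← hsol s hsR]
  · by_contra hne
    have h0 : CauchyFoliation.solution D (C.transferTest D s φ) (C.point t z) ≠ 0 := fun h =>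
      hne (by rw [evolutionTest_apply, h, act_zero])
    obtain ⟨w, hw, h⟩ := C.exists_related_of_solution_ne_zero D h0
    refine hz ⟨C.point t z, hKL _ ⟨(s, w), ⟨abs_le.1 hsR, hw⟩, rfl⟩ _ h ?_ ?_, C.space_point t z⟩
    · rw [C.tau_point]; exact (abs_le.1 ht).1
    · rw [C.tau_point]; exact (abs_le.1 ht).2

lemma eventually_abs_le (p : ℝ × ℝ) :
    ∀ᶠ q in nhds p, |q.1| ≤ |p.1| + |p.2| + 1 ∧ |q.2| ≤ |p.1| + |p.2| + 1 := by
  have h1 : ∀ᶠ q : ℝ × ℝ in nhds p, |q.1| < |p.1| + |p.2| + 1 :=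
    (continuous_abs.comp continuous_fst).continuousAt.eventually_lt continuousAt_const (by
      have := abs_nonneg p.2
      simp only [Function.comp_apply]
      linarith)
  have h2 : ∀ᶠ q : ℝ × ℝ in nhds p, |q.2| < |p.1| + |p.2| + 1 :=
    (continuous_abs.comp continuous_snd).continuousAt.eventually_lt continuousAt_const (by
      have := abs_nonneg p.1
      simp only [Function.comp_apply]
      linarith)
  filter_upwards [h1, h2] with q h1 h2 using ⟨h1.le, h2.le⟩

lemma momentum_eq_zero_of_compl {L : Set Space} (hL : IsClosed L) {f : Space → Spinor}
    (hf : ∀ z ∉ L, f z = 0) (i : Fin 3) : ∀ z ∉ L, momentum i f z = 0 := by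
  intro z hz
  have h : f =ᶠ[nhds z] fun _ => 0 := by
    filter_upwards [hL.isOpen_compl.mem_nhds hz] with y hy using hf y hy
  simp [momentum, pd, h.fderiv_eq]

lemma hamiltonian_eq_zero_of_compl {L : Set Space} (hL : IsClosed L) {f : Space → Spinor}
    (hf : ∀ z ∉ L, f z = 0) (s : ℝ) : ∀ z ∉ L, C.hamiltonian D s f z = 0 := by
  intro z hz
  have h1 := fun i => momentum_eq_zero_of_compl hL hf i z hz
  have h2 := fun i => momentum_eq_zero_of_compl hL
    (f := fun z => act (C.lambdaMatrix D i (C.point s z)) (f z))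
    (fun z hz => by rw [hf z hz, act_zero]) i z hz
  simp [hamiltonian, h1, h2, hf z hz]

lemma oscillator_eq_zero_of_compl {L : Set Space} (hL : IsClosed L) {f : Space → Spinor}
    (hf : ∀ z ∉ L, f z = 0) : ∀ z ∉ L, oscillator f z = 0 := by
  intro z hz
  have h1 := fun i => momentum_eq_zero_of_compl hL (momentum_eq_zero_of_compl hL hf i) i z hz
  simp [oscillator, h1, hf z hz]

lemma continuous_toL2_evolutionTest (φ : TestSpinor) :
    Continuous fun p : ℝ × ℝ => toL2 (C.evolutionTest D p.1 p.2 φ) := by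
  rw [continuous_iff_continuousAt]
  intro p
  obtain ⟨v, hv, L, hL, h⟩ := C.exists_smooth_evolutionTest D φ (|p.1| + |p.2| + 1)
  refine continuousAt_toL2 hL hv.continuous ?_
  filter_upwards [eventually_abs_le p] with q hq z using h q.1 q.2 hq.1 hq.2 z

lemma continuous_toL2_hamiltonianTest (φ : TestSpinor) :
    Continuous fun p : ℝ × ℝ => toL2 (C.hamiltonianTest D p.1 (C.evolutionTest D p.1 p.2 φ)) := by
  rw [continuous_iff_continuousAt]
  intro p
  obtain ⟨v, hv, L, hL, h⟩ := C.exists_smooth_evolutionTest D φ (|p.1| + |p.2| + 1)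
  refine continuousAt_toL2 hL (C.contDiff_hamiltonian_param D contDiff_fst hv).continuous ?_
  filter_upwards [eventually_abs_le p] with q hq z
  have hq' := h q.1 q.2 hq.1 hq.2
  rw [hamiltonianTest_apply]
  refine ⟨?_, C.hamiltonian_eq_zero_of_compl D hL.isClosed (fun z => (hq' z).2) q.1 z⟩
  rw [funext fun z => (hq' z).1]

lemma continuous_toL2_oscillatorTest (φ : TestSpinor) :
    Continuous fun p : ℝ × ℝ => toL2 (oscillatorTest (C.evolutionTest D p.1 p.2 φ)) := by
  rw [continuous_iff_continuousAt]
  intro p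
  obtain ⟨v, hv, L, hL, h⟩ := C.exists_smooth_evolutionTest D φ (|p.1| + |p.2| + 1)
  refine continuousAt_toL2 hL (contDiff_oscillator_param hv).continuous ?_
  filter_upwards [eventually_abs_le p] with q hq z
  have hq' := h q.1 q.2 hq.1 hq.2
  rw [oscillatorTest_apply]
  refine ⟨?_, oscillator_eq_zero_of_compl hL.isClosed (fun z => (hq' z).2) z⟩
  rw [funext fun z => (hq' z).1]

lemma hasDerivAt_toL2_evolutionTest (hF : F.RotationallySymmetric) (φ : TestSpinor) (t s : ℝ) :
    HasDerivAt (fun r => toL2 (C.evolutionTest D r s φ))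
      (-Complex.I • toL2 (C.hamiltonianTest D t (C.evolutionTest D t s φ))) t := by
  obtain ⟨v, hv, L, hL, h⟩ := C.exists_smooth_evolutionTest D φ (|t| + |s| + 1)
  have ht : ∀ r ∈ Metric.ball t 1, |r| ≤ |t| + |s| + 1 := by
    intro r hr
    have h1 : |r - t| < 1 := hr
    have h2 := abs_sub_abs_le_abs_sub r t
    have h3 := abs_nonneg s
    linarith
  have hs : |s| ≤ |t| + |s| + 1 := by
    have h3 := abs_nonneg t
    linarith
  have hw : ContDiff ℝ ∞ fun q : ℝ × Space => v ((q.1, s), q.2) :=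
    hv.comp ((contDiff_fst.prodMk contDiff_const).prodMk contDiff_snd)
  rw [← map_smul]
  refine hasDerivAt_toL2 (f := fun r => C.evolutionTest D r s φ)
    (d := fun r => -Complex.I • C.hamiltonianTest D r (C.evolutionTest D r s φ))
    (g := fun q => -Complex.I • C.hamiltonian D q.1 (fun z => v ((q.1, s), z)) q.2) one_pos hL
    ((C.contDiff_hamiltonian_param D contDiff_id hw).const_smul (-Complex.I)).continuous (fun r hr z => ?_)
    (fun r hr z => ?_) fun r hr z => (h r s (ht r hr) hs z).2
  · have h1 := C.schroedinger D hF
      (CauchyFoliation.isDiracSolution_solution (C.transferTest D s φ)) r z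
    change HasDerivAt _ (-Complex.I • (C.hamiltonianTest D r (C.evolutionTest D r s φ)).1 z) r
    rw [hamiltonianTest_apply]
    exact h1
  · change -Complex.I • (C.hamiltonianTest D r (C.evolutionTest D r s φ)).1 z = _
    rw [hamiltonianTest_apply, funext fun z => (h r s (ht r hr) hs z).1]

/-- Symmetry of the generator makes the two terms in the time derivative of the product cancel, so
the product keeps its value at t = s. -/
lemma inner_toL2_evolutionTest (hF : F.RotationallySymmetric) (φ χ : TestSpinor) (t s : ℝ) :
    inner ℂ (toL2 (C.evolutionTest D t s φ)) (toL2 (C.evolutionTest D t s χ))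
      = inner ℂ (toL2 φ) (toL2 χ) := by
  have hd : ∀ r, HasDerivAt (fun r => inner ℂ (toL2 (C.evolutionTest D r s φ))
      (toL2 (C.evolutionTest D r s χ))) 0 r := by
    intro r
    refine ((C.hasDerivAt_toL2_evolutionTest D hF φ r s).inner ℂ
      (C.hasDerivAt_toL2_evolutionTest D hF χ r s)).congr_deriv ?_
    rw [inner_smul_left, inner_smul_right, hamiltonianTest_symmetric]
    simp
  have h := is_const_of_deriv_eq_zero (fun r => (hd r).differentiableAt) (fun r => (hd r).deriv) t s
  simpa only [evolutionTest_self] using h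

end AdaptedCoordinates

namespace CauchyFoliation

variable (D : DiracMatrices) (F : CauchyFoliation)

/-- Current conservation is obtained from the Schrödinger form in the coordinates (τ, 𝐱), instead of
from the divergence theorem. -/
lemma prod_evolution (hF : F.RotationallySymmetric) (t s : ℝ) (f g : F.TestSpinor s) :
    F.prod D t (evolution D F t s f).1 (evolution D F t s g).1 = F.prod D s f.1 g.1 := by
  have key : ∀ φ χ : DiracFoliation.TestSpinor,
      F.prod D t (evolution D F t s (F.canonicalCoordinates.transferTest D s φ)).1
        (evolution D F t s (F.canonicalCoordinates.transferTest D s χ)).1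
      = F.prod D s (F.canonicalCoordinates.transferTest D s φ).1
        (F.canonicalCoordinates.transferTest D s χ).1 := by
    intro φ χ
    rw [← AdaptedCoordinates.transferTest_evolutionTest,
      ← AdaptedCoordinates.transferTest_evolutionTest]
    simp only [AdaptedCoordinates.transferTest_apply, AdaptedCoordinates.prod_transferFn]
    rw [← inner_toL2, ← inner_toL2, AdaptedCoordinates.inner_toL2_evolutionTest D _ hF]
  have h := key ((F.canonicalCoordinates.transferTest D s).symm f)
    ((F.canonicalCoordinates.transferTest D s).symm g)
  simpa only [LinearEquiv.apply_symm_apply] using h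

lemma norm_toHilbert_evolution (hF : F.RotationallySymmetric) (t s : ℝ) (f : F.TestSpinor s) :
    ‖F.toHilbert D t (evolution D F t s f)‖ = ‖F.toHilbert D s f‖ := by
  rw [norm_eq_sqrt_re_inner (𝕜 := ℂ), norm_eq_sqrt_re_inner (𝕜 := ℂ), inner_toHilbert,
    inner_toHilbert, prod_evolution D F hF]

/-- The unitary Dirac evolution between the Hilbert spaces of two Cauchy surfaces. -/
def evolutionUnitary (hF : F.RotationallySymmetric) (t s : ℝ) :
    F.Hilbert D s ≃ₗᵢ[ℂ] F.Hilbert D t :=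
  have := completeSpace_hilbert D F s
  have := completeSpace_hilbert D F t
  (evolution D F t s).extendOfIsometry (F.toHilbert D s) (F.toHilbert D t)
    (denseRange_toHilbert D F s) (denseRange_toHilbert D F t) (norm_toHilbert_evolution D F hF t s)

lemma evolutionUnitary_toHilbert (hF : F.RotationallySymmetric) (t s : ℝ) (f : F.TestSpinor s) :
    evolutionUnitary D F hF t s (F.toHilbert D s f) = F.toHilbert D t (evolution D F t s f) :=
  have := completeSpace_hilbert D F s
  have := completeSpace_hilbert D F t
  LinearEquiv.extendOfIsometry_eq _ _ _ (denseRange_toHilbert D F s) (denseRange_toHilbert D F t)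
    (norm_toHilbert_evolution D F hF t s) f

end CauchyFoliation

end

section

/-! ### The unitary evolution in adapted coordinates -/

namespace AdaptedCoordinates

variable (D : DiracMatrices) {F : CauchyFoliation} (hF : F.RotationallySymmetric)
  (C : AdaptedCoordinates F)

/-- The unitary Dirac evolution on `ℂ⁴ ⊗ L²(ℝ³)`. -/
def evolutionL2 (t s : ℝ) : L2Spinor ≃ₗᵢ[ℂ] L2Spinor :=
  (C.transferUnitary D s).trans
    ((CauchyFoliation.evolutionUnitary D F hF t s).trans (C.transferUnitary D t).symm)

lemma evolutionL2_apply (t s : ℝ) (χ : L2Spinor) :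
    C.evolutionL2 D hF t s χ = (C.transferUnitary D t).symm
      (CauchyFoliation.evolutionUnitary D F hF t s (C.transferUnitary D s χ)) := rfl

lemma evolutionL2_toL2 (t s : ℝ) (φ : TestSpinor) :
    C.evolutionL2 D hF t s (toL2 φ) = toL2 (C.evolutionTest D t s φ) := by
  rw [evolutionL2_apply, transferUnitary_toL2, CauchyFoliation.evolutionUnitary_toHilbert,
    ← transferTest_evolutionTest, ← transferUnitary_toL2, LinearIsometryEquiv.symm_apply_apply]

lemma evolutionL2_self (s : ℝ) (χ : L2Spinor) : C.evolutionL2 D hF s s χ = χ := by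
  refine congrFun (denseRange_toL2.equalizer (C.evolutionL2 D hF s s).continuous continuous_id
    (funext fun φ => ?_)) χ
  simp only [Function.comp_apply, evolutionL2_toL2, evolutionTest_self, id]

lemma evolutionL2_evolutionL2 (t r s : ℝ) (χ : L2Spinor) :
    C.evolutionL2 D hF t r (C.evolutionL2 D hF r s χ) = C.evolutionL2 D hF t s χ := by
  refine congrFun (denseRange_toL2.equalizer
    ((C.evolutionL2 D hF t r).continuous.comp (C.evolutionL2 D hF r s).continuous)
    (C.evolutionL2 D hF t s).continuous (funext fun φ => ?_)) χ
  simp only [Function.comp_apply, evolutionL2_toL2, evolutionTest_evolutionTest]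

/-- The operators are uniformly 1-Lipschitz and depend continuously on (t, s) on a dense set. -/
lemma continuous_evolutionL2 : Continuous fun q : (ℝ × ℝ) × L2Spinor =>
    C.evolutionL2 D hF q.1.1 q.1.2 q.2 := by
  refine continuous_prod_of_dense_continuous_lipschitzWith' _ 1 denseRange_toL2
    (fun p => (C.evolutionL2 D hF p.1 p.2).lipschitz) ?_
  rintro - ⟨φ, rfl⟩
  simp only [evolutionL2_toL2]
  exact C.continuous_toL2_evolutionTest D φ

lemma continuous_evolutionL2_left (χ : L2Spinor) :
    Continuous fun p : ℝ × ℝ => C.evolutionL2 D hF p.1 p.2 χ :=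
  Continuous.comp (g := fun q : (ℝ × ℝ) × L2Spinor => C.evolutionL2 D hF q.1.1 q.1.2 q.2)
    (f := fun p => (p, χ)) (C.continuous_evolutionL2 D hF) (continuous_id.prodMk continuous_const)

lemma inner_evolutionL2 (t s : ℝ) (χ χ' : L2Spinor) :
    inner ℂ χ (C.evolutionL2 D hF t s χ') = inner ℂ (C.evolutionL2 D hF s t χ) χ' := by
  rw [← (C.evolutionL2 D hF s t).inner_map_map, evolutionL2_evolutionL2, evolutionL2_self]

lemma hasDerivAt_evolutionL2_left (φ : TestSpinor) (t s : ℝ) :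
    HasDerivAt (fun r => C.evolutionL2 D hF r s (toL2 φ))
      (-Complex.I • toL2 (C.hamiltonianTest D t (C.evolutionTest D t s φ))) t := by
  simp only [evolutionL2_toL2]
  exact C.hasDerivAt_toL2_evolutionTest D hF φ t s

/-- By the evolution law the difference quotient in s equals -U(t, r) applied to that of U(r, s)φ at
r = s; joint continuity of the evolution allows passage to the limit. -/
lemma hasDerivAt_evolutionL2_right (φ : TestSpinor) (t s : ℝ) :
    HasDerivAt (fun r => C.evolutionL2 D hF t r (toL2 φ))
      (Complex.I • C.evolutionL2 D hF t s (toL2 (C.hamiltonianTest D s φ))) s := by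
  have h := C.hasDerivAt_evolutionL2_left D hF φ s s
  rw [evolutionTest_self, hasDerivAt_iff_tendsto_slope] at h
  rw [hasDerivAt_iff_tendsto_slope]
  have hp : Filter.Tendsto (fun r : ℝ => (t, r)) (nhdsWithin s {s}ᶜ) (nhds (t, s)) :=
    ((Continuous.prodMk_right t).tendsto s).mono_left nhdsWithin_le_nhds
  have h1 := (((C.continuous_evolutionL2 D hF).tendsto _).comp (hp.prodMk_nhds h)).neg
  have e : -C.evolutionL2 D hF t s (-Complex.I • toL2 (C.hamiltonianTest D s φ))
      = Complex.I • C.evolutionL2 D hF t s (toL2 (C.hamiltonianTest D s φ)) := by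
    rw [map_smul, neg_smul, neg_neg]
  rw [← e]
  refine h1.congr fun r => ?_
  simp only [Function.comp_apply, slope, vsub_eq_sub]
  rw [evolutionL2_self, show ∀ v, C.evolutionL2 D hF t r ((r - s)⁻¹ • v)
    = (r - s)⁻¹ • C.evolutionL2 D hF t r v from
      map_smul ((C.evolutionL2 D hF t r).toLinearEquiv.toLinearMap.restrictScalars ℝ) _,
    map_sub, evolutionL2_evolutionL2, ← smul_neg, neg_sub]

lemma continuous_hamiltonianTest (φ : TestSpinor) :
    Continuous fun s => toL2 (C.hamiltonianTest D s φ) := by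
  have h := (C.continuous_toL2_hamiltonianTest D φ).comp (continuous_id.prodMk continuous_id)
  simpa only [Function.comp_def, id, evolutionTest_self] using h

/-- Both partial derivatives exist and are continuous in (t, s), which gives continuous
differentiability. -/
lemma contDiff_evolutionL2 (φ : TestSpinor) :
    ContDiff ℝ 1 fun p : ℝ × ℝ => C.evolutionL2 D hF p.1 p.2 (toL2 φ) := by
  set f₁ : ℝ → ℝ → ℝ →L[ℝ] L2Spinor := fun t s => ContinuousLinearMap.toSpanSingleton ℝ
    (-Complex.I • toL2 (C.hamiltonianTest D t (C.evolutionTest D t s φ))) with hf₁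
  set f₂ : ℝ → ℝ → ℝ →L[ℝ] L2Spinor := fun t s => ContinuousLinearMap.toSpanSingleton ℝ
    (Complex.I • C.evolutionL2 D hF t s (toL2 (C.hamiltonianTest D s φ))) with hf₂
  have hc : Continuous fun v : L2Spinor => ContinuousLinearMap.toSpanSingleton ℝ v :=
    (ContinuousLinearMap.toSpanSingletonCLE (𝕜 := ℝ) (E := L2Spinor)).continuous
  have h₁ : Continuous fun p : ℝ × ℝ => f₁ p.1 p.2 :=
    hc.comp ((C.continuous_toL2_hamiltonianTest D φ).const_smul (-Complex.I))
  have h₂ : Continuous fun p : ℝ × ℝ => f₂ p.1 p.2 :=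
    hc.comp (((C.continuous_evolutionL2 D hF).comp (continuous_id.prodMk
      ((C.continuous_hamiltonianTest D φ).comp continuous_snd))).const_smul Complex.I)
  rw [contDiff_one_iff_hasFDerivAt]
  refine ⟨fun p => (f₁ p.1 p.2).coprod (f₂ p.1 p.2), ?_, fun p => ?_⟩
  · have e : ∀ p : ℝ × ℝ, (f₁ p.1 p.2).coprod (f₂ p.1 p.2)
        = (f₁ p.1 p.2).comp (ContinuousLinearMap.fst ℝ ℝ ℝ)
          + (f₂ p.1 p.2).comp (ContinuousLinearMap.snd ℝ ℝ ℝ) := by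
      intro p; ext <;> simp
    simp only [e]
    exact (h₁.clm_comp continuous_const).add (h₂.clm_comp continuous_const)
  · exact (hasStrictFDerivAt_uncurry_coprod
      (f := fun t s => C.evolutionL2 D hF t s (toL2 φ)) (f₁ := f₁) (f₂ := f₂)
      (Filter.Eventually.of_forall fun q =>
        (C.hasDerivAt_evolutionL2_left D hF φ q.1 q.2).hasFDerivAt)
      (Filter.Eventually.of_forall fun q =>
        (C.hasDerivAt_evolutionL2_right D hF φ q.1 q.2).hasFDerivAt)
      h₁.continuousAt h₂.continuousAt).hasFDerivAt

lemma causallyRelated_symm {x y : Minkowski} (h : CausallyRelated x y) : CausallyRelated y x := by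
  simp only [CausallyRelated] at h ⊢
  rw [sub_sq_comm (y 0)]
  simpa only [sub_sq_comm (y _)] using h

lemma isOpen_not_related (t s : ℝ) {A : Set Space} (hA : IsClosed A) :
    IsOpen {z : Space | ∀ w ∈ A, ¬ CausallyRelated (C.point t z) (C.point s w)} := by
  rw [← isClosed_compl_iff]
  refine (congrArg IsClosed (Set.ext fun z => ?_)).mpr
    ((CauchyFoliation.isClosed_related_slice F (hA.preimage C.contDiff_space.continuous)
      s).preimage (C.contDiff_point_right t).continuous)
  simp only [Set.mem_compl_iff, Set.mem_ofPred_eq, Set.mem_preimage, not_forall, not_not]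
  constructor
  · rintro ⟨w, hw, h⟩
    exact ⟨C.point s w, by rwa [C.space_point], C.tau_point s w, h⟩
  · rintro ⟨y, hy, hys, h⟩
    exact ⟨C.space y, hy, by rwa [C.point_space hys]⟩

/-- By duality: a test function φ supported in the unrelated open set evolves back to one that
vanishes on A, so its product with χ, and hence that of φ with U(t, s)χ, is zero. -/
lemma evolutionL2_causal (t s : ℝ) (χ : L2Spinor) {A : Set Space} (hA : IsClosed A)
    (hχ : ∀ᵐ w, w ∉ A → χ w = 0) :
    ∀ᵐ z, (∀ w ∈ A, ¬ CausallyRelated (C.point t z) (C.point s w)) →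
      C.evolutionL2 D hF t s χ z = 0 := by
  have hloc : LocallyIntegrable (C.evolutionL2 D hF t s χ) (volume : Measure Space) :=
    (Lp.memLp _).locallyIntegrable (by norm_num)
  refine (C.isOpen_not_related t s hA).ae_eq_zero_of_integral_contDiff_smul_eq_zero
    (hloc.locallyIntegrableOn _) fun g hg hgc hgO => ?_
  refine ext_inner_left ℂ fun v => ?_
  rw [inner_zero_right, ← integral_inner
    (hloc.integrable_smul_left_of_hasCompactSupport hg.continuous hgc)]
  set φ : TestSpinor := ⟨fun z => g z • v, hg.smul contDiff_const, hgc.smul_right⟩ with hφ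
  have h1 : ∫ z, inner ℂ v (g z • C.evolutionL2 D hF t s χ z)
      = inner ℂ (toL2 φ) (C.evolutionL2 D hF t s χ) := by
    rw [L2.inner_def]
    refine integral_congr_ae ?_
    filter_upwards [toL2_coeFn φ] with z hz
    rw [hz]
    change _ = inner ℂ (g z • v) _
    rw [← Complex.coe_smul, ← Complex.coe_smul, inner_smul_left, inner_smul_right,
      Complex.conj_ofReal]
  rw [h1, inner_evolutionL2, evolutionL2_toL2, L2.inner_def]
  refine integral_eq_zero_of_ae ?_
  filter_upwards [toL2_coeFn (C.evolutionTest D s t φ), hχ] with w hw hw2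
  rw [hw, Pi.zero_apply]
  by_cases hwA : w ∈ A
  · by_cases h0 : (C.evolutionTest D s t φ).1 w = 0
    · rw [h0, inner_zero_left]
    · obtain ⟨z, hz, hzw⟩ := C.evolutionTest_causal D s t φ w (subset_tsupport _ h0)
      have hzg : z ∈ tsupport g :=
        closure_mono (Function.support_smul_subset_left g fun _ => v) hz
      exact absurd (causallyRelated_symm hzw) (hgO hzg w hwA)
  · rw [hw2 hwA, inner_zero_right]

end AdaptedCoordinates

end

end DiracFoliation

end

/-! ### Assembly of the theorem. -/

theorem theorem2p1 (D : DiracMatrices) (F : CauchyFoliation) (hF : F.RotationallySymmetric) :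
    ∃ (US : ∀ t s : ℝ, F.TestSpinor s ≃ₗ[ℂ] F.TestSpinor t)
      (UH : ∀ t s : ℝ, F.Hilbert D s ≃ₗᵢ[ℂ] F.Hilbert D t),
      -- `US` is the free Dirac evolution: the Cauchy problem is uniquely solvable, and
      -- `US t s` takes the restriction of a solution to `Σ_s` to its restriction to `Σ_t`
      (∀ (s : ℝ) (f : F.TestSpinor s),
        ∃! ψ : Minkowski → Spinor, IsDiracSolution D ψ ∧ ∀ x : F.Slice s, ψ x = f.1 x) ∧
      (∀ (t s : ℝ) (f : F.TestSpinor s) (ψ : Minkowski → Spinor), IsDiracSolution D ψ →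
        (∀ x : F.Slice s, ψ x = f.1 x) → ∀ x : F.Slice t, (US t s f).1 x = ψ x) ∧
      -- it is isometric
      (∀ (t s : ℝ) (f g : F.TestSpinor s),
        F.prod D t (US t s f).1 (US t s g).1 = F.prod D s f.1 g.1) ∧
      -- it respects causality
      (∀ (t s : ℝ) (f : F.TestSpinor s), ∀ x ∈ tsupport (US t s f).1,
        ∃ y ∈ tsupport f.1, CausallyRelated x.1 y.1) ∧
      -- it extends by continuity to unitary operators between Hilbert spaces
      (∀ s : ℝ, CompleteSpace (F.Hilbert D s)) ∧
      (∀ s : ℝ, DenseRange (F.toHilbert D s)) ∧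
      (∀ (t s : ℝ) (f : F.TestSpinor s),
        UH t s (F.toHilbert D s f) = F.toHilbert D t (US t s f)) ∧
      -- the evolution in adapted coordinates
      ∀ C : AdaptedCoordinates F,
        ∃ (T : ∀ s : ℝ, L2Spinor ≃ₗᵢ[ℂ] F.Hilbert D s)
          (U : ∀ _ _ : ℝ, L2Spinor ≃ₗᵢ[ℂ] L2Spinor)
          (V : ∀ _ _ : ℝ, TestSpinor ≃ₗ[ℂ] TestSpinor)
          (H : ℝ → TestSpinor →ₗ[ℂ] TestSpinor)
          (h : TestSpinor →ₗ[ℂ] TestSpinor),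
          -- `T s` is multiplication by `|g_z|^{-1/4} K`
          (∀ (s : ℝ) (χ : L2Spinor), ∀ᵐ x ∂F.surfMeasure s,
            (T s χ).fn x = act (C.transfer D x.1) (χ (C.space x.1))) ∧
          (∀ (t s : ℝ) (χ : L2Spinor), U t s χ = (T t).symm (UH t s (T s χ))) ∧
          -- `H s` and `h` are the operators `H₀(s)` and `h₀` on `C₀^∞`
          (∀ (s : ℝ) (φ : TestSpinor) (z : Space), (H s φ).1 z = C.hamiltonian D s φ.1 z) ∧
          (∀ (φ : TestSpinor) (z : Space), (h φ).1 z = oscillator φ.1 z) ∧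
          -- strongly continuous evolution system
          (∀ (s : ℝ) (χ : L2Spinor), U s s χ = χ) ∧
          (∀ (t r s : ℝ) (χ : L2Spinor), U t r (U r s χ) = U t s χ) ∧
          (∀ χ : L2Spinor, Continuous fun p : ℝ × ℝ => U p.1 p.2 χ) ∧
          -- (A) `U t s` maps `C₀^∞` onto itself (as the bijection `V t s`), and causality
          (∀ (t s : ℝ) (φ : TestSpinor), U t s (toL2 φ) = toL2 (V t s φ)) ∧
          (∀ (t s : ℝ) (φ : TestSpinor), ∀ z ∈ tsupport (V t s φ).1,
            ∃ w ∈ tsupport φ.1, CausallyRelated (C.point t z) (C.point s w)) ∧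
          (∀ (t s : ℝ) (χ : L2Spinor) (A : Set Space), IsClosed A →
            (∀ᵐ w, w ∉ A → χ w = 0) →
            ∀ᵐ z, (∀ w ∈ A, ¬ CausallyRelated (C.point t z) (C.point s w)) → U t s χ z = 0) ∧
          -- (B)
          (∀ φ : TestSpinor,
            Continuous (fun p : ℝ × ℝ => toL2 (H p.1 (V p.1 p.2 φ))) ∧
            Continuous (fun p : ℝ × ℝ => toL2 (h (V p.1 p.2 φ))) ∧
            ContDiff ℝ 1 (fun p : ℝ × ℝ => U p.1 p.2 (toL2 φ)) ∧
            ∀ t s : ℝ,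
              (∃ d : L2Spinor, HasDerivAt (fun t' => U t' s (toL2 φ)) d t ∧
                Complex.I • d = toL2 (H t (V t s φ))) ∧
              (∃ d : L2Spinor, HasDerivAt (fun s' => U t s' (toL2 φ)) d s ∧
                Complex.I • d = -U t s (toL2 (H s φ)))) ∧
          -- (C)
          (∀ (s : ℝ) (φ χ : TestSpinor),
            inner ℂ (toL2 (H s φ)) (toL2 χ) = inner ℂ (toL2 φ) (toL2 (H s χ))) := by
  refine ⟨CauchyFoliation.evolution D F, CauchyFoliation.evolutionUnitary D F hF,
    fun s f => CauchyFoliation.existsUnique_solution D f, fun t s f ψ hψ h x => ?_,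
    CauchyFoliation.prod_evolution D F hF, fun t s f => CauchyFoliation.evolve_causal f,
    CauchyFoliation.completeSpace_hilbert D F, CauchyFoliation.denseRange_toHilbert D F,
    CauchyFoliation.evolutionUnitary_toHilbert D F hF, fun C => ?_⟩
  · rw [CauchyFoliation.eq_solution hψ h]
    rfl
  · refine ⟨C.transferUnitary D, C.evolutionL2 D hF, C.evolutionTest D, C.hamiltonianTest D,
      oscillatorTest, C.transferUnitary_fn D, fun _ _ _ => rfl, C.hamiltonianTest_apply D,
      oscillatorTest_apply, C.evolutionL2_self D hF, C.evolutionL2_evolutionL2 D hF,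
      C.continuous_evolutionL2_left D hF,
      C.evolutionL2_toL2 D hF, C.evolutionTest_causal D,
      fun t s χ A hA hχ => C.evolutionL2_causal D hF t s χ hA hχ, fun φ => ?_,
      C.hamiltonianTest_symmetric D⟩
    refine ⟨C.continuous_toL2_hamiltonianTest D φ, C.continuous_toL2_oscillatorTest D φ,
      C.contDiff_evolutionL2 D hF φ, fun t s =>
        ⟨⟨_, C.hasDerivAt_evolutionL2_left D hF φ t s, ?_⟩,
          ⟨_, C.hasDerivAt_evolutionL2_right D hF φ t s, ?_⟩⟩⟩
    · rw [smul_smul, mul_neg, Complex.I_mul_I, neg_neg, one_smul]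
    · rw [smul_smul, Complex.I_mul_I, neg_one_smul]
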